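/- Let $K$ be a field of characteristic $0$, let $M$ be a smooth algebraic variety over $K$ (a smooth separated $K$-scheme of finite type), and let $Z\subseteq M$ be a closed subvariety, smooth over $K$, all of whose irreducible components have codimension at most $2$ in $M$. Let $I_Z\subseteq\mathcal O_M$ be its ideal sheaf and let $k\ge 0$. For a coherent sheaf $F$ on $M$, $LSym^k(F)$ denotes the derived $S_k$-invariants of the $k$-fold derived tensor power of $F$: if $E_\bullet\to F$ is a resolution by locally free sheaves, $LSym^k(F)$ is the complex $(E_\bullet^{\otimes k})^{S_k}$, where $S_k$ permutes the factors with the Koszul signs. Then the multiplication map $$LSym^k(I_Z)\longrightarrow I_Z^k$$ is a quasi-isomorphism. Explicitly: for every resolution $\varepsilon: E_\bullet\to I_Z$ by locally free $\mathcal O_M$-modules, the map of complexes $(E_\bullet^{\otimes k})^{S_k}\to I_Z^k$ given in degree $0$ by $x_1\otimes\cdots\otimes x_k\mapsto \varepsilon(x_1)\cdots\varepsilon(x_k)$ is a quasi-isomorphism. Moreover, the following explicit local form holds. Let $R$ be a commutative ring, $(x_1,x_2)$ a regular sequence in $R$, $I=(x_1,x_2)$, $V$ a free $R$-module with basis $e_1,e_2$,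 $d:V\to R$ the linear map with $d(e_i)=x_i$, and $k\ge 1$. Then the sequence $$0\to \wedge^2 V\otimes_R \mathrm{Sym}^{k-1}(V)\to \mathrm{Sym}^k(V)\to I^k\to 0$$ is exact, where the first map is $(a\wedge b)\otimes\alpha\mapsto d(b)\,a\alpha-d(a)\,b\alpha$ and the second sends a product $v_1\cdots v_k$ to $d(v_1)\cdots d(v_k)$. -/

import Mathlib

open CategoryTheory AlgebraicGeometry TopologicalSpace
open scoped TensorProduct DirectSum

universe u v

noncomputable section

namespace DerivedSymmetricPower

section Algebra

variable (A : Type u) [CommRing A] (E : ℕ → Type u) [∀ n, AddCommGroup (E n)]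
  [∀ n, Module A (E n)]

/-- The total module `⨁ₙ Eₙ` of a chain complex `⋯ → E₁ → E₀` of `A`-modules. -/
abbrev Tot : Type u := ⨁ n, E n

/-- The involution of `⨁ₙ Eₙ` which is multiplication by `(-1)ⁿ` on `Eₙ`. -/
def signInv : Tot E →ₗ[A] Tot E :=
  DirectSum.lmap fun n => (-1 : A) ^ n • (LinearMap.id : E n →ₗ[A] E n)

/-- The projection of `⨁ₙ Eₙ` onto the sum of the `Eₙ` with `n` of parity `p`. -/
def parityProj (p : ZMod 2) : Tot E →ₗ[A] Tot E :=
  DirectSum.lmap fun n => if (n : ZMod 2) = p then (LinearMap.id : E n →ₗ[A] E n) else 0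

variable {A E} in
/-- The differential of the complex `⋯ → E₁ → E₀ → 0` as an endomorphism of `⨁ₙ Eₙ`. -/
def totD (d : ∀ n, E (n + 1) →ₗ[A] E n) : Tot E →ₗ[A] Tot E :=
  DirectSum.toModule A ℕ (Tot E) fun n =>
    match n with
    | 0 => 0
    | n + 1 => (DirectSum.lof A ℕ E n).comp (d n)

/-- The `k`-fold tensor power over `A` of the total module of the complex. -/
abbrev TPow (k : ℕ) : Type u := ⨂[A] (_ : Fin k), Tot E

variable {A E} in
/-- The differential of the `k`-fold tensor power of the complex `E`:
`x₁ ⊗ ⋯ ⊗ x_k ↦ ∑ⱼ (-1)^{|x₁| + ⋯ + |x_{j-1}|} x₁ ⊗ ⋯ ⊗ d xⱼ ⊗ ⋯ ⊗ x_k`. -/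
def tensorD (d : ∀ n, E (n + 1) →ₗ[A] E n) (k : ℕ) : TPow A E k →ₗ[A] TPow A E k :=
  ∑ j : Fin k, PiTensorProduct.map fun i =>
    if i < j then signInv A E else if i = j then totD d else LinearMap.id

/-- The sign attached to a permutation `π` of factors of parities `p`: a factor `-1` for every pair
of odd factors whose order is reversed by `π`. -/
def koszulSign {k : ℕ} (π : Equiv.Perm (Fin k)) (p : Fin k → ZMod 2) : ℤ :=
  ∏ i : Fin k, ∏ j : Fin k, if i < j ∧ π j < π i ∧ p i = 1 ∧ p j = 1 then -1 else 1

/-- The action of a permutation `π` on the `k`-fold tensor power of a complex, with the Koszul sign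
rule: on homogeneous elements, `x₁ ⊗ ⋯ ⊗ x_k` is sent to `±1` times the tensor whose factor at the
place `π i` is `xᵢ`, see `permAct_homTensor`. -/
def permAct {k : ℕ} (π : Equiv.Perm (Fin k)) : TPow A E k →ₗ[A] TPow A E k :=
  ∑ p : Fin k → ZMod 2, (koszulSign π p : A) •
    ((PiTensorProduct.reindex A (fun _ => Tot E) π).toLinearMap.comp
      (PiTensorProduct.map fun i => parityProj A E (p i)))

variable {E} in
/-- A tensor product of homogeneous elements. -/
def homTensor {k : ℕ} (a : Fin k → ℕ) (x : ∀ i, E (a i)) : TPow A E k :=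
  PiTensorProduct.tprod A fun i => DirectSum.lof A ℕ E (a i) (x i)

/-- The part of degree `n` of the `k`-fold tensor power of the complex. -/
def degPart (k n : ℕ) : Submodule A (TPow A E k) :=
  Submodule.span A {z | ∃ (a : Fin k → ℕ) (x : ∀ i, E (a i)), ∑ i, a i = n ∧ z = homTensor A a x}

/-- The part of degree `n` of `(E^{⊗ k})^{S_k}`. -/
def symPart (k n : ℕ) : Submodule A (TPow A E k) where
  carrier := {z | z ∈ degPart A E k n ∧ ∀ π : Equiv.Perm (Fin k), permAct A E π z = z}
  add_mem' hx hy := ⟨add_mem hx.1 hy.1, fun π => by rw [map_add, hx.2, hy.2]⟩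
  zero_mem' := ⟨zero_mem _, fun π => map_zero _⟩
  smul_mem' r _ hx := ⟨Submodule.smul_mem _ r hx.1, fun π => by rw [map_smul, hx.2]⟩

variable {A E}

lemma signInv_lof (n : ℕ) (x : E n) :
    signInv A E (DirectSum.lof A ℕ E n x) = (-1 : A) ^ n • DirectSum.lof A ℕ E n x := by
  simp [signInv]

lemma parityProj_lof (p : ZMod 2) (n : ℕ) (x : E n) :
    parityProj A E p (DirectSum.lof A ℕ E n x) =
      if (n : ZMod 2) = p then DirectSum.lof A ℕ E n x else 0 := by
  simp only [parityProj, DirectSum.lmap_lof]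
  split_ifs <;> simp

lemma totD_lof_zero (d : ∀ n, E (n + 1) →ₗ[A] E n) (x : E 0) :
    totD d (DirectSum.lof A ℕ E 0 x) = 0 := by
  simp [totD]

lemma totD_lof_succ (d : ∀ n, E (n + 1) →ₗ[A] E n) (n : ℕ) (x : E (n + 1)) :
    totD d (DirectSum.lof A ℕ E (n + 1) x) = DirectSum.lof A ℕ E n (d n x) := by
  simp [totD]

lemma tpow_hom_ext {M : Type*} [AddCommGroup M] [Module A M] {k : ℕ}
    {f g : TPow A E k →ₗ[A] M}
    (h : ∀ (a : Fin k → ℕ) (x : ∀ i, E (a i)), f (homTensor A a x) = g (homTensor A a x)) :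
    f = g := by
  apply PiTensorProduct.ext
  apply MultilinearMap.directSum_ext
  intro a
  ext x
  exact h a x

lemma permAct_tprod {k : ℕ} (π : Equiv.Perm (Fin k)) (p : Fin k → ZMod 2) (t : Fin k → Tot E)
    (ht : ∀ i q, parityProj A E q (t i) = if p i = q then t i else 0) :
    permAct A E π (PiTensorProduct.tprod A t) =
      (koszulSign π p : A) • PiTensorProduct.tprod A fun i => t (π.symm i) := by
  rw [permAct, LinearMap.sum_apply, Finset.sum_eq_single p]
  · rw [LinearMap.smul_apply, LinearMap.comp_apply, PiTensorProduct.map_tprod,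
      LinearEquiv.coe_coe, PiTensorProduct.reindex_tprod]
    simp only [ht, if_true]
  · intro q _ hq
    obtain ⟨i, hi⟩ := Function.ne_iff.mp hq
    have : PiTensorProduct.map (fun i => parityProj A E (q i)) (PiTensorProduct.tprod A t) = 0 := by
      rw [PiTensorProduct.map_tprod]
      apply MultilinearMap.map_coord_zero _ i
      rw [ht, if_neg (Ne.symm hi)]
    rw [LinearMap.smul_apply, LinearMap.comp_apply, this, map_zero, smul_zero]
  · exact fun h => absurd (Finset.mem_univ _) h

/-- The Koszul sign rule for the action of permutations on homogeneous elements. -/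
lemma permAct_homTensor {k : ℕ} (π : Equiv.Perm (Fin k)) (a : Fin k → ℕ) (x : ∀ i, E (a i)) :
    permAct A E π (homTensor A a x) =
      (koszulSign π (fun i => (a i : ZMod 2)) : A) •
        homTensor A (fun i => a (π.symm i)) (fun i => x (π.symm i)) :=
  permAct_tprod π _ _ fun _ _ => parityProj_lof _ _ _

lemma tensorD_homTensor (d : ∀ n, E (n + 1) →ₗ[A] E n) {k : ℕ} (a : Fin k → ℕ)
    (x : ∀ i, E (a i)) :
    tensorD d k (homTensor A a x) = ∑ j, (∏ i, if i < j then (-1 : A) ^ a i else 1) •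
      PiTensorProduct.tprod A (Function.update (fun i => DirectSum.lof A ℕ E (a i) (x i)) j
        (totD d (DirectSum.lof A ℕ E (a j) (x j)))) := by
  rw [tensorD, LinearMap.sum_apply]
  refine Finset.sum_congr rfl fun j _ => ?_
  rw [homTensor, PiTensorProduct.map_tprod, ← MultilinearMap.map_smul_univ]
  congr 1
  ext1 i
  rcases lt_trichotomy i j with h | rfl | h
  · simp [h, h.ne, signInv_lof]
  · simp
  · simp [h.not_gt, h.ne']

lemma homTensor_update {k : ℕ} (a : Fin k → ℕ) (x : ∀ i, E (a i)) (j : Fin k) (m : ℕ) (y : E m) :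
    ∃ x' : ∀ i, E (Function.update a j m i),
      PiTensorProduct.tprod A (Function.update (fun i => DirectSum.lof A ℕ E (a i) (x i)) j
        (DirectSum.lof A ℕ E m y)) = homTensor A (Function.update a j m) x' := by
  refine ⟨fun i => if h : i = j then cast (by rw [h]; simp) y
    else cast (by simp [Function.update_of_ne h]) (x i), ?_⟩
  rw [homTensor]
  congr 1
  ext1 i
  by_cases h : i = j
  · subst h
    have : ∀ (n : ℕ) (e : n = m), DirectSum.lof A ℕ E m y =
      DirectSum.lof A ℕ E n (cast (by rw [e]) y) := by rintro _ rfl; rfl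
    simpa using this _ (Function.update_self i m a)
  · have : ∀ (n : ℕ) (e : n = a i), DirectSum.lof A ℕ E (a i) (x i) =
      DirectSum.lof A ℕ E n (cast (by rw [e]) (x i)) := by rintro _ rfl; rfl
    simpa [h] using this _ (Function.update_of_ne h m a)

lemma tensorD_mem_degPart (d : ∀ n, E (n + 1) →ₗ[A] E n) {k n : ℕ} {z : TPow A E k}
    (hz : z ∈ degPart A E k (n + 1)) : tensorD d k z ∈ degPart A E k n := by
  revert z
  suffices degPart A E k (n + 1) ≤ (degPart A E k n).comap (tensorD d k) from fun z hz => this hz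
  refine Submodule.span_le.mpr ?_
  rintro _ ⟨a, x, ha, rfl⟩
  simp only [Submodule.comap_coe, Set.mem_preimage, SetLike.mem_coe]
  rw [tensorD_homTensor]
  refine Submodule.sum_mem _ fun j _ => Submodule.smul_mem _ _ ?_
  obtain ⟨m, y, hy⟩ : ∃ (m : ℕ) (y : E m), (m + 1 = a j ∧
      totD d (DirectSum.lof A ℕ E (a j) (x j)) = DirectSum.lof A ℕ E m y) ∨
      totD d (DirectSum.lof A ℕ E (a j) (x j)) = 0 := by
    generalize x j = y
    revert y
    cases a j with
    | zero => exact fun y => ⟨0, y, Or.inr (totD_lof_zero d y)⟩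
    | succ m => exact fun y => ⟨m, d m y, Or.inl ⟨rfl, totD_lof_succ d m y⟩⟩
  rcases hy with ⟨hm, hy⟩ | hy
  · rw [hy]
    obtain ⟨x', hx'⟩ := homTensor_update (A := A) a x j m y
    rw [hx']
    refine Submodule.subset_span ⟨_, x', ?_, rfl⟩
    have h1 := Finset.sum_update_of_mem (Finset.mem_univ j) a m
    have h2 := Finset.add_sum_erase Finset.univ a (Finset.mem_univ j)
    rw [Finset.sdiff_singleton_eq_erase] at h1
    omega
  · rw [hy, MultilinearMap.map_coord_zero _ j (by simp)]
    exact zero_mem _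

lemma koszulSign_update {k : ℕ} (π : Equiv.Perm (Fin k)) (p : Fin k → ZMod 2) (j : Fin k) :
    koszulSign π p * (∏ i, if π i < π j ∧ p i = 1 then -1 else 1) =
      (∏ i, if i < j ∧ p i = 1 then -1 else 1) *
        koszulSign π (Function.update p j (p j + 1)) := by
  have h2 : ∀ q : ZMod 2, q + 1 = 1 ↔ ¬ q = 1 := by decide
  have key : ∀ i l : Fin k,
      (if i < l ∧ π l < π i ∧ Function.update p j (p j + 1) i = 1 ∧
        Function.update p j (p j + 1) l = 1 then (-1 : ℤ) else 1) =
      (if i < l ∧ π l < π i ∧ p i = 1 ∧ p l = 1 then (-1 : ℤ) else 1) *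
        ((if j = l then (if i < j ∧ π j < π i ∧ p i = 1 then -1 else 1) else 1) *
        (if j = i then (if j < l ∧ π l < π j ∧ p l = 1 then -1 else 1) else 1)) := by
    intro i l
    by_cases hi : j = i
    · subst hi
      by_cases hl : j = l
      · subst hl
        simp
      · rw [Function.update_self, Function.update_of_ne (Ne.symm hl), if_neg hl, if_pos rfl]
        simp only [h2]
        by_cases h : p j = 1 <;> by_cases h' : p l = 1 <;> simp [h, h']
        split_ifs <;> simp
    · rw [if_neg hi]
      by_cases hl : j = l
      · subst hl
        rw [Function.update_self, Function.update_of_ne (Ne.symm hi), if_pos rfl]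
        simp only [h2]
        by_cases h : p j = 1 <;> by_cases h' : p i = 1 <;> simp [h, h']
        split_ifs <;> simp
      · rw [Function.update_of_ne (Ne.symm hl), Function.update_of_ne (Ne.symm hi), if_neg hl]
        simp
  have h3 : koszulSign π (Function.update p j (p j + 1)) = koszulSign π p *
      ((∏ i, if i < j ∧ π j < π i ∧ p i = 1 then -1 else 1) *
        ∏ l, if j < l ∧ π l < π j ∧ p l = 1 then -1 else 1) := by
    simp only [koszulSign, key, Finset.prod_mul_distrib]
    congr 2
    · exact Finset.prod_congr rfl fun i _ => by simp
    · rw [Finset.prod_comm]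
      exact Finset.prod_congr rfl fun i _ => by simp
  rw [h3, mul_left_comm]
  congr 1
  rw [← Finset.prod_mul_distrib, ← Finset.prod_mul_distrib]
  refine Finset.prod_congr rfl fun i _ => ?_
  by_cases h : p i = 1
  · rcases lt_trichotomy i j with hij | rfl | hij
    · rcases lt_or_gt_of_ne (π.injective.ne hij.ne) with h' | h'
      · simp [h, hij, h', hij.not_gt, h'.not_gt]
      · simp [h, hij, h', hij.not_gt, h'.not_gt]
    · simp
    · rcases lt_or_gt_of_ne (π.injective.ne hij.ne') with h' | h'
      · simp [h, hij, h', hij.not_gt, h'.not_gt]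
      · simp [h, hij, h', hij.not_gt, h'.not_gt]
  · simp [h]

lemma neg_one_pow_cast (n : ℕ) : (-1 : A) ^ n = ((if (n : ZMod 2) = 1 then -1 else 1 : ℤ) : A) := by
  rcases Nat.even_or_odd n with h | h
  · have : ((n : ℕ) : ZMod 2) = 0 := (ZMod.natCast_eq_zero_iff_even).mpr h
    simp [h.neg_one_pow, this]
  · have : ((n : ℕ) : ZMod 2) = 1 := (ZMod.natCast_eq_one_iff_odd).mpr h
    simp [h.neg_one_pow, this]

lemma parityProj_totD_lof (d : ∀ n, E (n + 1) →ₗ[A] E n) (n : ℕ) (x : E n) (q : ZMod 2) :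
    parityProj A E q (totD d (DirectSum.lof A ℕ E n x)) =
      if (n : ZMod 2) + 1 = q then totD d (DirectSum.lof A ℕ E n x) else 0 := by
  cases n with
  | zero => simp [totD_lof_zero]
  | succ n =>
    have : ((n + 1 : ℕ) : ZMod 2) + 1 = n := by
      push_cast
      rw [add_assoc, show (1 : ZMod 2) + 1 = 0 from by decide, add_zero]
    rw [totD_lof_succ, parityProj_lof, this]

/-- The differential of the tensor power commutes with permutations. -/
lemma permAct_tensorD (d : ∀ n, E (n + 1) →ₗ[A] E n) {k : ℕ} (π : Equiv.Perm (Fin k))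
    (z : TPow A E k) : permAct A E π (tensorD d k z) = tensorD d k (permAct A E π z) := by
  suffices (permAct A E π).comp (tensorD d k) = (tensorD d k).comp (permAct A E π) from
    LinearMap.congr_fun this z
  refine tpow_hom_ext fun a x => ?_
  rw [LinearMap.comp_apply, LinearMap.comp_apply, tensorD_homTensor, permAct_homTensor, map_smul,
    tensorD_homTensor, map_sum, Finset.smul_sum]
  refine Eq.trans ?_ (Equiv.sum_comp π _)
  refine Finset.sum_congr rfl fun j _ => ?_
  rw [map_smul, permAct_tprod π
    (Function.update (fun i => (a i : ZMod 2)) j ((a j : ZMod 2) + 1)), smul_smul, smul_smul]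
  · congr 1
    · rw [← Equiv.prod_comp π (fun i => if i < π j then (-1 : A) ^ a (π.symm i) else 1)]
      have h := congrArg (Int.cast : ℤ → A)
        (koszulSign_update π (fun i => (a i : ZMod 2)) j)
      rw [Int.cast_mul, Int.cast_mul, Int.cast_prod, Int.cast_prod] at h
      refine Eq.trans ?_ (h.symm.trans ?_)
      · congr 1
        refine Finset.prod_congr rfl fun i _ => ?_
        rw [neg_one_pow_cast]
        by_cases h1 : i < j <;> simp [h1]
      · congr 1
        refine Finset.prod_congr rfl fun i _ => ?_
        rw [neg_one_pow_cast, Equiv.symm_apply_apply]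
        by_cases h1 : π i < π j <;> simp [h1]
    · congr 1
      ext1 i
      by_cases h : i = π j
      · subst h
        rw [Function.update_self, Equiv.symm_apply_apply, Function.update_self]
      · have h' : π.symm i ≠ j := fun e => h (by rw [← e, Equiv.apply_symm_apply])
        rw [Function.update_of_ne h, Function.update_of_ne h']
  · intro i q
    by_cases h : i = j
    · subst h
      rw [Function.update_self, Function.update_self, parityProj_totD_lof]
    · rw [Function.update_of_ne h, Function.update_of_ne h, parityProj_lof]

lemma totD_totD (d : ∀ n, E (n + 1) →ₗ[A] E n) (hd : ∀ n, (d n).comp (d (n + 1)) = 0) :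
    (totD d).comp (totD d) = 0 := by
  apply DirectSum.linearMap_ext
  intro n
  ext x : 1
  simp only [LinearMap.comp_apply, LinearMap.zero_apply]
  match n with
  | 0 => rw [totD_lof_zero, map_zero]
  | 1 => rw [totD_lof_succ, totD_lof_zero]
  | n + 2 =>
    have h : d n (d (n + 1) x) = 0 := LinearMap.congr_fun (hd n) x
    rw [totD_lof_succ, totD_lof_succ, h, map_zero]

lemma signInv_totD (d : ∀ n, E (n + 1) →ₗ[A] E n) :
    (signInv A E).comp (totD d) = (-1 : A) • (totD d).comp (signInv A E) := by
  apply DirectSum.linearMap_ext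
  intro n
  ext x : 1
  simp only [LinearMap.comp_apply, LinearMap.smul_apply]
  match n with
  | 0 => rw [totD_lof_zero, signInv_lof, map_smul, totD_lof_zero]; simp
  | n + 1 =>
    rw [totD_lof_succ, signInv_lof, signInv_lof, map_smul, totD_lof_succ, smul_smul, pow_succ']
    congr 1
    ring

lemma tensorD_tensorD (d : ∀ n, E (n + 1) →ₗ[A] E n) (hd : ∀ n, (d n).comp (d (n + 1)) = 0)
    (k : ℕ) (z : TPow A E k) : tensorD d k (tensorD d k z) = 0 := by
  let g : Fin k → Fin k → (Tot E →ₗ[A] Tot E) := fun j i =>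
    if i < j then signInv A E else if i = j then totD d else LinearMap.id
  let D : Fin k → (TPow A E k →ₗ[A] TPow A E k) := fun j => PiTensorProduct.map (g j)
  have hlt : ∀ i j, i < j → (D i).comp (D j) = -(D j).comp (D i) := by
    intro i j hij
    have h1 : (D j).comp (D i) = PiTensorProduct.map fun l => (g j l).comp (g i l) :=
      (PiTensorProduct.map_comp _ _).symm
    have h2 : (D i).comp (D j) = PiTensorProduct.map fun l => (g i l).comp (g j l) :=
      (PiTensorProduct.map_comp _ _).symm
    have h3 : (fun l => (g j l).comp (g i l)) =
        Function.update (fun l => (g i l).comp (g j l)) i ((-1 : A) • (g i i).comp (g j i)) := by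
      ext1 l
      rcases lt_trichotomy l i with h | rfl | h
      · rw [Function.update_of_ne h.ne]
        simp [g, h, h.trans hij]
      · rw [Function.update_self]
        simp only [g, hij, lt_irrefl, if_true, if_false]
        exact signInv_totD d
      · rw [Function.update_of_ne h.ne']
        simp only [g, h.not_gt, h.ne', if_false]
        rfl
    have h4 : ∀ w : TPow A E k →ₗ[A] TPow A E k, w = -((-1 : A) • w) := fun w => by
      ext z
      simp
    rw [h1, h3, PiTensorProduct.map_update_smul, Function.update_eq_self, h2]
    exact h4 _
  have hself : ∀ i, (D i).comp (D i) = 0 := by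
    intro i
    have h2 : (D i).comp (D i) = PiTensorProduct.map fun l => (g i l).comp (g i l) :=
      (PiTensorProduct.map_comp _ _).symm
    rw [h2]
    apply PiTensorProduct.ext
    refine MultilinearMap.ext fun t => ?_
    change PiTensorProduct.map (fun l => (g i l).comp (g i l)) (PiTensorProduct.tprod A t) = 0
    rw [PiTensorProduct.map_tprod]
    apply MultilinearMap.map_coord_zero _ i
    simp only [g, lt_irrefl, if_true, if_false, totD_totD d hd, LinearMap.zero_apply]
  have hD : ∀ w, tensorD d k w = ∑ j, D j w := fun w => by
    rw [tensorD, LinearMap.sum_apply]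
  rw [hD, hD]
  have hs : ∀ j, D j (∑ i, D i z) = ∑ i, D j (D i z) := fun j => map_sum (D j) (fun i => D i z) _
  rw [Finset.sum_congr rfl fun j _ => hs j]
  rw [← Finset.sum_product']
  refine Finset.sum_involution (fun q _ => (q.2, q.1)) ?_ ?_ ?_ ?_
  · rintro ⟨i, j⟩ -
    change D i (D j z) + D j (D i z) = 0
    rcases lt_trichotomy i j with h | rfl | h
    · have h1 : D i (D j z) = -D j (D i z) := LinearMap.congr_fun (hlt i j h) z
      rw [h1, neg_add_cancel]
    · have h1 : D i (D i z) = 0 := LinearMap.congr_fun (hself i) z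
      rw [h1, add_zero]
    · have h1 : D j (D i z) = -D i (D j z) := LinearMap.congr_fun (hlt j i h) z
      rw [h1, add_neg_cancel]
  · rintro ⟨i, j⟩ - hne heq
    obtain rfl : j = i := congrArg Prod.fst heq
    exact hne (by rw [← LinearMap.comp_apply, hself]; rfl)
  · simp
  · simp

/-- The differential of the complex `(E^{⊗ k})^{S_k}`. -/
def symD (d : ∀ n, E (n + 1) →ₗ[A] E n) (k n : ℕ) : symPart A E k (n + 1) →ₗ[A] symPart A E k n :=
  (tensorD d k).restrict fun z hz =>
    ⟨tensorD_mem_degPart d hz.1, fun π => by rw [permAct_tensorD, hz.2 π]⟩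

/-- For a linear map `ε : E₀ → A`, the map `E^{⊗ k} → A` sending `x₁ ⊗ ⋯ ⊗ x_k` to the product
`ε x₁ ⋯ ε x_k`, where `ε` is extended by zero to the `Eₙ` with `n > 0`. -/
def mulMap (ε : E 0 →ₗ[A] A) (k : ℕ) : TPow A E k →ₗ[A] A :=
  PiTensorProduct.lift ((MultilinearMap.mkPiAlgebra A (Fin k) A).compLinearMap fun _ =>
    DirectSum.toModule A ℕ A fun n =>
      match n with
      | 0 => ε
      | _ + 1 => 0)

lemma mulMap_tensorD (d : ∀ n, E (n + 1) →ₗ[A] E n) (ε : E 0 →ₗ[A] A) (hε : ε.comp (d 0) = 0)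
    (k : ℕ) (z : TPow A E k) : mulMap ε k (tensorD d k z) = 0 := by
  suffices (mulMap ε k).comp (tensorD d k) = 0 from LinearMap.congr_fun this z
  refine tpow_hom_ext fun a x => ?_
  rw [LinearMap.comp_apply, tensorD_homTensor, map_sum, LinearMap.zero_apply]
  refine Finset.sum_eq_zero fun j _ => ?_
  rw [map_smul, mulMap, PiTensorProduct.lift.tprod, MultilinearMap.compLinearMap_apply,
    MultilinearMap.mkPiAlgebra_apply]
  refine (congrArg _ (Finset.prod_eq_zero (Finset.mem_univ j) ?_)).trans (smul_zero _)
  rw [Function.update_self]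
  generalize x j = y
  revert y
  match a j with
  | 0 => intro y; rw [totD_lof_zero, map_zero]
  | 1 =>
    intro y
    rw [totD_lof_succ, DirectSum.toModule_lof, ← LinearMap.comp_apply, hε, LinearMap.zero_apply]
  | n + 2 => intro y; rw [totD_lof_succ, DirectSum.toModule_lof, LinearMap.zero_apply]

lemma mulMap_mem (ε : E 0 →ₗ[A] A) (I : Ideal A) (hε : ∀ x, ε x ∈ I) (k : ℕ) (z : TPow A E k) :
    mulMap ε k z ∈ I ^ k := by
  induction z using PiTensorProduct.induction_on with
  | smul_tprod r t =>
    rw [map_smul, mulMap, PiTensorProduct.lift.tprod, MultilinearMap.compLinearMap_apply,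
      MultilinearMap.mkPiAlgebra_apply]
    refine Ideal.mul_mem_left _ _ ?_
    have : I ^ k = ∏ _i : Fin k, I := by simp
    rw [this]
    refine Ideal.prod_mem_prod fun i _ => ?_
    induction t i using DirectSum.induction_on with
    | zero => simp
    | of n x =>
      have h := DirectSum.toModule_lof (R := A) (M := E) (φ := fun n =>
        (match n with
        | 0 => ε
        | _ + 1 => 0 : E n →ₗ[A] A)) n x
      rw [← DirectSum.lof_eq_of A, h]
      cases n with
      | zero => exact hε x
      | succ n => simp
    | add x y hx hy => rw [map_add]; exact add_mem hx hy
  | add x y hx hy => rw [map_add]; exact add_mem hx hy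

end Algebra

section BaseChange

variable {A B C : Type u} [CommRing A] [CommRing B] [CommRing C] {φ : A →+* B} {ψ : B →+* C}
  {E F G : ℕ → Type u} [∀ n, AddCommGroup (E n)] [∀ n, Module A (E n)]
  [∀ n, AddCommGroup (F n)] [∀ n, Module B (F n)] [∀ n, AddCommGroup (G n)] [∀ n, Module C (G n)]

/-- The map of total modules induced by maps `Eₙ → Fₙ` which are semilinear along `A → B`. -/
def totMap (f : ∀ n, E n →ₛₗ[φ] F n) : Tot E →ₛₗ[φ] Tot F where
  toFun := DirectSum.map fun n => (f n).toAddMonoidHom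
  map_add' := map_add _
  map_smul' r x := by
    induction x using DirectSum.induction_on with
    | zero => simp
    | of n x =>
      rw [← DirectSum.lof_eq_of A, ← map_smul, DirectSum.lof_eq_of, DirectSum.lof_eq_of,
        DirectSum.map_of, DirectSum.map_of, ← DirectSum.lof_eq_of B, ← DirectSum.lof_eq_of B,
        ← map_smul]
      simp
    | add x y hx hy => rw [smul_add, map_add, hx, hy, map_add, smul_add]

lemma totMap_lof (f : ∀ n, E n →ₛₗ[φ] F n) (n : ℕ) (x : E n) :
    totMap f (DirectSum.lof A ℕ E n x) = DirectSum.lof B ℕ F n (f n x) :=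
  DirectSum.map_of _ _ _

/-- The map `x₁ ⊗ ⋯ ⊗ x_k ↦ f x₁ ⊗ ⋯ ⊗ f x_k` of tensor powers over `A` and `B`. -/
def tpowMap (f : ∀ n, E n →ₛₗ[φ] F n) (k : ℕ) : TPow A E k →ₛₗ[φ] TPow B F k :=
  letI : Module A (TPow B F k) := Module.compHom _ φ
  let m : MultilinearMap A (fun _ : Fin k => Tot E) (TPow B F k) :=
    { toFun := fun x => PiTensorProduct.tprod B fun i => totMap f (x i)
      map_update_add' := fun x i y z => by
        have h : ∀ w, (fun l => totMap f (Function.update x i w l)) =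
            Function.update (fun l => totMap f (x l)) i (totMap f w) := fun w =>
          funext fun l => Function.apply_update (fun _ => totMap f) x i w l
        simp only [h, map_add, MultilinearMap.map_update_add]
      map_update_smul' := fun x i r y => by
        have h : ∀ w, (fun l => totMap f (Function.update x i w l)) =
            Function.update (fun l => totMap f (x l)) i (totMap f w) := fun w =>
          funext fun l => Function.apply_update (fun _ => totMap f) x i w l
        simp only [h, map_smulₛₗ, MultilinearMap.map_update_smul]
        rfl }
  { toFun := PiTensorProduct.lift m
    map_add' := map_add _
    map_smul' := fun r x => map_smul (PiTensorProduct.lift m) r x }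

lemma tpowMap_tprod (f : ∀ n, E n →ₛₗ[φ] F n) {k : ℕ} (t : Fin k → Tot E) :
    tpowMap f k (PiTensorProduct.tprod A t) = PiTensorProduct.tprod B fun i => totMap f (t i) :=
  letI : Module A (TPow B F k) := Module.compHom _ φ
  PiTensorProduct.lift.tprod _

lemma tpowMap_homTensor (f : ∀ n, E n →ₛₗ[φ] F n) {k : ℕ} (a : Fin k → ℕ) (x : ∀ i, E (a i)) :
    tpowMap f k (homTensor A a x) = homTensor B a fun i => f _ (x i) := by
  rw [homTensor, tpowMap_tprod, homTensor]
  simp only [totMap_lof]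

lemma tpow_induction {k : ℕ} {P : TPow A E k → Prop} (z : TPow A E k)
    (h : ∀ (r : A) (a : Fin k → ℕ) (x : ∀ i, E (a i)), P (r • homTensor A a x))
    (hadd : ∀ x y, P x → P y → P (x + y)) : P z := by
  have hz : z ∈ Submodule.span A {z | ∃ a x, z = homTensor (E := E) A (k := k) a x} := by
    let q := (Submodule.span A {z | ∃ a x, z = homTensor (E := E) A (k := k) a x}).mkQ
    have : q = 0 := tpow_hom_ext fun a x => by
      rw [LinearMap.zero_apply]
      exact (Submodule.Quotient.mk_eq_zero _).mpr (Submodule.subset_span ⟨a, x, rfl⟩)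
    exact (Submodule.Quotient.mk_eq_zero _).mp (LinearMap.congr_fun this z)
  have h0 : P 0 := by simpa using h 0 (fun _ => 0) 0
  refine Submodule.closure_induction (p := fun z _ => P z) h0 (fun x y _ _ => hadd x y) ?_ hz
  rintro r _ ⟨a, x, rfl⟩
  exact h r a x

lemma tpowMap_mem_degPart (f : ∀ n, E n →ₛₗ[φ] F n) {k n : ℕ} {z : TPow A E k}
    (hz : z ∈ degPart A E k n) : tpowMap f k z ∈ degPart B F k n := by
  revert z
  suffices degPart A E k n ≤ (degPart B F k n).comap (tpowMap f k) from fun z hz => this hz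
  refine Submodule.span_le.mpr ?_
  rintro _ ⟨a, x, ha, rfl⟩
  simp only [Submodule.comap_coe, Set.mem_preimage, SetLike.mem_coe, tpowMap_homTensor]
  exact Submodule.subset_span ⟨_, _, ha, rfl⟩

lemma permAct_tpowMap (f : ∀ n, E n →ₛₗ[φ] F n) {k : ℕ} (π : Equiv.Perm (Fin k)) (z : TPow A E k) :
    permAct B F π (tpowMap f k z) = tpowMap f k (permAct A E π z) := by
  induction z using tpow_induction with
  | h r a x =>
    simp only [map_smulₛₗ, tpowMap_homTensor, permAct_homTensor, map_intCast, RingHom.id_apply]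
  | hadd x y hx hy => rw [map_add, map_add, map_add, map_add, hx, hy]

lemma tensorD_tpowMap (d : ∀ n, E (n + 1) →ₗ[A] E n) (d' : ∀ n, F (n + 1) →ₗ[B] F n)
    (f : ∀ n, E n →ₛₗ[φ] F n) (hf : ∀ n x, d' n (f (n + 1) x) = f n (d n x)) {k : ℕ}
    (z : TPow A E k) : tensorD d' k (tpowMap f k z) = tpowMap f k (tensorD d k z) := by
  have hd : ∀ n x, totD d' (DirectSum.lof B ℕ F n (f n x)) =
      totMap f (totD d (DirectSum.lof A ℕ E n x)) := by
    intro n x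
    cases n with
    | zero => rw [totD_lof_zero, totD_lof_zero, map_zero]
    | succ n => rw [totD_lof_succ, totD_lof_succ, totMap_lof, hf]
  induction z using tpow_induction with
  | h r a x =>
    simp only [map_smulₛₗ, tpowMap_homTensor, tensorD_homTensor, map_sum]
    congr 1
    refine Finset.sum_congr rfl fun j _ => ?_
    rw [tpowMap_tprod]
    congr 1
    · rw [map_prod]
      refine Finset.prod_congr rfl fun i _ => ?_
      split_ifs <;> simp
    · congr 1
      ext1 i
      by_cases h : i = j
      · subst h
        rw [Function.update_self, Function.update_self, hd]
      · rw [Function.update_of_ne h, Function.update_of_ne h, totMap_lof]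
  | hadd x y hx hy => rw [map_add, map_add, map_add, map_add, hx, hy]

/-- The map between degree `n` parts of `(E^{⊗ k})^{S_k}` and `(F^{⊗ k})^{S_k}` induced by
semilinear maps `Eₙ → Fₙ`. -/
def symMap (f : ∀ n, E n →ₛₗ[φ] F n) (k n : ℕ) : symPart A E k n →ₛₗ[φ] symPart B F k n :=
  (tpowMap f k).restrict fun z hz =>
    ⟨tpowMap_mem_degPart f hz.1, fun π => by rw [permAct_tpowMap, hz.2 π]⟩

lemma tpowMap_eq_self {φ : A →+* A} (f : ∀ n, E n →ₛₗ[φ] E n) (hφ : ∀ r, φ r = r)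
    (hf : ∀ n x, f n x = x) {k : ℕ} (z : TPow A E k) : tpowMap f k z = z := by
  induction z using tpow_induction with
  | h r a x => simp only [map_smulₛₗ, tpowMap_homTensor, hφ, hf]
  | hadd x y hx hy => rw [map_add, hx, hy]

lemma tpowMap_eq_comp {χ : A →+* C} (f : ∀ n, E n →ₛₗ[φ] F n) (g : ∀ n, F n →ₛₗ[ψ] G n)
    (h : ∀ n, E n →ₛₗ[χ] G n) (hχ : ∀ r, χ r = ψ (φ r)) (hh : ∀ n x, h n x = g n (f n x))
    {k : ℕ} (z : TPow A E k) : tpowMap h k z = tpowMap g k (tpowMap f k z) := by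
  induction z using tpow_induction with
  | h r a x => simp only [map_smulₛₗ, tpowMap_homTensor, hχ, hh]
  | hadd x y hx hy => rw [map_add, map_add, map_add, hx, hy]

lemma mulMap_tpowMap (ε : E 0 →ₗ[A] A) (ε' : F 0 →ₗ[B] B) (f : ∀ n, E n →ₛₗ[φ] F n)
    (hf : ∀ x, ε' (f 0 x) = φ (ε x)) {k : ℕ} (z : TPow A E k) :
    mulMap ε' k (tpowMap f k z) = φ (mulMap ε k z) := by
  induction z using tpow_induction with
  | h r a x =>
    simp only [map_smulₛₗ, tpowMap_homTensor, smul_eq_mul, map_mul]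
    congr 1
    rw [homTensor, homTensor, mulMap, mulMap, PiTensorProduct.lift.tprod,
      PiTensorProduct.lift.tprod, MultilinearMap.compLinearMap_apply,
      MultilinearMap.compLinearMap_apply, MultilinearMap.mkPiAlgebra_apply,
      MultilinearMap.mkPiAlgebra_apply, map_prod]
    refine Finset.prod_congr rfl fun i _ => ?_
    rw [DirectSum.toModule_lof, DirectSum.toModule_lof]
    generalize x i = y
    revert y
    cases a i with
    | zero => exact hf
    | succ n => intro y; simp
  | hadd x y hx hy => rw [map_add, map_add, map_add, map_add, hx, hy]

end BaseChange

section Scheme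

variable {X : Scheme.{u}}

/-- The differential on sections over `U` of a complex of sheaves of modules. -/
def secD (E : ChainComplex X.Modules ℕ) (U : X.Opens) (n : ℕ) :
    Γ(E.X (n + 1), U) →ₗ[Γ(X, U)] Γ(E.X n, U) where
  toFun x := (E.d (n + 1) n).app U x
  map_add' := map_add _
  map_smul' r x := Scheme.Modules.Hom.app_smul _ r x

/-- The restriction of sections of a sheaf of modules as a semilinear map. -/
def secRes (M : X.Modules) {U V : X.Opens} (i : U ⟶ V) :
    Γ(M, V) →ₛₗ[(X.presheaf.map i.op).hom] Γ(M, U) where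
  toFun x := M.presheaf.map i.op x
  map_add' := map_add _
  map_smul' r x := Scheme.Modules.map_smul M i r x

lemma secD_comp (E : ChainComplex X.Modules ℕ) (U : X.Opens) (n : ℕ) :
    (secD E U n).comp (secD E U (n + 1)) = 0 := by
  ext x
  have h := congrArg (fun f => f.app U x) (E.d_comp_d (n + 2) (n + 1) n)
  exact h

lemma secD_secRes (E : ChainComplex X.Modules ℕ) {U V : X.Opens} (i : U ⟶ V) (n : ℕ)
    (x : Γ(E.X (n + 1), V)) :
    secD E U n (secRes (E.X (n + 1)) i x) = secRes (E.X n) i (secD E V n x) :=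
  CategoryTheory.congr_fun ((E.d (n + 1) n).mapPresheaf.naturality i.op) x

/-- The presheaf of modules `U ↦` the degree `n` part of
`(E(U) ⊗ ⋯ ⊗ E(U))^{S_k}`, the tensor product being over `𝒪(U)`. -/
def symPresheaf (E : ChainComplex X.Modules ℕ) (k n : ℕ) : X.PresheafOfModules where
  obj U := ModuleCat.of Γ(X, U.unop) (symPart Γ(X, U.unop) (fun m => Γ(E.X m, U.unop)) k n)
  map {U V} f := ModuleCat.semilinearMapAddEquiv _ _ _
    (symMap (fun m => secRes (E.X m) f.unop) k n)
  map_id U := by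
    ext z
    refine Subtype.ext (tpowMap_eq_self _ (fun r => ?_) (fun m x => ?_) z.1)
    · exact CategoryTheory.congr_fun (X.presheaf.map_id U) r
    · exact CategoryTheory.congr_fun ((E.X m).presheaf.map_id U) x
  map_comp f g := by
    ext z
    refine Subtype.ext (tpowMap_eq_comp _ _ _ (fun r => ?_) (fun m x => ?_) z.1)
    · exact CategoryTheory.congr_fun (X.presheaf.map_comp f g) r
    · exact CategoryTheory.congr_fun ((E.X m).presheaf.map_comp f g) x

/-- The differential of the complex of presheaves `(E ⊗ ⋯ ⊗ E)^{S_k}`. -/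
def symPresheafD (E : ChainComplex X.Modules ℕ) (k n : ℕ) :
    symPresheaf E k (n + 1) ⟶ symPresheaf E k n where
  app U := ModuleCat.ofHom (symD (secD E U.unop) k n)
  naturality {U V} f := by
    ext z
    refine Subtype.ext ?_
    exact tensorD_tpowMap _ _ _ (fun m x => secD_secRes E f.unop m x) z.1

/-- The complex of presheaves of modules `(E ⊗ ⋯ ⊗ E)^{S_k}`. -/
def symPresheafComplex (E : ChainComplex X.Modules ℕ) (k : ℕ) :
    ChainComplex X.PresheafOfModules ℕ :=
  ChainComplex.of (symPresheaf E k) (symPresheafD E k) fun n => by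
    ext U z
    refine Subtype.ext ?_
    exact tensorD_tensorD _ (secD_comp E U.unop) k z.1

variable (X) in
/-- The sheafification functor for presheaves of modules on a scheme. -/
def sheafify : X.PresheafOfModules ⥤ X.Modules :=
  PresheafOfModules.sheafification (𝟙 X.ringCatSheaf.obj)

instance : (sheafify X).PreservesZeroMorphisms :=
  inferInstanceAs (PresheafOfModules.sheafification (𝟙 X.ringCatSheaf.obj)).PreservesZeroMorphisms

/-- The complex of sheaves of `𝒪_X`-modules `(E^{⊗ k})^{S_k}`: the sheafification of the complex of
presheaves given by the invariants in the tensor powers of the complexes of sections. Tensor powers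
of sheaves of modules are sheafifications of presheaf tensor powers, and sheafification, being
exact, commutes with the formation of invariants. -/
def symPower (E : ChainComplex X.Modules ℕ) (k : ℕ) : ChainComplex X.Modules ℕ :=
  ((sheafify X).mapHomologicalComplex _).obj (symPresheafComplex E k)

/-- The sections over an open set `U` of a quasi-coherent sheaf of ideals. -/
def idealSections (I : X.IdealSheafData) (U : X.Opens) : Ideal Γ(X, U) :=
  ⨅ (V : X.affineOpens) (h : V.1 ≤ U), (I.ideal V).comap (X.presheaf.map (homOfLE h).op).hom

lemma mem_idealSections {I : X.IdealSheafData} {U : X.Opens} {f : Γ(X, U)} :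
    f ∈ idealSections I U ↔ ∀ (V : X.affineOpens) (h : V.1 ≤ U),
      X.presheaf.map (homOfLE h).op f ∈ I.ideal V := by
  simp only [idealSections, Submodule.mem_iInf, Ideal.mem_comap]

/-- On affine open sets, `idealSections` is the given ideal. -/
lemma idealSections_affine (I : X.IdealSheafData) (U : X.affineOpens) :
    idealSections I U.1 = I.ideal U := by
  ext f
  rw [mem_idealSections]
  refine ⟨fun h => ?_, fun hf V h => I.ideal_le_comap_ideal h hf⟩
  have := h U le_rfl
  rwa [show (homOfLE (le_refl U.1)).op = 𝟙 _ from rfl, X.presheaf.map_id] at this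

lemma map_mem_idealSections {I : X.IdealSheafData} {U V : X.Opens} (i : U ⟶ V) {f : Γ(X, V)}
    (hf : f ∈ idealSections I V) : X.presheaf.map i.op f ∈ idealSections I U := by
  rw [mem_idealSections] at hf ⊢
  intro W h
  have := hf W (h.trans i.le)
  rwa [← CategoryTheory.comp_apply, ← X.presheaf.map_comp]

lemma mem_idealSections_of_cover {I : X.IdealSheafData} {ι : Type u} {U : ι → X.Opens}
    {V : X.Opens} (i : ∀ j, U j ⟶ V) (hV : V ≤ iSup U) {f : Γ(X, V)}
    (hf : ∀ j, X.presheaf.map (i j).op f ∈ idealSections I (U j)) : f ∈ idealSections I V := by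
  rw [mem_idealSections]
  intro W h
  rw [W.2.mem_ideal_iff]
  intro x hx
  obtain ⟨j, hj⟩ := Opens.mem_iSup.mp (hV (h hx))
  obtain ⟨W', hW', hxW', hle⟩ := X.isBasis_affineOpens.exists_subset_of_mem_open
    (show x ∈ ((U j ⊓ W.1 : X.Opens) : Set X) from ⟨hj, hx⟩) (U j ⊓ W.1).isOpen
  obtain ⟨W', hW'', rfl⟩ := hW'
  have h1 : W' ≤ U j := fun y hy => (hle hy).1
  have h2 : W' ≤ W.1 := fun y hy => (hle hy).2
  have h3 := mem_idealSections.mp (hf j) ⟨W', hW''⟩ h1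
  rw [← I.map_ideal (U := ⟨W', hW''⟩) (V := W) h2] at h3
  have h4 := Ideal.mem_map_of_mem (X.presheaf.germ W' x hxW').hom h3
  rw [Ideal.map_map, ← CommRingCat.hom_comp, TopCat.Presheaf.germ_res'] at h4
  convert! h4 using 1
  change _ = X.presheaf.germ W' x hxW' (X.presheaf.map (homOfLE h1).op (X.presheaf.map (i j).op f))
  rw [← CategoryTheory.comp_apply (X.presheaf.map (i j).op), ← X.presheaf.map_comp,
    TopCat.Presheaf.germ_res_apply', TopCat.Presheaf.germ_res_apply']

/-- A quasi-coherent sheaf of ideals as a submodule of the structure sheaf. -/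
def idealSubmodule (I : X.IdealSheafData) :
    PresheafOfModules.Submodule (PresheafOfModules.unit X.ringCatSheaf.obj) where
  obj U := idealSections I U.unop
  map i := fun _ hf => map_mem_idealSections i.unop hf

/-- A quasi-coherent sheaf of ideals on `X` as a sheaf of `𝒪_X`-modules. -/
def idealModule (I : X.IdealSheafData) : X.Modules where
  val := (idealSubmodule I).toPresheafOfModules
  isSheaf := by
    refine (TopCat.Presheaf.isSheaf_iff_isSheafUniqueGluing
      (F := (idealSubmodule I).toPresheafOfModules.presheaf)).mpr fun ι U sf hsf => ?_
    obtain ⟨s, hs, hs'⟩ := TopCat.Sheaf.existsUnique_gluing X.sheaf U (fun i => (sf i).1)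
      fun i j => congrArg Subtype.val (hsf i j)
    refine ⟨⟨s, mem_idealSections_of_cover (fun j => Opens.leSupr U j) le_rfl fun j => ?_⟩,
      fun j => Subtype.ext (hs j), fun t ht => Subtype.ext (hs' t.1 fun j => ?_)⟩
    · have h : X.presheaf.map (Opens.leSupr U j).op s = (sf j).1 := hs j
      rw [h]
      exact (sf j).2
    · exact congrArg Subtype.val (ht j)

/-- For `ε : M → I`, the composite of the map on sections with the inclusion of `I` in `𝒪_X`. -/
def secEps {M : X.Modules} {I : X.IdealSheafData} (ε : M ⟶ idealModule I) (U : X.Opens) :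
    Γ(M, U) →ₗ[Γ(X, U)] Γ(X, U) :=
  (idealSections I U).subtype.comp (show Γ(M, U) →ₗ[Γ(X, U)] idealSections I U from
    (ε.val.app (Opposite.op U)).hom)

lemma secEps_mem {M : X.Modules} {I : X.IdealSheafData} (ε : M ⟶ idealModule I) (U : X.Opens)
    (x : Γ(M, U)) : secEps ε U x ∈ idealSections I U :=
  Subtype.prop (show idealSections I U from ε.app U x)

lemma secEps_secRes {M : X.Modules} {I : X.IdealSheafData} (ε : M ⟶ idealModule I) {U V : X.Opens}
    (i : U ⟶ V) (x : Γ(M, V)) :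
    secEps ε U (secRes M i x) = X.presheaf.map i.op (secEps ε V x) :=
  congrArg Subtype.val (CategoryTheory.congr_fun (ε.mapPresheaf.naturality i.op) x)

lemma idealSections_pow_le (I : X.IdealSheafData) (U : X.Opens) (k : ℕ) :
    idealSections I U ^ k ≤ idealSections (I ^ k) U := by
  intro f hf
  rw [mem_idealSections]
  intro V h
  have h1 : idealSections I U ≤ (I.ideal V).comap (X.presheaf.map (homOfLE h).op).hom :=
    fun g hg => mem_idealSections.mp hg V h
  exact Ideal.le_comap_pow _ k (Ideal.pow_right_mono h1 k hf)

/-- The multiplication map `x₁ ⊗ ⋯ ⊗ x_k ↦ ε x₁ ⋯ ε x_k` on sections over `U`, from the degree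
zero part of `(E(U) ⊗ ⋯ ⊗ E(U))^{S_k}` to the sections of `I^k`. -/
def mulSec {E : ChainComplex X.Modules ℕ} {I : X.IdealSheafData}
    (ε : E.X 0 ⟶ idealModule I) (k : ℕ) (U : X.Opens) :
    symPart Γ(X, U) (fun m => Γ(E.X m, U)) k 0 →ₗ[Γ(X, U)] idealSections (I ^ k) U :=
  LinearMap.codRestrict (idealSections (I ^ k) U)
    ((mulMap (E := fun m => Γ(E.X m, U)) (secEps ε U) k).comp (Submodule.subtype _)) fun z =>
      idealSections_pow_le I U k (mulMap_mem _ _ (secEps_mem ε U) k z.1)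

lemma mulSec_symMap {E : ChainComplex X.Modules ℕ} {I : X.IdealSheafData}
    (ε : E.X 0 ⟶ idealModule I) (k : ℕ) {U V : X.Opens} (i : U ⟶ V)
    (z : symPart Γ(X, V) (fun m => Γ(E.X m, V)) k 0) :
    (mulSec ε k U (symMap (fun m => secRes (E.X m) i) k 0 z)).1 =
      X.presheaf.map i.op (mulSec ε k V z).1 :=
  mulMap_tpowMap (E := fun m => Γ(E.X m, V)) (F := fun m => Γ(E.X m, U))
    (φ := (X.presheaf.map i.op).hom) (secEps ε V) (secEps ε U)
    (fun m => secRes (E.X m) i) (fun x => secEps_secRes ε i x) z.1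

lemma mulSec_symD {E : ChainComplex X.Modules ℕ} {I : X.IdealSheafData}
    (ε : E.X 0 ⟶ idealModule I) (hε : E.d 1 0 ≫ ε = 0) (k : ℕ) (U : X.Opens)
    (z : symPart Γ(X, U) (fun m => Γ(E.X m, U)) k 1) :
    (mulSec ε k U (symD (secD E U) k 0 z)).1 = 0 := by
  refine mulMap_tensorD (E := fun m => Γ(E.X m, U)) (secD E U) (secEps ε U) ?_ k z.1
  ext x
  exact congrArg Subtype.val (CategoryTheory.congr_fun (congrArg (fun f => f.app U) hε) x)

/-- The multiplication map of presheaves from the degree zero part of `(E ⊗ ⋯ ⊗ E)^{S_k}`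
to `I^k`. -/
def mulPresheaf {E : ChainComplex X.Modules ℕ} {I : X.IdealSheafData}
    (ε : E.X 0 ⟶ idealModule I) (k : ℕ) :
    symPresheaf E k 0 ⟶ (idealModule (I ^ k)).val where
  app U := (ModuleCat.ofHom (mulSec ε k U.unop) :
    ModuleCat.of Γ(X, U.unop) (symPart Γ(X, U.unop) (fun m => Γ(E.X m, U.unop)) k 0) ⟶
      ModuleCat.of Γ(X, U.unop) (idealSections (I ^ k) U.unop))
  naturality {U V} f := by
    ext z
    exact Subtype.ext (mulSec_symMap ε k f.unop z)

lemma symPresheafD_mulPresheaf {E : ChainComplex X.Modules ℕ} {I : X.IdealSheafData}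
    (ε : E.X 0 ⟶ idealModule I) (hε : E.d 1 0 ≫ ε = 0) (k : ℕ) :
    symPresheafD E k 0 ≫ mulPresheaf ε k = 0 := by
  ext U z
  exact Subtype.ext (mulSec_symD ε hε k U.unop z)

/-- The canonical isomorphism from the sheafification of a sheaf of modules to itself. -/
def sheafifyCounit (N : X.Modules) : (sheafify X).obj N.val ⟶ N :=
  (PresheafOfModules.sheafificationAdjunction (𝟙 X.ringCatSheaf.obj)).counit.app N

/-- The multiplication map of sheaves from the degree zero part of `(E^{⊗ k})^{S_k}` to `I^k`. -/
def mulSheaf {E : ChainComplex X.Modules ℕ} {I : X.IdealSheafData}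
    (ε : E.X 0 ⟶ idealModule I) (k : ℕ) : (symPower E k).X 0 ⟶ idealModule (I ^ k) :=
  (sheafify X).map (mulPresheaf ε k) ≫ sheafifyCounit (idealModule (I ^ k))

lemma symPower_d_mulSheaf {E : ChainComplex X.Modules ℕ} {I : X.IdealSheafData}
    (ε : E.X 0 ⟶ idealModule I) (hε : E.d 1 0 ≫ ε = 0) (k : ℕ) :
    (symPower E k).d 1 0 ≫ mulSheaf ε k = 0 := by
  have h1 : (symPower E k).d 1 0 = (sheafify X).map (symPresheafD E k 0) :=
    congrArg (sheafify X).map (ChainComplex.of_d (symPresheaf E k) (symPresheafD E k) 0)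
  have h2 : (sheafify X).map (symPresheafD E k 0) ≫ (sheafify X).map (mulPresheaf ε k) = 0 := by
    rw [← Functor.map_comp, symPresheafD_mulPresheaf ε hε, Functor.map_zero]
  have h3 : (sheafify X).map (symPresheafD E k 0) ≫ mulSheaf ε k = 0 := by
    have := congrArg (fun f => f ≫ sheafifyCounit (idealModule (I ^ k))) h2
    simp only [Category.assoc, Limits.zero_comp] at this
    exact this
  rw [h1]
  exact h3

/-- The multiplication map `(E^{⊗ k})^{S_k} → I^k` induced by an augmentation `E → I`. -/
def symPowerMul {E : ChainComplex X.Modules ℕ} {I : X.IdealSheafData}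
    (ε : E ⟶ (ChainComplex.single₀ X.Modules).obj (idealModule I)) (k : ℕ) :
    symPower E k ⟶ (ChainComplex.single₀ X.Modules).obj (idealModule (I ^ k)) :=
  let e := ChainComplex.toSingle₀Equiv E (idealModule I) ε
  (ChainComplex.toSingle₀Equiv (symPower E k) (idealModule (I ^ k))).symm
    ⟨mulSheaf e.1 k, symPower_d_mulSheaf e.1 e.2 k⟩

end Scheme

section Koszul

variable {R : Type*} [CommRing R]

/-- The functional `e₁ ↦ x₁`, `e₂ ↦ x₂` on `V = R e₁ ⊕ R e₂`. -/
def koszulFunctional (x : Fin 2 → R) : (Fin 2 → R) →ₗ[R] R :=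
  Fintype.linearCombination R x

/-- Multiplication `V × Sym^k V → Sym^{k+1} V` for `V = R e₁ ⊕ R e₂`, where `Sym^k V` is the module
of homogeneous polynomials of degree `k` in `e₁, e₂`. -/
def symMul (k : ℕ) : (Fin 2 → R) →ₗ[R] MvPolynomial.homogeneousSubmodule (Fin 2) R k →ₗ[R]
    MvPolynomial.homogeneousSubmodule (Fin 2) R (k + 1) :=
  LinearMap.mk₂ R (fun v α => ⟨Fintype.linearCombination R MvPolynomial.X v * α.1, by
      rw [add_comm, MvPolynomial.mem_homogeneousSubmodule]
      refine MvPolynomial.IsHomogeneous.mul ?_ α.2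
      rw [Fintype.linearCombination_apply, ← MvPolynomial.mem_homogeneousSubmodule]
      exact Submodule.sum_mem _ fun i _ => Submodule.smul_mem _ _
        (MvPolynomial.isHomogeneous_X R i)⟩)
    (fun v w α => Subtype.ext (by simp [add_mul]))
    (fun r v α => Subtype.ext (by simp))
    (fun v α β => Subtype.ext (by simp [mul_add]))
    (fun r v α => Subtype.ext (by simp))

/-- The alternating map `(a, b) ↦ (α ↦ d(b) a α - d(a) b α)` on `V = R e₁ ⊕ R e₂`. -/
def koszulAlternating (x : Fin 2 → R) (k : ℕ) : (Fin 2 → R) [⋀^Fin 2]→ₗ[R]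
    (MvPolynomial.homogeneousSubmodule (Fin 2) R k →ₗ[R]
      MvPolynomial.homogeneousSubmodule (Fin 2) R (k + 1)) where
  toFun m := koszulFunctional x (m 1) • symMul k (m 0) - koszulFunctional x (m 0) • symMul k (m 1)
  map_update_add' m i a b := by
    fin_cases i
    · simp only [Fin.zero_eta, Function.update_self, ne_eq, one_ne_zero, not_false_eq_true,
        Function.update_of_ne, map_add, smul_add, add_smul]
      abel
    · simp only [Fin.mk_one, Function.update_self, ne_eq, zero_ne_one, not_false_eq_true,
        Function.update_of_ne, map_add, smul_add, add_smul]
      abel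
  map_update_smul' m i r a := by
    fin_cases i
    · refine LinearMap.ext fun α => ?_
      simp [smul_sub, smul_smul, mul_comm]
    · refine LinearMap.ext fun α => ?_
      simp [smul_sub, smul_smul, mul_comm]
  map_eq_zero_of_eq' m i j h hij := by
    have h1 : m 0 = m 1 := by
      fin_cases i <;> fin_cases j <;> simp_all
    rw [h1]
    exact sub_self (koszulFunctional x (m 1) • symMul k (m 1))

/-- The differential `⋀² V ⊗ Sym^k V → Sym^{k+1} V`,
`(a ∧ b) ⊗ α ↦ d(b) a α - d(a) b α`, where `V = R e₁ ⊕ R e₂` and `d(eᵢ) = xᵢ`. -/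
def koszulSymD (x : Fin 2 → R) (k : ℕ) :
    (⋀[R]^2 (Fin 2 → R)) ⊗[R] MvPolynomial.homogeneousSubmodule (Fin 2) R k →ₗ[R]
      MvPolynomial.homogeneousSubmodule (Fin 2) R (k + 1) :=
  TensorProduct.lift (exteriorPower.alternatingMapLinearEquiv (R := R) (M := Fin 2 → R)
    (N := MvPolynomial.homogeneousSubmodule (Fin 2) R k →ₗ[R]
      MvPolynomial.homogeneousSubmodule (Fin 2) R (k + 1)) (koszulAlternating x k))

/-- The map `Sym^k V → R` which sends a product of `k` vectors of `V = R e₁ ⊕ R e₂` to the product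
of their images under `eᵢ ↦ xᵢ`: evaluation of homogeneous polynomials at `x`. -/
def symEval (x : Fin 2 → R) (k : ℕ) : MvPolynomial.homogeneousSubmodule (Fin 2) R k →ₗ[R] R :=
  (MvPolynomial.aeval x).toLinearMap.comp (Submodule.subtype _)

end Koszul

end DerivedSymmetricPower

end

/-! Being a quasi-isomorphism is a condition on stalks, and the formation of invariants in tensor
powers commutes with stalks, since an element or a relation at a point involves finitely many
sections and `S_k` is finite. This is `quasiIso_symPowerMul_of_stk`. What remains is a statement
about a local ring `A` containing `ℚ`: if `E` is a free resolution of an ideal `I` of `A`, then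
`(E^{⊗ k})^{S_k}` resolves `I^k`.

In characteristic zero the invariants are the image of an averaging operator which commutes with the
differential. A homotopy on `E` induces one on `E^{⊗ k}` (`tensorD_tensorH`), and its average is a
homotopy on the invariants. So the answer does not depend on the projective resolution
(`SymExact.of_resolution`), and a small one may be chosen.

Smoothness provides it. At a point of `Z`, minimal generators of the ideal have differentials
independent modulo the maximal ideal, because the conormal sequence of `Z` in `M` splits. Hence `A`
is flat over the polynomial ring in these generators, and they inherit from the variables the
property of being a regular sequence (`exists_isWeaklyRegular_ker`). Localizing at the generic point
of a component of `Z` bounds their number by the codimension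
(`exists_isWeaklyRegular_localization`). Off `Z` the sequence `[1]` does.

For a regular pair `(x₀, x₁)` the ideal has the resolution `0 → A → A² → I → 0`, with two even
generators and one odd one. An odd generator can occur at most once in an invariant tensor, so the
symmetric power has only two terms. It becomes multiplication by the Koszul form `x₁ X₀ - x₀ X₁`
from homogeneous polynomials of degree `k - 1` to those of degree `k`, followed by evaluation at
`x`. Exactness says that a homogeneous polynomial killed by the form is zero
(`eq_zero_of_koszulForm_mul`), and that a homogeneous polynomial of positive degree vanishing at `x`
is a multiple of it (`exists_eq_koszulForm_mul`). Both go by induction on the degree, and both also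
prove the explicit local form over any ring. Sequences of length zero or one need no odd generator.
-/

noncomputable section

/-! ### Exactness of sheaves of modules on stalks -/

section
open CategoryTheory AlgebraicGeometry TopologicalSpace Limits
namespace DerivedSymmetricPower

section
variable {P S D K : Type*} [Category P] [Category S] [Category D] [Category K]

/-- A functor on a reflective subcategory preserves colimits if its composite with the reflector
does. -/
lemma preservesColimitsOfShape_of_reflective {L : P ⥤ S} {i : S ⥤ P} (adj : L ⊣ i)
    [IsIso adj.counit] (T : S ⥤ D) [HasColimitsOfShape K P] [PreservesColimitsOfShape K (L ⋙ T)] :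
    PreservesColimitsOfShape K T where
  preservesColimit {F} := by
    have : PreservesColimitsOfShape K L := adj.leftAdjoint_preservesColimits.1
    let c := colimit.cocone (F ⋙ i)
    let hc : IsColimit c := colimit.isColimit _
    have h1 : IsColimit (L.mapCocone c) := isColimitOfPreserves L hc
    have h2 : IsColimit (T.mapCocone (L.mapCocone c)) :=
      isColimitOfPreserves (L ⋙ T) hc
    have : PreservesColimit ((F ⋙ i) ⋙ L) T := preservesColimit_of_preserves_colimit_cocone h1 h2
    -- Through the counit every diagram in the subcategory is the reflection of a diagram upstairs,
    -- where the colimit was formed.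
    exact preservesColimit_of_iso_diagram T (K₁ := (F ⋙ i) ⋙ L)
      (Functor.isoWhiskerLeft F (asIso adj.counit))
end

variable {X : Scheme.{u}}

variable (X) in
/-- The functor forgetting the module structure of a sheaf of modules. -/
def toAbSheaf : X.Modules ⥤ TopCat.Sheaf Ab.{u} X := SheafOfModules.toSheaf X.ringCatSheaf

instance : PreservesFiniteLimits (toAbSheaf X) :=
  inferInstanceAs (PreservesFiniteLimits (SheafOfModules.toSheaf X.ringCatSheaf))

/-- Sheafifying a presheaf of modules and then forgetting the action is the same as forgetting
first, and that composite preserves colimits. -/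
instance (K : Type u) [SmallCategory K] : PreservesColimitsOfShape K (toAbSheaf X) := by
  have : PreservesColimitsOfShape K (PresheafOfModules.sheafification (𝟙 X.ringCatSheaf.obj) ⋙
      SheafOfModules.toSheaf X.ringCatSheaf) :=
    inferInstanceAs (PreservesColimitsOfShape K
      (PresheafOfModules.toPresheaf X.ringCatSheaf.obj ⋙ presheafToSheaf _ Ab.{u}))
  exact preservesColimitsOfShape_of_reflective
    (PresheafOfModules.sheafificationAdjunction (𝟙 X.ringCatSheaf.obj))
    (SheafOfModules.toSheaf X.ringCatSheaf)

instance : PreservesFiniteColimits (toAbSheaf X) := 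
  have : PreservesColimitsOfSize.{u, u} (toAbSheaf X) := ⟨inferInstance⟩
  have : PreservesColimitsOfSize.{0, 0} (toAbSheaf X) := preservesColimitsOfSize_shrink _
  inferInstance
instance : (toAbSheaf X).Additive where
  map_add := rfl
instance : (toAbSheaf X).Faithful :=
  inferInstanceAs (SheafOfModules.toSheaf X.ringCatSheaf).Faithful

/-- The stalk of a sheaf of modules as an abelian group. -/
def stalkAb (x : X) : X.Modules ⥤ Ab.{u} :=
  toAbSheaf X ⋙ TopCat.Sheaf.forget Ab.{u} X ⋙ TopCat.Presheaf.stalkFunctor Ab.{u} x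

instance (x : X) : (stalkAb x).PreservesZeroMorphisms :=
  inferInstanceAs (toAbSheaf X ⋙ TopCat.Sheaf.forget Ab.{u} X ⋙ TopCat.Presheaf.stalkFunctor Ab.{u} x).PreservesZeroMorphisms

/-- The functor to abelian sheaves is exact and faithful, so it preserves and reflects exactness,
and for abelian sheaves exactness is known to be stalkwise. -/
lemma exact_iff_stalk (S : ShortComplex X.Modules) :
    S.Exact ↔ ∀ x : X, (S.map (stalkAb x)).Exact := by
  rw [← ShortComplex.exact_map_iff_of_faithful S (toAbSheaf X), TopCat.Sheaf.exact_iff_stalkFunctor_map_exact]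
  rfl

/-- Needed for arbitrary coproducts, because the free sheaves that occur may have infinite rank. -/
instance (I : Type u) (x : X) : PreservesColimitsOfShape (Discrete I) (stalkAb x) := by
  have : PreservesColimitsOfShape (Discrete I) (TopCat.Sheaf.forget Ab.{u} X ⋙ TopCat.Presheaf.stalkFunctor Ab.{u} x) := inferInstance
  unfold stalkAb
  infer_instance
end DerivedSymmetricPower
end

/-! ### Quasi-isomorphisms and sheafification on stalks -/

section
open CategoryTheory AlgebraicGeometry TopologicalSpace Limits
namespace DerivedSymmetricPower

/-- A map from a chain complex to an object in degree zero is a quasi-isomorphism if and only if the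
augmented complex is exact. -/
lemma quasiIso_single₀_iff {C : Type*} [Category C] [Abelian C] (K : ChainComplex C ℕ) (N : C)
    (f : K ⟶ (ChainComplex.single₀ C).obj N) :
    QuasiIso f ↔ (∀ n, (ShortComplex.mk (K.d (n + 2) (n + 1)) (K.d (n + 1) n)
        (K.d_comp_d _ _ _)).Exact) ∧
      (ShortComplex.mk (K.d 1 0) (ChainComplex.toSingle₀Equiv K N f).1
        (ChainComplex.toSingle₀Equiv K N f).2).Exact ∧
      Epi (ChainComplex.toSingle₀Equiv K N f).1 := by
  rw [quasiIso_iff]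
  have h0 : QuasiIsoAt f 0 ↔ (ShortComplex.mk (K.d 1 0) (ChainComplex.toSingle₀Equiv K N f).1
        (ChainComplex.toSingle₀Equiv K N f).2).Exact ∧
      Epi (ChainComplex.toSingle₀Equiv K N f).1 := by
    rw [ChainComplex.quasiIsoAt₀_iff, ShortComplex.quasiIso_iff_of_zeros']
    · rfl
    · exact K.shape _ _ (by simp)
    · rfl
    · rfl
  have hn : ∀ n, QuasiIsoAt f (n + 1) ↔ (ShortComplex.mk (K.d (n + 2) (n + 1)) (K.d (n + 1) n)
        (K.d_comp_d _ _ _)).Exact := by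
    intro n
    rw [quasiIsoAt_iff_exactAt' _ _ (ChainComplex.exactAt_succ_single_obj _ _),
      HomologicalComplex.exactAt_iff' _ (n + 2) (n + 1) n (by simp) (by simp)]
    rfl
  constructor
  · exact fun h => ⟨fun n => (hn n).mp (h _), h0.mp (h 0)⟩
  · rintro ⟨h1, h2⟩ n
    cases n with
    | zero => exact h0.mpr h2
    | succ n => exact (hn n).mpr (h1 n)

variable {X : Scheme.{u}}

/-- Being an epimorphism is exactness of `M ⟶ N ⟶ 0`, so the stalk criterion for exactness applies.
-/
lemma epi_iff_stalk {M N : X.Modules} (f : M ⟶ N) :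
    Epi f ↔ ∀ x : X, Function.Surjective ((stalkAb x).map f) := by
  refine (ShortComplex.exact_iff_epi (ShortComplex.mk f (0 : N ⟶ N) comp_zero) rfl).symm.trans ?_
  rw [exact_iff_stalk]
  refine forall_congr' fun x => ?_
  rw [ShortComplex.exact_iff_epi _ ((stalkAb x).map_zero N N), AddCommGrpCat.epi_iff_surjective]
  rfl

lemma exact_iff_stalk' {M N P : X.Modules} (f : M ⟶ N) (g : N ⟶ P) (w : f ≫ g = 0) :
    (ShortComplex.mk f g w).Exact ↔
      ∀ x : X, Function.Exact ((stalkAb x).map f) ((stalkAb x).map g) := by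
  rw [exact_iff_stalk]
  refine forall_congr' fun x => ?_
  rw [ShortComplex.ab_exact_iff_function_exact]
  rfl

lemma quasiIso_iff_stalk (K : ChainComplex X.Modules ℕ) (N : X.Modules)
    (f : K ⟶ (ChainComplex.single₀ X.Modules).obj N) :
    QuasiIso f ↔ ∀ x : X, (∀ n, Function.Exact ((stalkAb x).map (K.d (n + 2) (n + 1)))
        ((stalkAb x).map (K.d (n + 1) n))) ∧
      Function.Exact ((stalkAb x).map (K.d 1 0))
        ((stalkAb x).map (ChainComplex.toSingle₀Equiv K N f).1) ∧
      Function.Surjective ((stalkAb x).map (ChainComplex.toSingle₀Equiv K N f).1) := by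
  rw [quasiIso_single₀_iff]
  simp only [exact_iff_stalk', epi_iff_stalk]
  rw [forall_comm, ← forall_and, ← forall_and]

/-- The stalk of a presheaf of modules. -/
def preStalk (x : X) : X.PresheafOfModules ⥤ Ab.{u} :=
  PresheafOfModules.toPresheaf X.ringCatSheaf.obj ⋙ TopCat.Presheaf.stalkFunctor Ab.{u} x

/-- Sheafification does not change stalks. -/
def stalkSheafify (x : X) (P : X.PresheafOfModules) :
    (preStalk x).obj P ≅ (stalkAb x).obj ((sheafify X).obj P) :=
  @asIso _ _ _ _ ((TopCat.Presheaf.stalkFunctor Ab.{u} x).map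
    (CategoryTheory.toSheafify (Opens.grothendieckTopology X) P.presheaf))
    (TopCat.Presheaf.stalkFunctor_map_unit_toSheafify_isIso x Ab.{u} P.presheaf)

lemma stalkSheafify_naturality (x : X) {P Q : X.PresheafOfModules} (f : P ⟶ Q) :
    (preStalk x).map f ≫ (stalkSheafify x Q).hom =
      (stalkSheafify x P).hom ≫ (stalkAb x).map ((sheafify X).map f) := by
  have h := CategoryTheory.toSheafify_naturality (Opens.grothendieckTopology X)
    ((PresheafOfModules.toPresheaf X.ringCatSheaf.obj).map f)
  have h2 := congrArg (TopCat.Presheaf.stalkFunctor Ab.{u} x).map h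
  rw [Functor.map_comp, Functor.map_comp] at h2
  exact h2

/-- A triangle identity of the sheafification adjunction, read on stalks. It lets the stalk of
`mulSheaf` be replaced by that of the presheaf map `mulPresheaf`. -/
lemma stalkSheafify_counit (x : X) (N : X.Modules) :
    (stalkSheafify x N.val).hom ≫ (stalkAb x).map (sheafifyCounit N) = 𝟙 _ := by
  have h := (PresheafOfModules.sheafificationAdjunction
    (𝟙 X.ringCatSheaf.obj)).right_triangle_components N
  have h2 := congrArg (fun f => (TopCat.Presheaf.stalkFunctor Ab.{u} x).map
    ((PresheafOfModules.toPresheaf X.ringCatSheaf.obj).map f)) h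
  refine Eq.trans ?_ (h2.trans ?_)
  · exact (Functor.map_comp (TopCat.Presheaf.stalkFunctor Ab.{u} x) _ _).symm
  · exact CategoryTheory.Functor.map_id (TopCat.Presheaf.stalkFunctor Ab.{u} x) _

lemma exact_of_iso {A B C A' B' C' : Ab.{u}} {f : A ⟶ B} {g : B ⟶ C} {f' : A' ⟶ B'} {g' : B' ⟶ C'}
    (a : A ≅ A') (b : B ≅ B') (c : C ≅ C') (h1 : f ≫ b.hom = a.hom ≫ f')
    (h2 : g ≫ c.hom = b.hom ≫ g') (h : Function.Exact f g) : Function.Exact f' g' := by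
  have w : f ≫ g = 0 := by
    ext x
    exact (h _).mpr ⟨x, rfl⟩
  have w' : f' ≫ g' = 0 := by
    rw [← cancel_epi a.hom, ← reassoc_of% h1, ← h2, reassoc_of% w]
    simp
  have e : ShortComplex.mk f g w ≅ ShortComplex.mk f' g' w' :=
    ShortComplex.isoMk a b c h1.symm h2.symm
  exact (ShortComplex.ab_exact_iff_function_exact _).mp ((ShortComplex.exact_iff_of_iso e).mp
    ((ShortComplex.ab_exact_iff_function_exact (ShortComplex.mk f g w)).mpr h))

/-- A criterion on stalks of presheaves for the multiplication map to be a quasi-isomorphism. -/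
lemma quasiIso_symPowerMul {E : ChainComplex X.Modules ℕ} {I : X.IdealSheafData}
    (ε : E ⟶ (ChainComplex.single₀ X.Modules).obj (idealModule I)) (k : ℕ)
    (h : ∀ x : X,
      (∀ n, Function.Exact ((preStalk x).map (symPresheafD E k (n + 1)))
        ((preStalk x).map (symPresheafD E k n))) ∧
      Function.Exact ((preStalk x).map (symPresheafD E k 0)) ((preStalk x).map
        (mulPresheaf (ChainComplex.toSingle₀Equiv E (idealModule I) ε).1 k)) ∧
      Function.Surjective ((preStalk x).map
        (mulPresheaf (ChainComplex.toSingle₀Equiv E (idealModule I) ε).1 k))) :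
    QuasiIso (symPowerMul ε k) := by
  rw [quasiIso_iff_stalk]
  intro x
  obtain ⟨h1, h2, h3⟩ := h x
  have hd : ∀ n, (symPower E k).d (n + 1) n = (sheafify X).map (symPresheafD E k n) := fun n =>
    congrArg (sheafify X).map (ChainComplex.of_d (symPresheaf E k) (symPresheafD E k) n)
  have hm : (ChainComplex.toSingle₀Equiv (symPower E k) (idealModule (I ^ k))
      (symPowerMul ε k)).1 =
      mulSheaf (ChainComplex.toSingle₀Equiv E (idealModule I) ε).1 k := by
    rw [symPowerMul]
    exact congrArg Subtype.val (Equiv.apply_symm_apply _ _)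
  have hm2 : (preStalk x).map
        (mulPresheaf (ChainComplex.toSingle₀Equiv E (idealModule I) ε).1 k) ≫ 
          (Iso.refl ((stalkAb x).obj (idealModule (I ^ k)))).hom =
      (stalkSheafify x _).hom ≫ (stalkAb x).map
        (mulSheaf (ChainComplex.toSingle₀Equiv E (idealModule I) ε).1 k) := by
    have h1 := stalkSheafify_naturality x
      (mulPresheaf (ChainComplex.toSingle₀Equiv E (idealModule I) ε).1 k)
    have h2 := congrArg (fun f => f ≫ (stalkAb x).map (sheafifyCounit (idealModule (I ^ k)))) h1
    have h3 := congrArg (fun f => (preStalk x).map (mulPresheaf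
      (ChainComplex.toSingle₀Equiv E (idealModule I) ε).1 k) ≫ f)
      (stalkSheafify_counit x (idealModule (I ^ k)))
    refine h3.symm.trans (((Category.assoc _ _ _).symm.trans h2).trans ?_)
    refine (Category.assoc _ _ _).trans ?_
    exact congrArg (fun f => (stalkSheafify x (symPresheaf E k 0)).hom ≫ f)
      ((stalkAb x).map_comp _ _).symm
  refine ⟨fun n => ?_, ?_, ?_⟩
  · rw [hd, hd]
    exact exact_of_iso _ _ _ (stalkSheafify_naturality x _) (stalkSheafify_naturality x _) (h1 n)
  · rw [hm, hd]
    exact exact_of_iso _ _ _ (stalkSheafify_naturality x _) hm2 h2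
  · rw [hm]
    intro y
    obtain ⟨z, hz⟩ := h3 y
    refine ⟨(stalkSheafify x _).hom z, ?_⟩
    have := CategoryTheory.congr_fun hm2 z
    exact this.symm.trans hz
end DerivedSymmetricPower
end

/-! ### Stalks as modules over the local rings; stalks of free sheaves -/

section
open CategoryTheory AlgebraicGeometry TopologicalSpace Limits
namespace DerivedSymmetricPower
variable {X : Scheme.{u}}

/-- The stalk of a sheaf of modules. -/
def Stk (M : X.Modules) (x : X) : Type u := ↑(TopCat.Presheaf.stalk M.val.presheaf x)

instance (M : X.Modules) (x : X) : AddCommGroup (Stk M x) :=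
  (TopCat.Presheaf.stalk M.val.presheaf x).str

instance (M : X.Modules) (x : X) : Module (X.presheaf.stalk x) (Stk M x) :=
  PresheafOfModules.instModuleCarrierStalkCommRingCatCarrierAbPresheafOpensCarrier
    (R := X.presheaf) M.val x

/-- The germ of a section of a sheaf of modules. -/
def stkGerm (M : X.Modules) (U : X.Opens) (x : X) (hx : x ∈ U) :
    Γ(M, U) →ₛₗ[(X.presheaf.germ U x hx).hom] Stk M x where
  toFun s := show ↑(TopCat.Presheaf.stalk M.val.presheaf x) from
    TopCat.Presheaf.germ M.val.presheaf U x hx s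
  map_add' := map_add (TopCat.Presheaf.germ M.val.presheaf U x hx).hom
  map_smul' r s := PresheafOfModules.germ_smul (R := X.presheaf) M.val x U hx r s

lemma exists_stkGerm {M : X.Modules} {x : X} (m : Stk M x) :
    ∃ (U : X.Opens) (hx : x ∈ U) (s : Γ(M, U)), stkGerm M U x hx s = m :=
  let ⟨U, hx, s, h⟩ := TopCat.Presheaf.exists_germ_eq M.val.presheaf m
  ⟨U, hx, s, h⟩

lemma stkGerm_secRes (M : X.Modules) {U V : X.Opens} (i : U ⟶ V) (x : X) (hx : x ∈ U) (s : Γ(M, V)) :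
    stkGerm M U x hx (secRes M i s) = stkGerm M V x (i.le hx) s :=
  TopCat.Presheaf.germ_res_apply M.val.presheaf i x hx s

lemma stkGerm_eq {M : X.Modules} {U V : X.Opens} {x : X} (hU : x ∈ U) (hV : x ∈ V) {s : Γ(M, U)}
    {t : Γ(M, V)} (h : stkGerm M U x hU s = stkGerm M V x hV t) :
    ∃ (W : X.Opens) (_ : x ∈ W) (i : W ⟶ U) (j : W ⟶ V), secRes M i s = secRes M j t :=
  TopCat.Presheaf.germ_eq M.val.presheaf x hU hV s t h

/-- The additive map of stalks induced by a map of sheaves of modules. -/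
def stkMapHom {M N : X.Modules} (f : M ⟶ N) (x : X) : Stk M x →+ Stk N x :=
  ((stalkAb x).map f).hom

/-- The map of stalks induced by a map of sheaves of modules. -/
def stkMap {M N : X.Modules} (f : M ⟶ N) (x : X) : Stk M x →ₗ[X.presheaf.stalk x] Stk N x where
  toFun := stkMapHom f x
  map_add' := map_add (stkMapHom f x)
  map_smul' r m := by
    obtain ⟨U, hU, a, rfl⟩ := TopCat.Presheaf.exists_germ_eq X.presheaf r
    obtain ⟨V, hV, s, rfl⟩ := exists_stkGerm m
    let W := U ⊓ V
    have hW : x ∈ W := ⟨hU, hV⟩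
    rw [← TopCat.Presheaf.germ_res_apply X.presheaf (Opens.infLELeft U V) x hW a,
      ← stkGerm_secRes M (Opens.infLERight U V) x hW s]
    generalize X.presheaf.map (Opens.infLELeft U V).op a = a'
    generalize secRes M (Opens.infLERight U V) s = s'
    have key : ∀ t : Γ(M, W), stkMapHom f x (stkGerm M W x hW t) =
        stkGerm N W x hW (f.app W t) := fun t =>
      TopCat.Presheaf.stalkFunctor_map_germ_apply W x hW
        ((PresheafOfModules.toPresheaf X.ringCatSheaf.obj).map f.val) t
    change stkMapHom f x (X.presheaf.germ W x hW a' • stkGerm M W x hW s') =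
      X.presheaf.germ W x hW a' • stkMapHom f x (stkGerm M W x hW s')
    have h1 : X.presheaf.germ W x hW a' • stkGerm M W x hW s' = stkGerm M W x hW (a' • s') :=
      (map_smulₛₗ (stkGerm M W x hW) a' s').symm
    rw [h1]
    refine (key _).trans ?_
    rw [Scheme.Modules.Hom.app_smul, map_smulₛₗ]
    exact congrArg _ (key _).symm

lemma stkMap_germ {M N : X.Modules} (f : M ⟶ N) (U : X.Opens) (x : X) (hx : x ∈ U) (t : Γ(M, U)) :
    stkMap f x (stkGerm M U x hx t) = stkGerm N U x hx (f.app U t) :=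
  TopCat.Presheaf.stalkFunctor_map_germ_apply U x hx
        ((PresheafOfModules.toPresheaf X.ringCatSheaf.obj).map f.val) t

lemma stkMap_comp {M N P : X.Modules} (f : M ⟶ N) (g : N ⟶ P) (x : X) (m : Stk M x) :
    stkMap (f ≫ g) x m = stkMap g x (stkMap f x m) :=
  CategoryTheory.congr_fun ((stalkAb x).map_comp f g) m

lemma stkMap_id (M : X.Modules) (x : X) (m : Stk M x) : stkMap (𝟙 M) x m = m :=
  CategoryTheory.congr_fun ((stalkAb x).map_id M) m

/-- The stalk of a sheaf of modules only depends on its isomorphism class. -/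
def stkEquiv {M N : X.Modules} (e : M ≅ N) (x : X) :
    Stk M x ≃ₗ[X.presheaf.stalk x] Stk N x :=
  { stkMap e.hom x with
    invFun := stkMap e.inv x
    left_inv := fun m => by
      change stkMap e.inv x (stkMap e.hom x m) = m
      rw [← stkMap_comp, e.hom_inv_id, stkMap_id]
    right_inv := fun m => by
      change stkMap e.hom x (stkMap e.inv x m) = m
      rw [← stkMap_comp, e.inv_hom_id, stkMap_id] }

variable (X) in
/-- The structure sheaf as a sheaf of modules. -/
abbrev unitModule : X.Modules := SheafOfModules.unit X.ringCatSheaf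

variable (X) in
/-- A free sheaf of modules. -/
abbrev freeModule (I : Type u) : X.Modules := SheafOfModules.free (R := X.ringCatSheaf) I

lemma stkGerm_unit_eq_smul (x : X) (U : X.Opens) (hx : x ∈ U) (s : Γ(X, U)) :
    stkGerm (unitModule X) U x hx s =
      X.presheaf.germ U x hx s • stkGerm (unitModule X) ⊤ x trivial (1 : Γ(X, ⊤)) := by
  have h1 : stkGerm (unitModule X) ⊤ x trivial (1 : Γ(X, ⊤)) =
      stkGerm (unitModule X) U x hx (1 : Γ(X, U)) := by
    have := stkGerm_secRes (unitModule X) (U.leTop) x hx (1 : Γ(X, ⊤))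
    refine this.symm.trans (congrArg (stkGerm (unitModule X) U x hx) ?_)
    exact map_one (X.presheaf.map (U.leTop).op).hom
  rw [h1]
  refine Eq.trans ?_ (map_smulₛₗ (stkGerm (unitModule X) U x hx) s (1 : Γ(X, U)))
  congr 1
  exact (mul_one s).symm

/-- The stalk of the structure sheaf as a sheaf of modules is the local ring. -/
def stkUnitEquiv (x : X) : X.presheaf.stalk x ≃ₗ[X.presheaf.stalk x] Stk (unitModule X) x :=
  LinearEquiv.ofBijective (LinearMap.toSpanSingleton _ _
      (stkGerm (unitModule X) ⊤ x trivial (1 : Γ(X, ⊤)))) <| by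
    constructor
    · rw [injective_iff_map_eq_zero]
      intro r hr
      obtain ⟨U, hU, a, rfl⟩ := TopCat.Presheaf.exists_germ_eq X.presheaf r
      have h1 : stkGerm (unitModule X) U x hU a = stkGerm (unitModule X) U x hU (0 : Γ(X, U)) := by
        rw [stkGerm_unit_eq_smul]
        refine Eq.trans hr ?_
        exact (map_zero (stkGerm (unitModule X) U x hU)).symm
      obtain ⟨W, hW, i, j, h⟩ := stkGerm_eq hU hU h1
      have h2 : X.presheaf.map i.op a = X.presheaf.map j.op 0 := h
      rw [← TopCat.Presheaf.germ_res_apply X.presheaf i x hW a, h2, map_zero, map_zero]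
    · intro m
      obtain ⟨U, hU, s, rfl⟩ := exists_stkGerm m
      exact ⟨X.presheaf.germ U x hU s, (stkGerm_unit_eq_smul x U hU s).symm⟩

lemma stkUnitEquiv_germ (x : X) (U : X.Opens) (hx : x ∈ U) (s : Γ(X, U)) :
    stkUnitEquiv x (X.presheaf.germ U x hx s) = stkGerm (unitModule X) U x hx s :=
  (stkGerm_unit_eq_smul x U hx s).symm

instance free_stk_unit (x : X) : Module.Free (X.presheaf.stalk x) (Stk (unitModule X) x) :=
  Module.Free.of_equiv (stkUnitEquiv x)

/-- Stalks commute with coproducts, so the stalk is a direct sum of copies of the stalk of the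
structure sheaf. The projections `pr` of the coproduct give injectivity of the comparison map `L`;
the universal property gives surjectivity. -/
instance free_stk_free (I : Type u) (x : X) :
    Module.Free (X.presheaf.stalk x) (Stk (freeModule X I) x) := by
  classical
  let ι : ∀ i : I, unitModule X ⟶ freeModule X I := fun i => SheafOfModules.ιFree i
  let hc := SheafOfModules.isColimitFreeCofan (R := X.ringCatSheaf) I
  let pr : ∀ j : I, freeModule X I ⟶ unitModule X := fun j =>
    Cofan.IsColimit.desc hc fun i => if i = j then 𝟙 _ else 0
  have hpr : ∀ i j, ι i ≫ pr j = if i = j then 𝟙 _ else 0 := fun i j =>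
    Cofan.IsColimit.fac hc _ i
  let L : (I →₀ Stk (unitModule X) x) →ₗ[X.presheaf.stalk x] Stk (freeModule X I) x :=
    Finsupp.lsum (X.presheaf.stalk x) fun i => stkMap (ι i) x
  have hL1 : ∀ j z, stkMap (pr j) x (L z) = z j := by
    intro j z
    induction z using Finsupp.induction_linear with
    | zero => simp
    | add f g hf hg => rw [map_add, map_add, hf, hg, Finsupp.add_apply]
    | single i m =>
      simp only [L, Finsupp.lsum_single]
      rw [← stkMap_comp, hpr, Finsupp.single_apply]
      split_ifs
      · exact stkMap_id _ _ _
      · exact CategoryTheory.congr_fun ((stalkAb x).map_zero (unitModule X) (unitModule X)) m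
  have hL : Function.Bijective L := by
    constructor
    · intro y z h
      ext j
      rw [← hL1, ← hL1, h]
    · rw [← LinearMap.range_eq_top, ← Submodule.Quotient.subsingleton_iff,
        ← not_nontrivial_iff_subsingleton]
      -- The quotient map by the range of `L` kills every summand, hence vanishes because the stalk
      -- is their coproduct in `Ab`.
      let Q : Ab.{u} := AddCommGrpCat.of (Stk (freeModule X I) x ⧸ LinearMap.range L)
      let q : (stalkAb x).obj (freeModule X I) ⟶ Q :=
        AddCommGrpCat.ofHom (LinearMap.range L).mkQ.toAddMonoidHom
      have hq : q = 0 := by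
        have hK : PreservesColimit (Discrete.functor fun _ : I => unitModule X) (stalkAb x) :=
          (inferInstance : PreservesColimitsOfShape (Discrete I) (stalkAb x)).preservesColimit
        have hc' := @isColimitOfPreserves _ _ _ _ _ _ _ (stalkAb x) _ hc hK
        refine hc'.hom_ext fun ⟨i⟩ => ?_
        ext m
        exact (Submodule.Quotient.mk_eq_zero _).mpr ⟨Finsupp.single i m,
          Finsupp.lsum_single (X.presheaf.stalk x) (fun i => stkMap (ι i) x) i m⟩
      rintro ⟨a, b, hab⟩
      obtain ⟨a, rfl⟩ := Submodule.Quotient.mk_surjective _ a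
      obtain ⟨b, rfl⟩ := Submodule.Quotient.mk_surjective _ b
      exact hab ((CategoryTheory.congr_fun hq a).trans (CategoryTheory.congr_fun hq b).symm)
  exact Module.Free.of_equiv (LinearEquiv.ofBijective L hL)

end DerivedSymmetricPower
end

/-! ### Stalks of locally free sheaves -/

section
open CategoryTheory AlgebraicGeometry TopologicalSpace Limits
namespace DerivedSymmetricPower
variable {X : Scheme.{u}}

/-- The restriction of a free sheaf of modules. -/
def overFreeIso (U : X.Opens) (I : Type u) :
    freeModule U.toScheme I ≅
      (Scheme.Modules.overEquiv U).functor.obj (SheafOfModules.free (R := X.ringCatSheaf.over U) I) :=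
  let F : SheafOfModules.{u} (X.ringCatSheaf.over U) ⥤ SheafOfModules.{u} U.toScheme.ringCatSheaf :=
    (Scheme.Modules.overEquiv U).functor
  have : PreservesColimitsOfShape (Discrete I) F :=
    (Scheme.Modules.overEquiv U).toAdjunction.leftAdjoint_preservesColimits.1
  SheafOfModules.mapFreeIso F I
    ((Scheme.Modules.restrictUnitIso U.ι).symm ≪≫
      ((Scheme.Modules.overFunctorEquiv U).app (SheafOfModules.unit X.ringCatSheaf)).symm)

/-- A locally free sheaf is free on an open neighbourhood of every point. -/
lemma exists_iso_freeModule (M : X.Modules) [hM : M.IsLocallyFree] (x : X) :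
    ∃ (U : X.Opens) (_ : x ∈ U) (I : Type u), Nonempty (freeModule U.toScheme I ≅ M.restrict U.ι) := by
  obtain ⟨q, hq⟩ := hM.exists_isLocallyFreeData
  have cov := q.coversTop
  rw [Opens.coversTop_iff] at cov
  obtain ⟨i, hi⟩ := Opens.mem_iSup.mp (show x ∈ ⨆ i, q.X i from cov ▸ trivial)
  refine ⟨q.X i, hi, (q.generators i).I, ⟨?_⟩⟩
  have : IsIso (q.generators i).π := hq.isIso i
  exact overFreeIso _ _ ≪≫
    (Scheme.Modules.overEquiv (q.X i)).functor.mapIso (asIso (q.generators i).π) ≪≫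
    (Scheme.Modules.overFunctorEquiv (q.X i)).app M

variable {Y : Scheme.{u}}

/-- The comparison map between the stalk of a sheaf and the stalk of a restriction. -/
def stkRestrict (M : Y.Modules) (f : X ⟶ Y) [IsOpenImmersion f] (x : X) :
    Stk (M.restrict f) x ≃+ Stk M (f x) :=
  ((Scheme.Modules.restrictStalkNatIso f x).app M).addCommGroupIsoToAddEquiv

lemma stkRestrict_germ (M : Y.Modules) (f : X ⟶ Y) [IsOpenImmersion f] (x : X) (U : X.Opens)
    (hx : x ∈ U) (s : Γ(M.restrict f, U)) :
    stkRestrict M f x (stkGerm (M.restrict f) U x hx s) =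
      stkGerm M (f ''ᵁ U) (f x) (by simpa) s :=
  CategoryTheory.congr_fun (Scheme.Modules.germ_restrictStalkNatIso_hom_app f x M hx) s

lemma stkRestrict_smul (M : Y.Modules) (f : X ⟶ Y) [IsOpenImmersion f] (x : X)
    (r : Y.presheaf.stalk (f x)) (m : Stk (M.restrict f) x) :
    stkRestrict M f x ((f.stalkMap x).hom r • m) = r • stkRestrict M f x m := by
  obtain ⟨V, hV, s, rfl⟩ := exists_stkGerm m
  obtain ⟨U, hU, a, rfl⟩ := TopCat.Presheaf.exists_germ_eq Y.presheaf r
  let W : X.Opens := f ⁻¹ᵁ U ⊓ V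
  have hW : x ∈ W := ⟨hU, hV⟩
  have hW' : f x ∈ f ''ᵁ W := by simpa
  have hle : f ''ᵁ W ≤ U := by
    rintro _ ⟨y, hy, rfl⟩
    exact hy.1
  rw [← stkGerm_secRes (M.restrict f) (Opens.infLERight (f ⁻¹ᵁ U) V) x hW s,
      ← TopCat.Presheaf.germ_res_apply Y.presheaf (homOfLE hle) (f x) hW' a]
  generalize Y.presheaf.map (homOfLE hle).op a = b
  generalize secRes (M.restrict f) (Opens.infLERight (f ⁻¹ᵁ U) V) s = t
  have h1 : (f.stalkMap x).hom (Y.presheaf.germ (f ''ᵁ W) (f x) hW' b) =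
      X.presheaf.germ W x hW ((f.appIso W).hom b) := by
    refine (CategoryTheory.congr_fun (f.germ_stalkMap (f ''ᵁ W) x hW') b).trans ?_
    rw [Scheme.Hom.appIso_hom]
    exact (TopCat.Presheaf.germ_res_apply X.presheaf _ x hW _).symm
  refine (congrArg (fun r => stkRestrict M f x (r • stkGerm (M.restrict f) W x hW t)) h1).trans ?_
  refine (congrArg (stkRestrict M f x) (map_smulₛₗ (stkGerm (M.restrict f) W x hW) _ t).symm).trans ?_
  rw [stkRestrict_germ, stkRestrict_germ]
  refine Eq.trans ?_ (map_smulₛₗ (stkGerm M (f ''ᵁ W) (f x) hW') b t)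
  refine congrArg _ ?_
  -- Scalars act on the sections of the restriction through the inverse of `f.appIso W`; once `b` is
  -- written in this form the two actions agree by definition.
  have : ((f.appIso W).inv ((f.appIso W).hom b)) = b := by simp
  nth_rw 2 [← this]
  rfl

/-- Near `x` the sheaf is free, so the stalk of its restriction is free. An open immersion induces
an isomorphism `ρ` of local rings, along which freeness is carried back. -/
lemma free_stk (M : X.Modules) [M.IsLocallyFree] (x : X) :
    Module.Free (X.presheaf.stalk x) (Stk M x) := by
  obtain ⟨U, hx, I, ⟨e⟩⟩ := exists_iso_freeModule M x
  let y : U.toScheme := ⟨x, hx⟩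
  have : Module.Free (U.toScheme.presheaf.stalk y) (Stk (M.restrict U.ι) y) :=
    Module.Free.of_equiv (stkEquiv e y)
  let ρ : X.presheaf.stalk x ≃+* U.toScheme.presheaf.stalk y :=
    (asIso (U.ι.stalkMap y)).commRingCatIsoToRingEquiv
  let σ := ρ.symm.toRingHom
  have : RingHomInvPair σ ρ.toRingHom := ⟨by ext; simp [σ], by ext; simp [σ]⟩
  have : RingHomInvPair ρ.toRingHom σ := ⟨by ext; simp [σ], by ext; simp [σ]⟩
  let F : Stk (M.restrict U.ι) y ≃ₛₗ[σ] Stk M x :=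
    { stkRestrict M U.ι y with
      map_smul' := fun r m => by
        obtain ⟨r, rfl⟩ := ρ.surjective r
        refine (stkRestrict_smul M U.ι y r m).trans ?_
        simp [σ]
        rfl }
  exact Module.Free.of_equiv F
end DerivedSymmetricPower
end

/-! ### Stalks of presheaves of tensor powers -/

section
open CategoryTheory AlgebraicGeometry TopologicalSpace Limits
namespace DerivedSymmetricPower
variable {X : Scheme.{u}}

lemma exists_nhd_le {ι : Type*} [Finite ι] {x : X} (W : ι → X.Opens) (hW : ∀ i, x ∈ W i) :
    ∃ V : X.Opens, x ∈ V ∧ ∀ i, V ≤ W i := by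
  cases nonempty_fintype ι
  exact ⟨Finset.univ.inf W, Finset.inf_induction (p := fun U : X.Opens => x ∈ U) trivial
    (fun _ h _ h' => ⟨h, h'⟩) (fun i _ => hW i), fun i => Finset.inf_le (Finset.mem_univ i)⟩

lemma exists_stkGerm_family {ι : Type*} [Finite ι] {M : ι → X.Modules} {x : X}
    (m : ∀ i, Stk (M i) x) (V : X.Opens) (hV : x ∈ V) :
    ∃ (U : X.Opens) (hx : x ∈ U) (_ : U ≤ V) (s : ∀ i, Γ(M i, U)), ∀ i, stkGerm (M i) U x hx (s i) = m i := by
  choose U hU s hs using fun i => exists_stkGerm (m i)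
  obtain ⟨W, hW, hle⟩ := exists_nhd_le (fun o : Option ι => o.elim V U)
    (fun o => by cases o; exacts [hV, hU _])
  exact ⟨W, hW, hle none, fun i => secRes (M i) (homOfLE (hle (some i))) (s i), fun i =>
    (stkGerm_secRes (M i) (homOfLE (hle (some i))) x hW (s i)).trans (hs i)⟩

lemma exists_nhd_secRes_eq {ι : Type*} [Finite ι] {M : ι → X.Modules} {x : X} {U V : X.Opens} (hU : x ∈ U)
    (hV : x ∈ V) (s : ∀ i, Γ(M i, U)) (t : ∀ i, Γ(M i, V))
    (h : ∀ i, stkGerm (M i) U x hU (s i) = stkGerm (M i) V x hV (t i)) :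
    ∃ (W : X.Opens) (_ : x ∈ W) (i : W ⟶ U) (j : W ⟶ V),
      ∀ l, secRes (M l) i (s l) = secRes (M l) j (t l) := by
  choose W hW i j hij using fun l => stkGerm_eq hU hV (h l)
  obtain ⟨W', hW', hle⟩ := exists_nhd_le (fun o : Option ι => o.elim (U ⊓ V) W)
    (fun o => by cases o; exacts [⟨hU, hV⟩, hW _])
  refine ⟨W', hW', homOfLE ((hle none).trans inf_le_left), homOfLE ((hle none).trans inf_le_right),
    fun l => ?_⟩
  have key : ∀ {A : X.Opens} (f : W l ⟶ A) (g : W' ⟶ A) (y : Γ(M l, A)),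
      secRes (M l) g y = secRes (M l) (homOfLE (hle (some l))) (secRes (M l) f y) := by
    intro A f g y
    exact CategoryTheory.congr_fun ((M l).presheaf.map_comp f.op (homOfLE (hle (some l))).op) y
  rw [key (i l), key (j l), hij]

lemma exists_stkGerm_family₂ {ι κ : Type*} [Finite ι] [Finite κ] {M : ι → X.Modules} {N : X.Modules} {x : X}
    (m : ∀ i, Stk (M i) x) (n : κ → Stk N x) (V : X.Opens) (hV : x ∈ V) :
    ∃ (U : X.Opens) (hx : x ∈ U) (_ : U ≤ V) (s : ∀ i, Γ(M i, U)) (t : κ → Γ(N, U)),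
      m = (fun i => stkGerm (M i) U x hx (s i)) ∧ n = fun i => stkGerm N U x hx (t i) := by
  obtain ⟨U, hU, hUV, s, hs⟩ := exists_stkGerm_family m V hV
  obtain ⟨W, hW, hWU, t, ht⟩ := exists_stkGerm_family (M := fun _ => N) n U hU
  refine ⟨W, hW, hWU.trans hUV, fun i => secRes (M i) (homOfLE hWU) (s i), t, ?_, ?_⟩
  · ext1 i
    rw [stkGerm_secRes, hs]
  · ext1 i
    rw [ht]

/-- The presheaf of tensor powers of a graded sheaf of modules. -/
def tpowPresheaf (E : ℕ → X.Modules) (k : ℕ) : X.PresheafOfModules where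
  obj U := ModuleCat.of Γ(X, U.unop) (TPow Γ(X, U.unop) (fun m => Γ(E m, U.unop)) k)
  map {U V} f := ModuleCat.semilinearMapAddEquiv _ _ _
    (tpowMap (fun m => secRes (E m) f.unop) k)
  map_id U := by
    refine ModuleCat.hom_ext (LinearMap.ext fun z => ?_)
    exact tpowMap_eq_self (fun m => secRes (E m) (𝟙 U.unop))
      (fun r => CategoryTheory.congr_fun (X.presheaf.map_id U) r)
      (fun m x => CategoryTheory.congr_fun ((E m).presheaf.map_id U) x)
      (show TPow Γ(X, U.unop) (fun m => Γ(E m, U.unop)) k from z)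
  map_comp {U V W} f g := by
    refine ModuleCat.hom_ext (LinearMap.ext fun z => ?_)
    exact tpowMap_eq_comp (fun m => secRes (E m) f.unop) (fun m => secRes (E m) g.unop)
      (fun m => secRes (E m) (f ≫ g).unop)
      (fun r => CategoryTheory.congr_fun (X.presheaf.map_comp f g) r)
      (fun m x => CategoryTheory.congr_fun ((E m).presheaf.map_comp f g) x)
      (show TPow Γ(X, U.unop) (fun m => Γ(E m, U.unop)) k from z)

/-- The stalk of the presheaf of tensor powers. -/
def TStk (E : ℕ → X.Modules) (k : ℕ) (x : X) : Type u :=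
  ↑(TopCat.Presheaf.stalk (tpowPresheaf E k).presheaf x)

variable (E : ℕ → X.Modules) (k : ℕ) (x : X)

instance : AddCommGroup (TStk E k x) :=
  (TopCat.Presheaf.stalk (tpowPresheaf E k).presheaf x).str

instance : Module (X.presheaf.stalk x) (TStk E k x) :=
  PresheafOfModules.instModuleCarrierStalkCommRingCatCarrierAbPresheafOpensCarrier
    (R := X.presheaf) (tpowPresheaf E k) x

variable {x}

/-- The germ of a section of the presheaf of tensor powers. -/
def tstkGerm (U : X.Opens) (hx : x ∈ U) :
    TPow Γ(X, U) (fun m => Γ(E m, U)) k →ₛₗ[(X.presheaf.germ U x hx).hom] TStk E k x where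
  toFun s := show ↑(TopCat.Presheaf.stalk (tpowPresheaf E k).presheaf x) from
    TopCat.Presheaf.germ (tpowPresheaf E k).presheaf U x hx s
  map_add' := map_add (TopCat.Presheaf.germ (tpowPresheaf E k).presheaf U x hx).hom
  map_smul' r s := PresheafOfModules.germ_smul (R := X.presheaf) (tpowPresheaf E k) x U hx r s

variable {E k}

lemma tstkGerm_res {U V : X.Opens} (i : U ⟶ V) (hx : x ∈ U)
    (s : TPow Γ(X, V) (fun m => Γ(E m, V)) k) :
    tstkGerm E k U hx (tpowMap (fun m => secRes (E m) i) k s) = tstkGerm E k V (i.le hx) s :=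
  TopCat.Presheaf.germ_res_apply (tpowPresheaf E k).presheaf i x hx s

lemma exists_res_eq_zero {U : X.Opens} (hx : x ∈ U) {s : TPow Γ(X, U) (fun m => Γ(E m, U)) k}
    (h : tstkGerm E k U hx s = 0) :
    ∃ (W : X.Opens) (_ : x ∈ W) (i : W ⟶ U), tpowMap (fun m => secRes (E m) i) k s = 0 := by
  obtain ⟨W, hW, i, j, h⟩ := TopCat.Presheaf.germ_eq (tpowPresheaf E k).presheaf x hx hx s 0
    (h.trans (map_zero (tstkGerm E k U hx)).symm)
  exact ⟨W, hW, i, h.trans (map_zero (tpowMap (fun m => secRes (E m) j) k))⟩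

/-- This makes `tstkMul` independent of the representatives chosen in its definition. -/
lemma tstkGerm_homTensor_eq {U V : X.Opens} (hU : x ∈ U) (hV : x ∈ V) (a : Fin k → ℕ)
    (s : ∀ i, Γ(E (a i), U)) (t : ∀ i, Γ(E (a i), V))
    (h : ∀ i, stkGerm (E (a i)) U x hU (s i) = stkGerm (E (a i)) V x hV (t i)) :
    tstkGerm E k U hU (homTensor (E := fun m => Γ(E m, U)) Γ(X, U) a s) =
      tstkGerm E k V hV (homTensor (E := fun m => Γ(E m, V)) Γ(X, V) a t) := by
  obtain ⟨W, hW, i, j, hij⟩ := exists_nhd_secRes_eq (M := fun l => E (a l)) hU hV s t h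
  rw [← tstkGerm_res i hW, ← tstkGerm_res j hW, tpowMap_homTensor, tpowMap_homTensor]
  simp only [hij]

/-- The germ of a tensor product of representatives of germs. -/
def tstkMul (a : Fin k → ℕ) (m : ∀ i, Stk (E (a i)) x) : TStk E k x :=
  let h := exists_stkGerm_family m ⊤ trivial
  tstkGerm E k h.choose h.choose_spec.choose
    (homTensor (E := fun m => Γ(E m, h.choose)) _ a h.choose_spec.choose_spec.choose_spec.choose)

lemma tstkMul_germ (a : Fin k → ℕ) (U : X.Opens) (hU : x ∈ U) (s : ∀ i, Γ(E (a i), U)) :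
    tstkMul a (fun i => stkGerm (E (a i)) U x hU (s i)) =
      tstkGerm E k U hU (homTensor (E := fun m => Γ(E m, U)) Γ(X, U) a s) :=
  let h := exists_stkGerm_family (fun i => stkGerm (E (a i)) U x hU (s i)) ⊤ trivial
  tstkGerm_homTensor_eq _ _ a _ _ h.choose_spec.choose_spec.choose_spec.choose_spec

lemma homTensor_eq_map {A : Type u} [CommRing A] {F : ℕ → Type u} [∀ n, AddCommGroup (F n)]
    [∀ n, Module A (F n)] (a : Fin k → ℕ) :
    ∃ f : MultilinearMap A (fun i => F (a i)) (TPow A F k), ∀ s, f s = homTensor A a s :=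
  ⟨(PiTensorProduct.tprod A).compLinearMap fun i => DirectSum.lof A ℕ F (a i), fun _ => rfl⟩

lemma update_stkGerm (a : Fin k → ℕ) (U : X.Opens) (hU : x ∈ U) (s : ∀ i, Γ(E (a i), U))
    (i : Fin k) (w : Γ(E (a i), U)) :
    Function.update (fun j => stkGerm (E (a j)) U x hU (s j)) i (stkGerm (E (a i)) U x hU w) =
      fun j => stkGerm (E (a j)) U x hU (Function.update s i w j) :=
  funext fun j => (Function.apply_update (fun j => stkGerm (E (a j)) U x hU) s i w j).symm

variable (E x) in
/-- `tstkMul` as a multilinear map. -/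
def tstkMultilinear (a : Fin k → ℕ) :
    MultilinearMap (X.presheaf.stalk x) (fun i => Stk (E (a i)) x) (TStk E k x) where
  toFun := tstkMul a
  map_update_add' := by
    intro inst m i y z
    obtain rfl : inst = instDecidableEqFin k := Subsingleton.elim _ _
    -- The family indexed by `Bool` represents both summands on one neighbourhood together with all
    -- entries of `m`.
    obtain ⟨U, hU, -, s, t, rfl, ht⟩ := exists_stkGerm_family₂ (κ := Bool) m
      (fun b => if b then y else z) ⊤ trivial
    obtain rfl : y = _ := congrFun ht true
    obtain rfl : z = _ := congrFun ht false
    rw [← map_add, update_stkGerm, update_stkGerm, update_stkGerm, tstkMul_germ, tstkMul_germ,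
      tstkMul_germ, ← map_add]
    congr 1
    obtain ⟨f, hf⟩ := homTensor_eq_map (A := Γ(X, U)) (F := fun m => Γ(E m, U)) a
    rw [← hf, ← hf, ← hf]
    exact f.map_update_add _ _ _ _
  map_update_smul' := by
    intro inst m i r y
    obtain rfl : inst = instDecidableEqFin k := Subsingleton.elim _ _
    obtain ⟨V, hV, r, rfl⟩ := TopCat.Presheaf.exists_germ_eq X.presheaf r
    obtain ⟨U, hU, hle, s, t, rfl, ht⟩ := exists_stkGerm_family₂ (κ := Unit) m (fun _ => y) V hV
    obtain rfl : y = _ := congrFun ht ()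
    rw [← TopCat.Presheaf.germ_res_apply X.presheaf (homOfLE hle) x hU]
    generalize X.presheaf.map (homOfLE hle).op r = r
    have h1 : X.presheaf.germ U x hU r • stkGerm (E (a i)) U x hU (t ()) =
      stkGerm (E (a i)) U x hU (r • t ()) := (map_smulₛₗ (stkGerm (E (a i)) U x hU) r (t ())).symm
    rw [h1, update_stkGerm, update_stkGerm, tstkMul_germ, tstkMul_germ]
    refine Eq.trans ?_ (map_smulₛₗ (tstkGerm E k U hU) r _)
    congr 1
    obtain ⟨f, hf⟩ := homTensor_eq_map (A := Γ(X, U)) (F := fun m => Γ(E m, U)) a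
    rw [← hf, ← hf]
    exact f.map_update_smul _ _ _ _

variable (E k x) in
/-- The comparison map from the tensor power of the stalks to the stalk of the tensor powers. -/
def tpowStkToTStk : TPow (X.presheaf.stalk x) (fun m => Stk (E m) x) k →ₗ[X.presheaf.stalk x] TStk E k x :=
  PiTensorProduct.lift (MultilinearMap.fromDirectSumEquiv
    (R := X.presheaf.stalk x) (M := fun (_ : Fin k) m => Stk (E m) x) fun a => tstkMultilinear E x a)

lemma tpowStkToTStk_homTensor (a : Fin k → ℕ) (m : ∀ i, Stk (E (a i)) x) :
    tpowStkToTStk E k x (homTensor (E := fun m => Stk (E m) x) _ a m) = tstkMul a m := by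
  rw [tpowStkToTStk, homTensor, PiTensorProduct.lift.tprod]
  exact MultilinearMap.fromDirectSumEquiv_lof (R := X.presheaf.stalk x)
    (M := fun (_ : Fin k) m => Stk (E m) x) (fun a => tstkMultilinear E x a) a m 

end DerivedSymmetricPower
end

/-! ### Invariants of tensor powers commute with stalks -/

section
open CategoryTheory AlgebraicGeometry TopologicalSpace Limits
namespace DerivedSymmetricPower
variable {X : Scheme.{u}}

section Germs
variable {E : ℕ → X.Modules} {k : ℕ} {x : X}

/-- The germ of a tensor is determined by its image in the tensor power of the stalks. This is the
only property of the comparison map that is used. -/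
lemma tpowStkToTStk_germ (U : X.Opens) (hU : x ∈ U) (z : TPow Γ(X, U) (fun m => Γ(E m, U)) k) :
    tpowStkToTStk E k x (tpowMap (fun m => stkGerm (E m) U x hU) k z) = tstkGerm E k U hU z := by
  induction z using tpow_induction with
  | h r a s =>
    rw [map_smulₛₗ, map_smul, map_smulₛₗ, tpowMap_homTensor, tpowStkToTStk_homTensor, tstkMul_germ]
  | hadd y z hy hz => rw [map_add, map_add, map_add, hy, hz]

/-- A relation in the tensor power of the stalks already holds near the point: the comparison map
carries it to a relation between germs of the presheaf. -/
lemma exists_tpowMap_secRes_eq_zero (U : X.Opens) (hU : x ∈ U)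
    (z : TPow Γ(X, U) (fun m => Γ(E m, U)) k)
    (hz : tpowMap (fun m => stkGerm (E m) U x hU) k z = 0) :
    ∃ (W : X.Opens) (_ : x ∈ W) (i : W ⟶ U), tpowMap (fun m => secRes (E m) i) k z = 0 := by
  apply exists_res_eq_zero hU
  rw [← tpowStkToTStk_germ, hz, map_zero]

lemma tpowMap_stkGerm_secRes {U V : X.Opens} (i : U ⟶ V) (hU : x ∈ U)
    (z : TPow Γ(X, V) (fun m => Γ(E m, V)) k) :
    tpowMap (fun m => stkGerm (E m) U x hU) k (tpowMap (fun m => secRes (E m) i) k z) =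
      tpowMap (fun m => stkGerm (E m) V x (i.le hU)) k z :=
  (tpowMap_eq_comp _ _ _ (fun r => (TopCat.Presheaf.germ_res_apply X.presheaf i x hU r).symm)
    (fun m s => (stkGerm_secRes (E m) i x hU s).symm) z).symm

lemma exists_degPart_rep {n : ℕ} {t : TPow (X.presheaf.stalk x) (fun m => Stk (E m) x) k}
    (ht : t ∈ degPart (X.presheaf.stalk x) (fun m => Stk (E m) x) k n) :
    ∃ (U : X.Opens) (hU : x ∈ U) (z : TPow Γ(X, U) (fun m => Γ(E m, U)) k),
      z ∈ degPart Γ(X, U) (fun m => Γ(E m, U)) k n ∧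
        tpowMap (fun m => stkGerm (E m) U x hU) k z = t := by
  induction ht using Submodule.span_induction with
  | mem t ht =>
    obtain ⟨a, m, ha, rfl⟩ := ht
    obtain ⟨U, hU, -, s, hs⟩ := exists_stkGerm_family (M := fun i => E (a i)) m ⊤ trivial
    refine ⟨U, hU, homTensor (E := fun m => Γ(E m, U)) _ a s, Submodule.subset_span ⟨a, s, ha, rfl⟩, ?_⟩
    rw [tpowMap_homTensor]
    exact congrArg _ (funext hs)
  | zero => exact ⟨⊤, trivial, 0, zero_mem _, map_zero _⟩
  | add y t _ _ hy ht =>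
    obtain ⟨U, hU, z, hz, rfl⟩ := hy
    obtain ⟨V, hV, w, hw, rfl⟩ := ht
    have hUV : x ∈ U ⊓ V := ⟨hU, hV⟩
    refine ⟨U ⊓ V, hUV, tpowMap (fun m => secRes (E m) (Opens.infLELeft U V)) k z +
      tpowMap (fun m => secRes (E m) (Opens.infLERight U V)) k w,
      add_mem (tpowMap_mem_degPart _ hz) (tpowMap_mem_degPart _ hw), ?_⟩
    rw [map_add, tpowMap_stkGerm_secRes, tpowMap_stkGerm_secRes]
  | smul r t _ ht =>
    obtain ⟨U, hU, z, hz, rfl⟩ := ht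
    obtain ⟨V, hV, r, rfl⟩ := TopCat.Presheaf.exists_germ_eq X.presheaf r
    have hUV : x ∈ U ⊓ V := ⟨hU, hV⟩
    refine ⟨U ⊓ V, hUV, X.presheaf.map (Opens.infLERight U V).op r •
      tpowMap (fun m => secRes (E m) (Opens.infLELeft U V)) k z,
      Submodule.smul_mem _ _ (tpowMap_mem_degPart _ hz), ?_⟩
    rw [map_smulₛₗ, tpowMap_stkGerm_secRes]
    congr 1
    exact TopCat.Presheaf.germ_res_apply X.presheaf (Opens.infLERight U V) x ⟨hU, hV⟩ r

/-- Invariance amounts to one equation for each element of the finite group `S_k`. Each holds after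
restriction to some neighbourhood, and so all of them hold on a common one. -/
lemma exists_symPart_rep {n : ℕ} (t : symPart (X.presheaf.stalk x) (fun m => Stk (E m) x) k n) :
    ∃ (U : X.Opens) (hU : x ∈ U) (z : symPart Γ(X, U) (fun m => Γ(E m, U)) k n),
        symMap (fun m => stkGerm (E m) U x hU) k n z = t := by
  obtain ⟨t, ht, ht'⟩ := t
  obtain ⟨U, hU, z, hz, rfl⟩ := exists_degPart_rep ht
  have h1 : ∀ π : Equiv.Perm (Fin k), ∃ (W : X.Opens) (_ : x ∈ W) (i : W ⟶ U),
      tpowMap (fun m => secRes (E m) i) k (permAct _ _ π z - z) = 0 := by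
    intro π
    apply exists_tpowMap_secRes_eq_zero U hU
    rw [map_sub, ← permAct_tpowMap, ht', sub_self]
  choose W hW i hi using h1
  obtain ⟨V, hV, hle⟩ := exists_nhd_le W hW
  let j : V ⟶ U := homOfLE ((hle 1).trans (i 1).le)
  refine ⟨V, hV, ⟨tpowMap (fun m => secRes (E m) j) k z, tpowMap_mem_degPart _ hz, fun π => ?_⟩,
    Subtype.ext (tpowMap_stkGerm_secRes j hV z)⟩
  have h2 : tpowMap (fun m => secRes (E m) j) k (permAct _ _ π z - z) = 0 := by
    have h3 := tpowMap_eq_comp (fun m => secRes (E m) (i π))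
      (fun m => secRes (E m) (homOfLE (hle π))) (fun m => secRes (E m) j)
      (fun r => CategoryTheory.congr_fun (X.presheaf.map_comp (i π).op (homOfLE (hle π)).op) r)
      (fun m x => CategoryTheory.congr_fun
        ((E m).presheaf.map_comp (i π).op (homOfLE (hle π)).op) x)
      (permAct _ _ π z - z)
    rw [h3, hi, map_zero]
  rw [permAct_tpowMap]
  exact sub_eq_zero.mp ((map_sub (tpowMap (fun m => secRes (E m) j) k) _ _).symm.trans h2)

end Germs

/-! ### The stalks of the complex of symmetric powers -/

section Complex
variable {E : ChainComplex X.Modules ℕ} {k n : ℕ} {x : X}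

variable (E x) in
/-- The differential of the complex of stalks. -/
def stkD (n : ℕ) : Stk (E.X (n + 1)) x →ₗ[X.presheaf.stalk x] Stk (E.X n) x :=
  stkMap (E.d (n + 1) n) x

lemma stkD_germ (U : X.Opens) (hU : x ∈ U) (n : ℕ) (s : Γ(E.X (n + 1), U)) :
    stkD E x n (stkGerm (E.X (n + 1)) U x hU s) = stkGerm (E.X n) U x hU (secD E U n s) :=
  stkMap_germ _ _ _ _ _

variable (E x) in
/-- The differential of the symmetric power of the complex of stalks. -/
def stkSymD (k n : ℕ) : symPart (X.presheaf.stalk x) (fun m => Stk (E.X m) x) k (n + 1) →ₗ[X.presheaf.stalk x]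
    symPart (X.presheaf.stalk x) (fun m => Stk (E.X m) x) k n :=
  symD (E := fun m => Stk (E.X m) x) (stkD E x) k n

variable (E k n) in
/-- The germ of a section of `symPresheaf`. -/
def symGerm (U : X.Opens) (hU : x ∈ U) :
    symPart Γ(X, U) (fun m => Γ(E.X m, U)) k n →+ (preStalk x).obj (symPresheaf E k n) :=
  (TopCat.Presheaf.germ (symPresheaf E k n).presheaf U x hU).hom

lemma symGerm_res {U V : X.Opens} (i : U ⟶ V) (hU : x ∈ U)
    (z : symPart Γ(X, V) (fun m => Γ(E.X m, V)) k n) :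
    symGerm E k n U hU (symMap (fun m => secRes (E.X m) i) k n z) = symGerm E k n V (i.le hU) z :=
  TopCat.Presheaf.germ_res_apply (symPresheaf E k n).presheaf i x hU z

lemma exists_symGerm (y : (preStalk x).obj (symPresheaf E k n)) :
    ∃ (U : X.Opens) (hU : x ∈ U) (z : symPart Γ(X, U) (fun m => Γ(E.X m, U)) k n),
      symGerm E k n U hU z = y :=
  let ⟨U, hU, z, h⟩ := TopCat.Presheaf.exists_germ_eq (symPresheaf E k n).presheaf y
  ⟨U, hU, z, h⟩

lemma symMap_stkGerm_secRes {U V : X.Opens} (i : U ⟶ V) (hU : x ∈ U)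
    (z : symPart Γ(X, V) (fun m => Γ(E.X m, V)) k n) :
    symMap (fun m => stkGerm (E.X m) U x hU) k n (symMap (fun m => secRes (E.X m) i) k n z) =
      symMap (fun m => stkGerm (E.X m) V x (i.le hU)) k n z :=
  Subtype.ext (tpowMap_stkGerm_secRes (E := E.X) i hU z.1)

/-- Together with `exists_symPart_rep` this identifies the stalk of the presheaf of invariants with
the invariants over the local ring, without constructing an isomorphism. -/
lemma symGerm_eq_zero_iff (U : X.Opens) (hU : x ∈ U)
    (z : symPart Γ(X, U) (fun m => Γ(E.X m, U)) k n) :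
    symGerm E k n U hU z = 0 ↔ symMap (fun m => stkGerm (E.X m) U x hU) k n z = 0 := by
  constructor
  · intro h
    obtain ⟨W, hW, i, j, h⟩ := TopCat.Presheaf.germ_eq (symPresheaf E k n).presheaf x hU hU z 0
      (h.trans (map_zero (symGerm E k n U hU)).symm)
    have h : symMap (fun m => secRes (E.X m) i) k n z = 0 :=
      h.trans (map_zero (symMap (fun m => secRes (E.X m) j) k n))
    rw [← symMap_stkGerm_secRes i hW, h, map_zero]
  · intro h
    obtain ⟨W, hW, i, h⟩ := exists_tpowMap_secRes_eq_zero (E := E.X) U hU z.1 (congrArg Subtype.val h)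
    have h : symMap (fun m => secRes (E.X m) i) k n z = 0 := Subtype.ext h
    rw [← symGerm_res i hW, h, map_zero]

lemma symGerm_eq_of_stk {U V : X.Opens} (hU : x ∈ U) (hV : x ∈ V)
    {z : symPart Γ(X, U) (fun m => Γ(E.X m, U)) k n}
    {w : symPart Γ(X, V) (fun m => Γ(E.X m, V)) k n}
    (h : symMap (fun m => stkGerm (E.X m) U x hU) k n z =
      symMap (fun m => stkGerm (E.X m) V x hV) k n w) :
    symGerm E k n U hU z = symGerm E k n V hV w := by
  have hUV : x ∈ U ⊓ V := ⟨hU, hV⟩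
  have h1 := (symGerm_eq_zero_iff (U ⊓ V) hUV
    (symMap (fun m => secRes (E.X m) (Opens.infLELeft U V)) k n z -
      symMap (fun m => secRes (E.X m) (Opens.infLERight U V)) k n w)).mpr
    ((map_sub (symMap (fun m => stkGerm (E.X m) (U ⊓ V) x hUV) k n) _ _).trans
      (by rw [symMap_stkGerm_secRes, symMap_stkGerm_secRes, h, sub_self]))
  have h2 := (map_sub (symGerm E k n (U ⊓ V) hUV) _ _).symm.trans h1
  rw [symGerm_res, symGerm_res] at h2
  exact sub_eq_zero.mp h2

lemma preStalk_map_symPresheafD (U : X.Opens) (hU : x ∈ U)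
    (z : symPart Γ(X, U) (fun m => Γ(E.X m, U)) k (n + 1)) :
    (preStalk x).map (symPresheafD E k n) (symGerm E k (n + 1) U hU z) =
      symGerm E k n U hU (symD (secD E U) k n z) :=
  TopCat.Presheaf.stalkFunctor_map_germ_apply U x hU
    ((PresheafOfModules.toPresheaf X.ringCatSheaf.obj).map (symPresheafD E k n)) z

lemma tensorD_tpowMap_stkGerm (U : X.Opens) (hU : x ∈ U) (z : TPow Γ(X, U) (fun m => Γ(E.X m, U)) k) :
    tensorD (E := fun m => Stk (E.X m) x) (stkD E x) k
        (tpowMap (fun m => stkGerm (E.X m) U x hU) k z) =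
      tpowMap (fun m => stkGerm (E.X m) U x hU) k
        (tensorD (E := fun m => Γ(E.X m, U)) (secD E U) k z) :=
  tensorD_tpowMap (E := fun m => Γ(E.X m, U)) (F := fun m => Stk (E.X m) x) _ _ _
    (fun m s => stkD_germ U hU m s) z

lemma symD_symMap_stkGerm (U : X.Opens) (hU : x ∈ U)
    (z : symPart Γ(X, U) (fun m => Γ(E.X m, U)) k (n + 1)) :
    stkSymD E x k n (symMap (fun m => stkGerm (E.X m) U x hU) k (n + 1) z) =
      symMap (fun m => stkGerm (E.X m) U x hU) k n (symD (secD E U) k n z) :=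
  Subtype.ext (tensorD_tpowMap_stkGerm U hU z.1)

lemma exists_symD_eq_of_stk {U : X.Opens} {hU : x ∈ U}
    {z : symPart Γ(X, U) (fun m => Γ(E.X m, U)) k n}
    {w : symPart (X.presheaf.stalk x) (fun m => Stk (E.X m) x) k (n + 1)}
    (h : stkSymD E x k n w = symMap (fun m => stkGerm (E.X m) U x hU) k n z) :
    ∃ y, (preStalk x).map (symPresheafD E k n) y = symGerm E k n U hU z := by
  obtain ⟨V, hV, w, rfl⟩ := exists_symPart_rep (E := E.X) w
  rw [symD_symMap_stkGerm] at h
  exact ⟨symGerm E k (n + 1) V hV w,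
    (preStalk_map_symPresheafD V hV w).trans (symGerm_eq_of_stk hV hU h)⟩

lemma preStalk_exact (hx : Function.Exact (stkSymD E x k (n + 1)) (stkSymD E x k n)) :
    Function.Exact ((preStalk x).map (symPresheafD E k (n + 1)))
        ((preStalk x).map (symPresheafD E k n)) := by
  intro y
  constructor
  · intro hy
    obtain ⟨U, hU, z, rfl⟩ := exists_symGerm y
    rw [preStalk_map_symPresheafD, symGerm_eq_zero_iff, ← symD_symMap_stkGerm] at hy
    obtain ⟨w, hw⟩ := (hx _).mp hy
    exact exists_symD_eq_of_stk hw
  · rintro ⟨y, rfl⟩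
    obtain ⟨U, hU, z, rfl⟩ := exists_symGerm y
    rw [preStalk_map_symPresheafD, preStalk_map_symPresheafD, symGerm_eq_zero_iff,
      ← symD_symMap_stkGerm, ← symD_symMap_stkGerm]
    exact hx.apply_apply_eq_zero _

end Complex

/-! ### Stalks of ideal sheaves -/

section Ideals
variable {I : X.IdealSheafData} {x : X}

/-- The inclusion of a sheaf of ideals in the structure sheaf. -/
def idealInclusion (I : X.IdealSheafData) : idealModule I ⟶ unitModule X :=
  ⟨(idealSubmodule I).ι⟩

variable (I x) in
/-- The inclusion of the stalk of a sheaf of ideals in the local ring. -/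
def stkIdealInclusion : Stk (idealModule I) x →ₗ[X.presheaf.stalk x] X.presheaf.stalk x :=
  (stkUnitEquiv x).symm.toLinearMap.comp (stkMap (idealInclusion I) x)

lemma stkIdealInclusion_germ (U : X.Opens) (hU : x ∈ U) (s : Γ(idealModule I, U)) :
    stkIdealInclusion I x (stkGerm (idealModule I) U x hU s) =
      X.presheaf.germ U x hU (show idealSections I U from s).1 := by
  rw [stkIdealInclusion, LinearMap.comp_apply, stkMap_germ]
  refine (LinearEquiv.symm_apply_eq _).mpr ?_
  rw [stkUnitEquiv_germ]
  rfl

lemma stkIdealInclusion_injective : Function.Injective (stkIdealInclusion I x) := by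
  rw [injective_iff_map_eq_zero]
  intro m hm
  obtain ⟨U, hU, s, rfl⟩ := exists_stkGerm m
  rw [stkIdealInclusion_germ] at hm
  obtain ⟨W, hW, i, j, h⟩ := TopCat.Presheaf.germ_eq X.presheaf x hU hU _ 0
    (hm.trans (map_zero (X.presheaf.germ U x hU).hom).symm)
  rw [← stkGerm_secRes _ i x hW]
  have : secRes (idealModule I) i s = 0 := Subtype.ext (h.trans (map_zero (X.presheaf.map j.op).hom))
  rw [this, map_zero]

/-- A germ is represented on a smaller affine open set inside `V`, and quasi-coherence (`map_ideal`)
says that the ideal there is generated by the one on `V`. -/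
lemma range_stkIdealInclusion (V : X.affineOpens) (hV : x ∈ V.1) :
    LinearMap.range (stkIdealInclusion I x) = (I.ideal V).map (X.presheaf.germ V.1 x hV).hom := by
  apply le_antisymm
  · rintro _ ⟨m, rfl⟩
    obtain ⟨U, hU, s, rfl⟩ := exists_stkGerm m
    rw [stkIdealInclusion_germ]
    obtain ⟨_, ⟨W, hW, rfl⟩, hxW, hle⟩ := X.isBasis_affineOpens.exists_subset_of_mem_open
      (show x ∈ ((U ⊓ V.1 : X.Opens) : Set X) from ⟨hU, hV⟩) (U ⊓ V.1).isOpen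
    have h1 : W ≤ U := fun y hy => (hle hy).1
    have h2 : W ≤ V.1 := fun y hy => (hle hy).2
    have h3 := mem_idealSections.mp (show idealSections I U from s).2 ⟨W, hW⟩ h1
    rw [← I.map_ideal (U := ⟨W, hW⟩) (V := V) h2] at h3
    have h4 := Ideal.mem_map_of_mem (X.presheaf.germ W x hxW).hom h3
    rw [Ideal.map_map, ← CommRingCat.hom_comp, TopCat.Presheaf.germ_res'] at h4
    have h5 := TopCat.Presheaf.germ_res_apply X.presheaf (homOfLE h1) x hxW
      (show idealSections I U from s).1
    rw [← h5]
    exact h4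
  · rw [Ideal.map_le_iff_le_comap]
    intro f hf
    rw [← idealSections_affine] at hf
    exact ⟨stkGerm (idealModule I) V.1 x hV ⟨f, hf⟩, stkIdealInclusion_germ _ _ _⟩

end Ideals
end DerivedSymmetricPower
end

/-! ### Reduction to resolutions over local rings -/

section
open CategoryTheory AlgebraicGeometry TopologicalSpace Limits
namespace DerivedSymmetricPower
variable {X : Scheme.{u}} {E : ChainComplex X.Modules ℕ} {I : X.IdealSheafData}
  {k : ℕ} {x : X}

/-- The augmentation on stalks, as a map to the local ring. -/
def stkEps {M : X.Modules} (ε : M ⟶ idealModule I) (x : X) : Stk M x →ₗ[X.presheaf.stalk x] X.presheaf.stalk x :=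
  (stkIdealInclusion I x).comp (stkMap ε x)

lemma stkEps_germ {M : X.Modules} (ε : M ⟶ idealModule I) (U : X.Opens) (hU : x ∈ U) (s : Γ(M, U)) :
    stkEps ε x (stkGerm M U x hU s) = X.presheaf.germ U x hU (secEps ε U s) := by
  rw [stkEps, LinearMap.comp_apply, stkMap_germ, stkIdealInclusion_germ]
  rfl

lemma mulMap_tpowMap_stkGerm (ε : E.X 0 ⟶ idealModule I) (U : X.Opens) (hU : x ∈ U)
    (z : TPow Γ(X, U) (fun m => Γ(E.X m, U)) k) :
    mulMap (E := fun m => Stk (E.X m) x) (stkEps ε x) k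
        (tpowMap (fun m => stkGerm (E.X m) U x hU) k z) =
      X.presheaf.germ U x hU (mulMap (E := fun m => Γ(E.X m, U)) (secEps ε U) k z) :=
  mulMap_tpowMap (E := fun m => Γ(E.X m, U)) (F := fun m => Stk (E.X m) x) (secEps ε U) (stkEps ε x)
    (fun m => stkGerm (E.X m) U x hU) (fun s => stkEps_germ ε U hU s) z

/-- The map of stalks of presheaves induced by multiplication. -/
def preStalkMul (ε : E.X 0 ⟶ idealModule I) (k : ℕ) (x : X) :
    (preStalk x).obj (symPresheaf E k 0) →+ Stk (idealModule (I ^ k)) x :=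
  ((preStalk x).map (mulPresheaf ε k)).hom

lemma preStalkMul_germ (ε : E.X 0 ⟶ idealModule I) (U : X.Opens) (hU : x ∈ U)
    (z : symPart Γ(X, U) (fun m => Γ(E.X m, U)) k 0) :
    preStalkMul ε k x (symGerm E k 0 U hU z) =
      stkGerm (idealModule (I ^ k)) U x hU (mulSec ε k U z) :=
  TopCat.Presheaf.stalkFunctor_map_germ_apply U x hU
    ((PresheafOfModules.toPresheaf X.ringCatSheaf.obj).map (mulPresheaf ε k)) z

lemma stkIdealInclusion_preStalkMul (ε : E.X 0 ⟶ idealModule I) (U : X.Opens) (hU : x ∈ U)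
    (z : symPart Γ(X, U) (fun m => Γ(E.X m, U)) k 0) :
    stkIdealInclusion (I ^ k) x (preStalkMul ε k x (symGerm E k 0 U hU z)) =
      mulMap (E := fun m => Stk (E.X m) x) (stkEps ε x) k
        (symMap (fun m => stkGerm (E.X m) U x hU) k 0 z).1 := by
  rw [preStalkMul_germ]
  exact (stkIdealInclusion_germ U hU _).trans (mulMap_tpowMap_stkGerm ε U hU z.1).symm

/-- On an affine open set the ideal of `I ^ k` is the power of the ideal of `I`, and extension of
ideals commutes with powers. -/
lemma stkIdealInclusion_pow_mem (m : Stk (idealModule (I ^ k)) x) :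
    stkIdealInclusion (I ^ k) x m ∈
      (show Ideal (X.presheaf.stalk x) from LinearMap.range (stkIdealInclusion I x)) ^ k := by
  obtain ⟨_, ⟨V, hV, rfl⟩, hxV, -⟩ := X.isBasis_affineOpens.exists_subset_of_mem_open
      (show x ∈ ((⊤ : X.Opens) : Set X) from trivial) (⊤ : X.Opens).isOpen
  rw [range_stkIdealInclusion ⟨V, hV⟩ hxV, ← Ideal.map_pow]
  have h := LinearMap.mem_range_self (stkIdealInclusion (I ^ k) x) m
  rw [range_stkIdealInclusion ⟨V, hV⟩ hxV] at h
  exact h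

variable (ε : E ⟶ (ChainComplex.single₀ X.Modules).obj (idealModule I))

/-- The degree zero component of an augmentation. -/
abbrev augZero : E.X 0 ⟶ idealModule I := (ChainComplex.toSingle₀Equiv E (idealModule I) ε).1

/-- The multiplication map is a quasi-isomorphism as soon as it is one on the symmetric powers of
the stalks. -/
theorem quasiIso_symPowerMul_of_stk (k : ℕ)
    (h : ∀ x : X,
      (∀ n, Function.Exact (stkSymD E x k (n + 1)) (stkSymD E x k n)) ∧
      (∀ z : symPart (X.presheaf.stalk x) (fun m => Stk (E.X m) x) k 0,
        mulMap (E := fun m => Stk (E.X m) x) (stkEps (augZero ε) x) k z.1 = 0 →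
          ∃ w, stkSymD E x k 0 w = z) ∧
      (∀ f ∈ (show Ideal (X.presheaf.stalk x) from LinearMap.range (stkEps (augZero ε) x)) ^ k,
        ∃ z : symPart (X.presheaf.stalk x) (fun m => Stk (E.X m) x) k 0,
          mulMap (E := fun m => Stk (E.X m) x) (stkEps (augZero ε) x) k z.1 = f))
    (hr : ∀ x : X, LinearMap.range (stkEps (augZero ε) x) = LinearMap.range (stkIdealInclusion I x)) :
    QuasiIso (symPowerMul ε k) := by
  refine quasiIso_symPowerMul ε k fun x => ⟨fun n => preStalk_exact ((h x).1 n), ?_, ?_⟩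
  · intro y
    change preStalkMul (augZero ε) k x y = 0 ↔ _
    constructor
    · intro hy
      obtain ⟨U, hU, z, rfl⟩ := exists_symGerm y
      have h1 := congrArg (stkIdealInclusion (I ^ k) x) hy
      rw [stkIdealInclusion_preStalkMul, map_zero] at h1
      obtain ⟨w, hw⟩ := (h x).2.1 _ h1
      exact exists_symD_eq_of_stk hw
    · rintro ⟨y, rfl⟩
      have h1 := congrArg (preStalk x).map (symPresheafD_mulPresheaf (augZero ε)
        (ChainComplex.toSingle₀Equiv E (idealModule I) ε).2 k)
      rw [Functor.map_comp] at h1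
      refine (CategoryTheory.congr_fun h1 y).trans ?_
      exact CategoryTheory.congr_fun ((TopCat.Presheaf.stalkFunctor Ab.{u} x).map_zero _ _) y
  · intro m
    change ∃ y, preStalkMul (augZero ε) k x y = m
    have h1 := stkIdealInclusion_pow_mem (show Stk (idealModule (I ^ k)) x from m)
    rw [← hr] at h1
    obtain ⟨z, hz⟩ := (h x).2.2 _ h1
    obtain ⟨U, hU, z, rfl⟩ := exists_symPart_rep (E := E.X) z
    refine ⟨symGerm E k 0 U hU z, stkIdealInclusion_injective ?_⟩
    rw [stkIdealInclusion_preStalkMul, hz]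

variable {ε}

lemma stkD_exact (hε : QuasiIso ε) (x : X) (n : ℕ) :
    Function.Exact (stkD E x (n + 1)) (stkD E x n) :=
  (((quasiIso_iff_stalk E _ ε).mp hε) x).1 n

lemma stkEps_exact (hε : QuasiIso ε) (x : X) :
    Function.Exact (stkD E x 0) (stkEps (augZero ε) x) := by
  have h : Function.Exact (stkD E x 0) (stkMap (augZero ε) x) :=
    (((quasiIso_iff_stalk E _ ε).mp hε) x).2.1
  intro m
  rw [← h m]
  exact map_eq_zero_iff _ stkIdealInclusion_injective

lemma range_stkEps (hε : QuasiIso ε) (x : X) :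
    LinearMap.range (stkEps (augZero ε) x) = LinearMap.range (stkIdealInclusion I x) := by
  have h : Function.Surjective (stkMap (augZero ε) x) :=
    (((quasiIso_iff_stalk E _ ε).mp hε) x).2.2
  exact LinearMap.range_comp_of_range_eq_top _ (LinearMap.range_eq_top.mpr h)

end DerivedSymmetricPower
end

/-! ### Multiplicativity of the Koszul sign -/

section
open CategoryTheory AlgebraicGeometry TopologicalSpace Limits
namespace DerivedSymmetricPower

/-- A symmetric `f` gives a product over unordered pairs, and `σ` permutes these. The pair of
minimum and maximum is the ordered representative of an unordered pair. -/
lemma prod_lt_comp_perm {k : ℕ} {M : Type*} [CommMonoid M] (σ : Equiv.Perm (Fin k))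
    (f : Fin k → Fin k → M) (hf : ∀ i j, f i j = f j i) :
    ∏ i, ∏ j, (if i < j then f (σ i) (σ j) else 1) = ∏ i, ∏ j, if i < j then f i j else 1 := by
  rw [← Finset.prod_product', ← Finset.prod_product', ← Finset.prod_filter, ← Finset.prod_filter]
  have hmem : ∀ (τ : Equiv.Perm (Fin k)) (p : Fin k × Fin k), p.1 < p.2 →
      min (τ p.1) (τ p.2) < max (τ p.1) (τ p.2) := fun τ p hp =>
    min_lt_max.mpr (τ.injective.ne hp.ne)
  have hinv : ∀ (τ : Equiv.Perm (Fin k)) (p : Fin k × Fin k), p.1 < p.2 →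
      (min (τ.symm (min (τ p.1) (τ p.2))) (τ.symm (max (τ p.1) (τ p.2))),
        max (τ.symm (min (τ p.1) (τ p.2))) (τ.symm (max (τ p.1) (τ p.2)))) = p := by
    intro τ p hp
    rcases le_total (τ p.1) (τ p.2) with h | h <;> simp [h, hp.le]
  refine Finset.prod_bij' (fun p _ => (min (σ p.1) (σ p.2), max (σ p.1) (σ p.2)))
    (fun p _ => (min (σ.symm p.1) (σ.symm p.2), max (σ.symm p.1) (σ.symm p.2)))
    (fun p hp => ?_) (fun p hp => ?_) (fun p hp => ?_) (fun p hp => ?_) (fun p hp => ?_)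
  · simpa using hmem σ p (by simpa using hp)
  · simpa using hmem σ.symm p (by simpa using hp)
  · exact hinv σ p (by simpa using hp)
  · simpa using hinv σ.symm p (by simpa using hp)
  · rcases le_total (σ p.1) (σ p.2) with h | h
    · simp [h]
    · simp [h, hf (σ p.1)]

/-- A pair is reversed by `π * σ` exactly when it is reversed by `σ` or its image is reversed by
`π`, but not both. The symmetric function `f` records the inversions of `π` on unordered pairs, so
that they can be reindexed along `σ`. -/
lemma koszulSign_mul {k : ℕ} (π σ : Equiv.Perm (Fin k)) (p : Fin k → ZMod 2) :
    koszulSign (π * σ) p = koszulSign π (fun i => p (σ.symm i)) * koszulSign σ p := by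
  let f : Fin k → Fin k → ℤ := fun i j =>
    if (i < j ∧ π j < π i ∨ j < i ∧ π i < π j) ∧ p (σ.symm i) = 1 ∧ p (σ.symm j) = 1 then -1 else 1
  have hf : ∀ i j, f i j = f j i := by
    intro i j
    simp only [f]
    congr 1
    simp only [eq_iff_iff]
    tauto
  have h1 : koszulSign π (fun i => p (σ.symm i)) = ∏ i, ∏ j, if i < j then f i j else 1 := by
    refine Finset.prod_congr rfl fun i _ => Finset.prod_congr rfl fun j _ => ?_
    by_cases h : i < j
    · simp [f, h, h.not_gt]
    · simp [h]
  rw [h1, ← prod_lt_comp_perm σ f hf, koszulSign, koszulSign, ← Finset.prod_mul_distrib]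
  refine Finset.prod_congr rfl fun i _ => ?_
  rw [← Finset.prod_mul_distrib]
  refine Finset.prod_congr rfl fun j _ => ?_
  by_cases h : i < j
  · have h2 := σ.injective.ne h.ne
    have h3 := π.injective.ne h2
    simp only [f, h, true_and, if_true, Equiv.symm_apply_apply, Equiv.Perm.mul_apply]
    by_cases hi : p i = 1 <;> by_cases hj : p j = 1 <;> simp only [hi, hj, and_true, and_false, if_false, mul_one]
    rcases lt_or_gt_of_ne h2 with h4 | h4 <;> rcases lt_or_gt_of_ne h3 with h5 | h5 <;>
      simp [h4, h5, h4.not_gt, h5.not_gt]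
  · simp [h]

/-! ### Averaging over the symmetric group -/

section
variable {A : Type u} [CommRing A] {E : ℕ → Type u} [∀ n, AddCommGroup (E n)]
  [∀ n, Module A (E n)] {k : ℕ}

lemma permAct_mul (π σ : Equiv.Perm (Fin k)) (z : TPow A E k) :
    permAct A E (π * σ) z = permAct A E π (permAct A E σ z) := by
  suffices permAct A E (π * σ) = (permAct A E π).comp (permAct A E σ) from LinearMap.congr_fun this z
  refine tpow_hom_ext fun a x => ?_
  rw [LinearMap.comp_apply, permAct_homTensor, permAct_homTensor, map_smul, permAct_homTensor,
    smul_smul, koszulSign_mul, Int.cast_mul, mul_comm]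
  rfl

lemma permAct_mem_degPart {n : ℕ} (π : Equiv.Perm (Fin k)) {z : TPow A E k}
    (hz : z ∈ degPart A E k n) : permAct A E π z ∈ degPart A E k n := by
  revert z
  suffices degPart A E k n ≤ (degPart A E k n).comap (permAct A E π) from fun z hz => this hz
  refine Submodule.span_le.mpr ?_
  rintro _ ⟨a, x, ha, rfl⟩
  simp only [Submodule.comap_coe, Set.mem_preimage, SetLike.mem_coe, permAct_homTensor]
  refine Submodule.smul_mem _ _ (Submodule.subset_span ⟨_, _, ?_, rfl⟩)
  rw [← ha]
  exact Equiv.sum_comp π.symm a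

variable [Algebra ℚ A]

variable (A E k) in
/-- The average over the symmetric group. -/
def symmetrize : TPow A E k →ₗ[A] TPow A E k :=
  algebraMap ℚ A (1 / k.factorial) • ∑ π : Equiv.Perm (Fin k), permAct A E π

lemma symmetrize_apply (z : TPow A E k) :
    symmetrize A E k z = algebraMap ℚ A (1 / k.factorial) • ∑ π : Equiv.Perm (Fin k), permAct A E π z := by
  simp [symmetrize]

lemma permAct_symmetrize (π : Equiv.Perm (Fin k)) (z : TPow A E k) :
    permAct A E π (symmetrize A E k z) = symmetrize A E k z := by
  rw [symmetrize_apply, map_smul, map_sum]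
  congr 1
  simp only [← permAct_mul]
  exact Equiv.sum_comp (Equiv.mulLeft π) fun σ => permAct A E σ z

lemma symmetrize_permAct (π : Equiv.Perm (Fin k)) (z : TPow A E k) :
    symmetrize A E k (permAct A E π z) = symmetrize A E k z := by
  rw [symmetrize_apply, symmetrize_apply]
  congr 1
  simp only [← permAct_mul]
  exact Equiv.sum_comp (Equiv.mulRight π) fun σ => permAct A E σ z

lemma factorial_smul_card {M : Type*} [AddCommGroup M] [Module A M] (m : M) :
    algebraMap ℚ A (1 / k.factorial) • ∑ _π : Equiv.Perm (Fin k), m = m := by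
  rw [Finset.sum_const, Finset.card_univ, Fintype.card_perm, Fintype.card_fin, ← Nat.cast_smul_eq_nsmul A,
    smul_smul, ← map_natCast (algebraMap ℚ A), ← map_mul,
    one_div_mul_cancel (Nat.cast_ne_zero.mpr k.factorial_ne_zero), map_one, one_smul]

lemma symmetrize_eq_self {z : TPow A E k} (hz : ∀ π, permAct A E π z = z) :
    symmetrize A E k z = z := by
  rw [symmetrize_apply]
  simp only [hz]
  exact factorial_smul_card z

lemma symmetrize_mem {n : ℕ} {z : TPow A E k} (hz : z ∈ degPart A E k n) :
    symmetrize A E k z ∈ symPart A E k n := by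
  refine ⟨?_, fun π => permAct_symmetrize π z⟩
  rw [symmetrize_apply]
  exact Submodule.smul_mem _ _ (Submodule.sum_mem _ fun π _ => permAct_mem_degPart π hz)

lemma map_symmetrize {M : Type*} [AddCommGroup M] [Module A M] (f : TPow A E k →ₗ[A] M)
    {z : TPow A E k} (hz : ∀ π, f (permAct A E π z) = f z) : f (symmetrize A E k z) = f z := by
  rw [symmetrize_apply, map_smul, map_sum]
  simp only [hz]
  exact factorial_smul_card (f z)

lemma tensorD_symmetrize (d : ∀ n, E (n + 1) →ₗ[A] E n) (z : TPow A E k) :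
    tensorD d k (symmetrize A E k z) = symmetrize A E k (tensorD d k z) := by
  rw [symmetrize_apply, symmetrize_apply, map_smul, map_sum]
  simp only [permAct_tensorD]

end
end DerivedSymmetricPower
end

/-! ### Homotopies on tensor powers -/

section
open CategoryTheory AlgebraicGeometry TopologicalSpace Limits
namespace DerivedSymmetricPower
section
variable {A : Type u} [CommRing A] {E P : ℕ → Type u} [∀ n, AddCommGroup (E n)]
  [∀ n, Module A (E n)] [∀ n, AddCommGroup (P n)] [∀ n, Module A (P n)] {k : ℕ}

/-- A map of degree one as an endomorphism of the total module. -/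
def totH (h : ∀ n, E n →ₗ[A] E (n + 1)) : Tot E →ₗ[A] Tot E :=
  DirectSum.toModule A ℕ (Tot E) fun n => (DirectSum.lof A ℕ E (n + 1)).comp (h n)

lemma totH_lof (h : ∀ n, E n →ₗ[A] E (n + 1)) (n : ℕ) (x : E n) :
    totH h (DirectSum.lof A ℕ E n x) = DirectSum.lof A ℕ E (n + 1) (h n x) := by
  simp [totH]

/-- The homotopy on the tensor power induced by a homotopy `h` from the identity to `q`. -/
def tensorH (h : ∀ n, E n →ₗ[A] E (n + 1)) (q : ∀ n, E n →ₗ[A] E n) (k : ℕ) :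
    TPow A E k →ₗ[A] TPow A E k :=
  ∑ j : Fin k, PiTensorProduct.map fun i =>
    if i < j then signInv A E else if i = j then totH h else totMap q

/-- The tensor power of endomorphisms. -/
lemma tpowMap_eq_map (q : ∀ n, E n →ₗ[A] E n) :
    tpowMap q k = PiTensorProduct.map (R := A) fun _ : Fin k => totMap q :=
  tpow_hom_ext fun a x => by
    rw [tpowMap_homTensor, homTensor, homTensor, PiTensorProduct.map_tprod]
    simp only [totMap_lof]

lemma tensorH_mem_degPart (h : ∀ n, E n →ₗ[A] E (n + 1)) (q : ∀ n, E n →ₗ[A] E n) {n : ℕ}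
    {z : TPow A E k} (hz : z ∈ degPart A E k n) : tensorH h q k z ∈ degPart A E k (n + 1) := by
  revert z
  suffices degPart A E k n ≤ (degPart A E k (n + 1)).comap (tensorH h q k) from fun z hz => this hz
  refine Submodule.span_le.mpr ?_
  rintro _ ⟨a, x, ha, rfl⟩
  simp only [Submodule.comap_coe, Set.mem_preimage, SetLike.mem_coe, tensorH, LinearMap.sum_apply]
  refine Submodule.sum_mem _ fun j _ => ?_
  have h1 : PiTensorProduct.map (fun i =>
      if i < j then signInv A E else if i = j then totH h else totMap q) (homTensor A a x) =
      (∏ i, if i < j then (-1 : A) ^ a i else 1) •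
      PiTensorProduct.tprod A (Function.update (fun i => DirectSum.lof A ℕ E (a i)
        (if i < j then x i else q _ (x i))) j (DirectSum.lof A ℕ E (a j + 1) (h _ (x j)))) := by
    rw [homTensor, PiTensorProduct.map_tprod, ← MultilinearMap.map_smul_univ]
    congr 1
    ext1 i
    rcases lt_trichotomy i j with h | rfl | h
    · simp [h, h.ne, signInv_lof]
    · simp [totH_lof]
    · rw [if_neg h.not_gt, if_neg h.ne', if_neg h.not_gt, Function.update_of_ne h.ne',
        if_neg h.not_gt, one_smul]
      exact totMap_lof _ _ _
  rw [h1]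
  refine Submodule.smul_mem _ _ ?_
  obtain ⟨x', hx'⟩ := homTensor_update (A := A) a (fun i => if i < j then x i else q _ (x i)) j (a j + 1) (h _ (x j))
  rw [hx']
  refine Submodule.subset_span ⟨_, x', ?_, rfl⟩
  have h1 := Finset.sum_update_of_mem (Finset.mem_univ j) a (a j + 1)
  have h2 := Finset.add_sum_erase Finset.univ a (Finset.mem_univ j)
  rw [Finset.sdiff_singleton_eq_erase] at h1
  omega

/-- The homotopy formula `d h + h d = 1 - q` on the total module, with `q` a chain map. -/
lemma totD_totH (d : ∀ n, E (n + 1) →ₗ[A] E n) (h : ∀ n, E n →ₗ[A] E (n + 1))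
    (q : ∀ n, E n →ₗ[A] E n) (h0 : ∀ x, d 0 (h 0 x) = x - q 0 x)
    (hs : ∀ n x, d (n + 1) (h (n + 1) x) + h n (d n x) = x - q (n + 1) x) :
    totD d ∘ₗ totH h + totH h ∘ₗ totD d = LinearMap.id - totMap q := by
  refine DirectSum.linearMap_ext A fun n => LinearMap.ext fun x => ?_
  simp only [LinearMap.comp_apply, LinearMap.add_apply, LinearMap.sub_apply, LinearMap.id_apply,
    totH_lof, totD_lof_succ]
  cases n with
  | zero => rw [totD_lof_zero, map_zero, add_zero, h0, map_sub, totMap_lof]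
  | succ n => rw [totD_lof_succ, totH_lof, ← map_add, hs, map_sub, totMap_lof]

lemma signInv_totH (h : ∀ n, E n →ₗ[A] E (n + 1)) :
    signInv A E ∘ₗ totH h = (-1 : A) • (totH h ∘ₗ signInv A E) := by
  refine DirectSum.linearMap_ext A fun n => LinearMap.ext fun x => ?_
  simp [totH_lof, signInv_lof, pow_succ]

lemma signInv_comp_totMap (q : ∀ n, E n →ₗ[A] E n) :
    signInv A E ∘ₗ totMap q = totMap q ∘ₗ signInv A E := by
  refine DirectSum.linearMap_ext A fun n => LinearMap.ext fun x => ?_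
  simp only [LinearMap.comp_apply, totMap_lof, signInv_lof, map_smul]

lemma totD_comp_totMap (d : ∀ n, E (n + 1) →ₗ[A] E n) (q : ∀ n, E n →ₗ[A] E n)
    (hq : ∀ n x, d n (q (n + 1) x) = q n (d n x)) :
    totD d ∘ₗ totMap q = totMap q ∘ₗ totD d := by
  refine DirectSum.linearMap_ext A fun n => LinearMap.ext fun x => ?_
  simp only [LinearMap.comp_apply, totMap_lof]
  cases n with
  | zero => rw [totD_lof_zero, totD_lof_zero, map_zero]
  | succ n => rw [totD_lof_succ, totD_lof_succ, totMap_lof, hq]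

lemma signInv_signInv : signInv A E ∘ₗ signInv A E = LinearMap.id := by
  refine DirectSum.linearMap_ext A fun n => LinearMap.ext fun x => ?_
  simp [signInv_lof, smul_smul, ← mul_pow]

lemma map_add_map_eq_zero_of_coord {f g : Fin k → (Tot E →ₗ[A] Tot E)} (l : Fin k)
    (h : f l = (-1 : A) • g l) (h' : ∀ i, i ≠ l → f i = g i) :
    PiTensorProduct.map f + PiTensorProduct.map g = (0 : TPow A E k →ₗ[A] TPow A E k) := by
  have : f = Function.update g l ((-1 : A) • g l) := by
    ext1 i
    by_cases hi : i = l
    · subst hi; simp [h]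
    · simp [hi, h']
  rw [this, PiTensorProduct.map_update_smul, Function.update_eq_self]
  module

lemma map_add_of_coord {f g e : Fin k → (Tot E →ₗ[A] Tot E)} (l : Fin k) (h : f l + g l = e l)
    (hf : ∀ i, i ≠ l → f i = e i) (hg : ∀ i, i ≠ l → g i = e i) :
    PiTensorProduct.map f + PiTensorProduct.map g =
      (PiTensorProduct.map e : TPow A E k →ₗ[A] TPow A E k) := by
  have h1 : f = Function.update e l (f l) := by
    ext1 i
    by_cases hi : i = l
    · subst hi; simp
    · simp [hi, hf]
  have h2 : g = Function.update e l (g l) := by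
    ext1 i
    by_cases hi : i = l
    · subst hi; simp
    · simp [hi, hg]
  rw [h1, h2, ← PiTensorProduct.map_update_add, h, Function.update_eq_self]

lemma sum_telescope_fin {M : Type*} [AddCommGroup M] (k : ℕ) (T : ℕ → M) :
    ∑ j : Fin k, (T (j + 1) - T j) = T k - T 0 := by
  rw [Fin.sum_univ_eq_sum_range (fun j => T (j + 1) - T j) k, Finset.sum_range_sub]

/-- Expand both composites over pairs consisting of a place `j` for `h` and a place `l` for `d`. For
`l ≠ j` the two orders of composition cancel by the signs. For `l = j` the sum has the identity
before `j`, the factor `1 - q` at `j`, and `q` after it, so the sum over `j` telescopes from `q ⊗ ⋯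
⊗ q` to the identity. -/
lemma tensorD_tensorH (d : ∀ n, E (n + 1) →ₗ[A] E n) (h : ∀ n, E n →ₗ[A] E (n + 1))
    (q : ∀ n, E n →ₗ[A] E n) (hq : ∀ n x, d n (q (n + 1) x) = q n (d n x))
    (h0 : ∀ x, d 0 (h 0 x) = x - q 0 x)
    (hs : ∀ n x, d (n + 1) (h (n + 1) x) + h n (d n x) = x - q (n + 1) x) :
    tensorD d k ∘ₗ tensorH h q k + tensorH h q k ∘ₗ tensorD d k =
      LinearMap.id - tpowMap q k := by
  have e1 := totD_totH d h q h0 hs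
  have e2 := signInv_totH h
  have e3 := signInv_comp_totMap q
  have e4 := totD_comp_totMap d q hq
  have e5 := signInv_totD d
  have e6 : signInv A E ∘ₗ signInv A E = LinearMap.id := signInv_signInv
  -- The partial stages of the telescope: the identity on the first `m` factors and `q` on the
  -- others.
  let T : ℕ → (TPow A E k →ₗ[A] TPow A E k) := fun m =>
    PiTensorProduct.map fun i => if i.1 < m then LinearMap.id else totMap q
  have hT : ∀ j l : Fin k, PiTensorProduct.map (fun i =>
          if i < l then signInv A E else if i = l then totD d else LinearMap.id) ∘ₗ
        PiTensorProduct.map (fun i =>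
          if i < j then signInv A E else if i = j then totH h else totMap q) +
      PiTensorProduct.map (fun i =>
          if i < j then signInv A E else if i = j then totH h else totMap q) ∘ₗ
        PiTensorProduct.map (fun i =>
          if i < l then signInv A E else if i = l then totD d else LinearMap.id) =
      if l = j then T (j + 1) - T j else 0 := by
    intro j l
    rw [← PiTensorProduct.map_comp, ← PiTensorProduct.map_comp]
    split_ifs with hl
    · subst hl
      refine @eq_sub_of_add_eq (TPow A E k →ₗ[A] TPow A E k) _ _ _ _ ?_
      rw [map_add_of_coord (e := fun i => if i < l then LinearMap.id else if i = l then LinearMap.id - totMap q else totMap q) l]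
      · refine map_add_of_coord l ?_ ?_ ?_
        · simp
        · intro i hi
          rcases lt_or_gt_of_ne hi with h | h
          · simp [h, h.le]
          · simp [h.not_gt, hi, h.not_ge]
        · intro i hi
          rcases lt_or_gt_of_ne hi with h | h
          · simp [h, h.le]
          · simp [h.not_gt, h.not_ge]
      · simpa using e1
      · intro i hi
        rcases lt_or_gt_of_ne hi with h | h
        · simp [h, e6]
        · simp [h.not_gt, hi]
      · intro i hi
        rcases lt_or_gt_of_ne hi with h | h
        · simp [h, e6]
        · simp [h.not_gt, hi]
    -- The minus sign arises at the smaller of the two places, where a sign involution meets `d` or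
    -- `h`; at every other place the two factors commute.
    · rcases lt_or_gt_of_ne hl with h | h
      · refine map_add_map_eq_zero_of_coord l ?_ ?_
        · simp [h, e5, smul_smul]
        · intro i hi
          rcases lt_or_gt_of_ne hi with h' | h'
          · simp [h', h'.trans h]
          · simp only [h'.not_gt, hi, if_false]
            rfl
      · refine map_add_map_eq_zero_of_coord j ?_ ?_
        · simp [h, e2]
        · intro i hi
          rcases lt_or_gt_of_ne hi with h' | h'
          · simp [h', h'.trans h]
          · simp only [h'.not_gt, hi, if_false]
            split_ifs
            · exact e3
            · exact e4
            · rfl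
  have key : tensorD d k ∘ₗ tensorH h q k + tensorH h q k ∘ₗ tensorD d k =
      ∑ j : Fin k, (T (j + 1) - T j) := by
    have h1 : ∀ j : Fin k, T (j + 1) - T j = ∑ l, if l = j then T (j + 1) - T j else 0 := by
      intro j; simp
    rw [Finset.sum_congr rfl fun j _ => h1 j]
    simp only [← hT, tensorD, tensorH, Finset.sum_add_distrib]
    refine congrArg₂ (· + ·) (LinearMap.ext fun z => ?_) (LinearMap.ext fun z => ?_)
    · simp only [LinearMap.comp_apply, LinearMap.sum_apply, map_sum]
    · simp only [LinearMap.comp_apply, LinearMap.sum_apply, map_sum]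
      rw [Finset.sum_comm]
  rw [key, sum_telescope_fin k T]
  refine congrArg₂ (· - ·) ?_ ?_
  · refine Eq.trans ?_ PiTensorProduct.map_id
    simp only [T, Fin.is_lt, if_true]
  · rw [tpowMap_eq_map]
    simp [T]
end
end DerivedSymmetricPower
end

/-! ### Independence of the projective resolution -/

section
open CategoryTheory AlgebraicGeometry TopologicalSpace Limits
namespace DerivedSymmetricPower

/-- Recursion with choice. The predicate `Q` carries the property of the current term that makes the
next step possible; `R` relates consecutive terms. -/
lemma exists_seq {T : ℕ → Type*} (Q : ∀ n, T n → Prop) (R : ∀ n, T n → T (n + 1) → Prop)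
    (h0 : ∃ a, Q 0 a) (hs : ∀ n a, Q n a → ∃ b, Q (n + 1) b ∧ R n a b) :
    ∃ s : ∀ n, T n, ∀ n, Q n (s n) ∧ R n (s n) (s (n + 1)) := by
  choose f hf using hs
  let s : ∀ n, {a : T n // Q n a} := fun n => Nat.rec ⟨h0.choose, h0.choose_spec⟩
    (fun n a => ⟨f n a.1 a.2, (hf n a.1 a.2).1⟩) n
  exact ⟨fun n => (s n).1, fun n => ⟨(s n).2, (hf n (s n).1 (s n).2).2⟩⟩

section
variable {A : Type u} [CommRing A]

lemma exists_lift {Q M N : Type*} [AddCommGroup Q] [AddCommGroup M] [AddCommGroup N] [Module A Q]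
    [Module A M] [Module A N] [Module.Projective A Q] (d : M →ₗ[A] N) (φ : Q →ₗ[A] N)
    (h : ∀ x, ∃ y, d y = φ x) : ∃ ψ : Q →ₗ[A] M, ∀ x, d (ψ x) = φ x := by
  obtain ⟨ψ, hψ⟩ := Module.projective_lifting_property d.rangeRestrict
    (φ.codRestrict (LinearMap.range d) h) d.surjective_rangeRestrict
  exact ⟨ψ, fun x => congrArg Subtype.val (LinearMap.congr_fun hψ x)⟩

variable {E P : ℕ → Type u} [∀ n, AddCommGroup (E n)]
  [∀ n, Module A (E n)] [∀ n, AddCommGroup (P n)] [∀ n, Module A (P n)] {k : ℕ}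
  {d : ∀ n, E (n + 1) →ₗ[A] E n} {ε : E 0 →ₗ[A] A}
  {d' : ∀ n, P (n + 1) →ₗ[A] P n} {η : P 0 →ₗ[A] A}

/-- The comparison theorem for projective resolutions, lifting one degree at a time. -/
lemma exists_chainMap [∀ n, Module.Projective A (E n)]
    (hd : ∀ n, Function.Exact (d (n + 1)) (d n)) (hε : Function.Exact (d 0) ε)
    (hd' : ∀ n, Function.Exact (d' (n + 1)) (d' n)) (hη : Function.Exact (d' 0) η)
    (hr : LinearMap.range ε ≤ LinearMap.range η) :
    ∃ g : ∀ n, E n →ₗ[A] P n, (∀ x, η (g 0 x) = ε x) ∧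
      ∀ n x, d' n (g (n + 1) x) = g n (d n x) := by
  obtain ⟨g, hg⟩ := exists_seq (T := fun n => E n →ₗ[A] P n)
    -- In positive degree the property carried along is that `g ∘ d` lands in the cycles of `P`;
    -- exactness then makes them boundaries and the next lift exists.
    (fun n => match n with
      | 0 => fun g => ∀ x, η (g x) = ε x
      | n + 1 => fun g => ∀ x, d' n (g (d (n + 1) x)) = 0)
    (fun n g g' => ∀ x, d' n (g' x) = g (d n x))
    (exists_lift η ε fun x => hr (LinearMap.mem_range_self ε x))
    (fun n g hg => by
      obtain ⟨g', hg'⟩ := exists_lift (d' n) (g ∘ₗ d n) fun x => by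
        cases n with
        | zero => exact (hη _).mp ((hg _).trans (hε.apply_apply_eq_zero x))
        | succ n => exact (hd' n _).mp (hg x)
      refine ⟨g', fun x => ?_, hg'⟩
      rw [hg', LinearMap.comp_apply, (hd n).apply_apply_eq_zero, map_zero])
  exact ⟨g, (hg 0).1, fun n => (hg n).2⟩

/-- A chain endomorphism that induces zero on the augmentation is null-homotopic: `u - h d` takes
values in cycles, so it lifts through `d` by projectivity. -/
lemma exists_homotopy [∀ n, Module.Projective A (E n)]
    (hd : ∀ n, Function.Exact (d (n + 1)) (d n)) (hε : Function.Exact (d 0) ε)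
    (u : ∀ n, E n →ₗ[A] E n) (hu : ∀ n x, d n (u (n + 1) x) = u n (d n x))
    (h0 : ∀ x, ε (u 0 x) = 0) :
    ∃ h : ∀ n, E n →ₗ[A] E (n + 1), (∀ x, d 0 (h 0 x) = u 0 x) ∧
      ∀ n x, d (n + 1) (h (n + 1) x) + h n (d n x) = u (n + 1) x := by
  obtain ⟨h, hh⟩ := exists_seq (T := fun n => E n →ₗ[A] E (n + 1))
    (fun n => match n with
      | 0 => fun h => ∀ x, d 0 (h x) = u 0 x
      | n + 1 => fun h => ∀ x, d (n + 1) (h (d (n + 1) x)) = u (n + 1) (d (n + 1) x))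
    (fun n h h' => ∀ x, d (n + 1) (h' x) + h (d n x) = u (n + 1) x)
    (exists_lift (d 0) (u 0) fun x => (hε _).mp (h0 x))
    (fun n h hh => by
      have key : ∀ x, d n (h (d n x)) = u n (d n x) := by
        cases n with
        | zero => exact fun x => hh _
        | succ n => exact hh
      obtain ⟨h', hh'⟩ := exists_lift (d (n + 1)) (u (n + 1) - h ∘ₗ d n) fun x =>
        (hd n _).mp (by simp [key, hu])
      refine ⟨h', fun x => ?_, fun x => ?_⟩
      · rw [hh']
        simp [(hd n).apply_apply_eq_zero]
      · rw [hh']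
        simp)
  exact ⟨h, (hh 0).1, fun n => (hh n).2⟩

/-- The complex of symmetric powers of the complex is a resolution of its image under
multiplication. -/
structure SymExact (d : ∀ n, E (n + 1) →ₗ[A] E n) (ε : E 0 →ₗ[A] A) (k : ℕ) : Prop where
  exists_succ : ∀ n, ∀ z ∈ symPart A E k (n + 1), tensorD d k z = 0 →
    ∃ w ∈ symPart A E k (n + 2), tensorD d k w = z
  exists_zero : ∀ z ∈ symPart A E k 0, mulMap ε k z = 0 →
    ∃ w ∈ symPart A E k 1, tensorD d k w = z

lemma tensorD_eq_zero (d : ∀ n, E (n + 1) →ₗ[A] E n) {z : TPow A E k} (hz : z ∈ degPart A E k 0) :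
    tensorD d k z = 0 := by
  revert z
  suffices degPart A E k 0 ≤ LinearMap.ker (tensorD d k) from fun z hz => this hz
  refine Submodule.span_le.mpr ?_
  rintro _ ⟨a, x, ha, rfl⟩
  rw [SetLike.mem_coe, LinearMap.mem_ker, tensorD_homTensor]
  refine Finset.sum_eq_zero fun j _ => ?_
  have h0 : a j = 0 := (Finset.sum_eq_zero_iff.mp ha) j (Finset.mem_univ j)
  have h1 : ∀ (n : ℕ) (y : E n), n = 0 → totD d (DirectSum.lof A ℕ E n y) = 0 := by
    rintro _ y rfl
    exact totD_lof_zero d y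
  rw [h1 _ _ h0, MultilinearMap.map_coord_zero _ j (by simp), smul_zero]

/-- Exactness of symmetric powers can be checked on any projective resolution. -/
theorem SymExact.of_resolution [Algebra ℚ A] [∀ n, Module.Projective A (E n)]
    [∀ n, Module.Projective A (P n)]
    (hd : ∀ n, Function.Exact (d (n + 1)) (d n)) (hε : Function.Exact (d 0) ε)
    (hd' : ∀ n, Function.Exact (d' (n + 1)) (d' n)) (hη : Function.Exact (d' 0) η)
    (hr : LinearMap.range ε = LinearMap.range η) (hP : SymExact d' η k) : SymExact d ε k := by
  obtain ⟨g, hg0, hg⟩ := exists_chainMap hd hε hd' hη hr.le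
  obtain ⟨f, hf0, hf⟩ := exists_chainMap hd' hη hd hε hr.ge
  obtain ⟨h, hh0, hh⟩ := exists_homotopy hd hε (fun n => LinearMap.id - f n ∘ₗ g n)
    (fun n x => by simp [hf, hg]) (fun x => by simp [hf0, hg0])
  -- `tensorH` treats the factors before and after `j` differently, so it is not equivariant.
  -- Averaging repairs this, and the homotopy formula survives on invariant elements because the
  -- differential commutes with the average.
  let H : TPow A E k →ₗ[A] TPow A E k :=
    symmetrize A E k ∘ₗ tensorH h (fun n => f n ∘ₗ g n) k
  have hH : ∀ z : TPow A E k, (∀ π, permAct A E π z = z) →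
      z = tensorD d k (H z) + symmetrize A E k (tensorH h (fun n => f n ∘ₗ g n) k (tensorD d k z)) +
        tpowMap f k (tpowMap g k z) := by
    intro z hz
    have h1 := LinearMap.congr_fun (tensorD_tensorH (k := k) d h (fun n => f n ∘ₗ g n)
      (fun n x => by simp [hf, hg]) (fun x => by simp [hh0]) (fun n x => by simp [hh])) z
    simp only [LinearMap.add_apply, LinearMap.comp_apply, LinearMap.sub_apply, LinearMap.id_apply] at h1
    have h2 : tpowMap (fun n => f n ∘ₗ g n) k z = tpowMap f k (tpowMap g k z) :=
      tpowMap_eq_comp g f _ (fun _ => rfl) (fun _ _ => rfl) z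
    have h3 := congrArg (symmetrize A E k) h1
    rw [h2, map_add, ← tensorD_symmetrize, map_sub, symmetrize_eq_self hz,
      symmetrize_eq_self (z := tpowMap f k _)
        fun π => by rw [permAct_tpowMap, permAct_tpowMap, hz]] at h3
    exact (eq_sub_iff_add_eq.mp h3).symm
  have hg' : ∀ {n} {z : TPow A E k}, z ∈ symPart A E k n → tpowMap g k z ∈ symPart A P k n :=
    fun {n z} hz => (symMap g k n ⟨z, hz⟩).2
  have hf' : ∀ {n} {z : TPow A P k}, z ∈ symPart A P k n → tpowMap f k z ∈ symPart A E k n :=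
    fun {n z} hz => (symMap f k n ⟨z, hz⟩).2
  -- For a cycle `z` the homotopy formula reads `z = d (H z) + f (g z)`. A primitive of `g z` among
  -- the invariants for `P` therefore gives one of `z`.
  have key : ∀ {n} {z : TPow A E k}, z ∈ symPart A E k n → tensorD d k z = 0 →
      (∃ w ∈ symPart A P k (n + 1), tensorD d' k w = tpowMap g k z) →
      ∃ w ∈ symPart A E k (n + 1), tensorD d k w = z := by
    rintro n z hz hz0 ⟨w, hw, hwz⟩
    refine ⟨H z + tpowMap f k w,
      add_mem (symmetrize_mem (tensorH_mem_degPart _ _ hz.1)) (hf' hw), ?_⟩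
    rw [map_add, tensorD_tpowMap d' d f hf, hwz]
    have := hH z hz.2
    rw [hz0, map_zero, map_zero, add_zero] at this
    exact this.symm
  constructor
  · intro n z hz hz0
    refine key hz hz0 (hP.exists_succ n _ (hg' hz) ?_)
    rw [tensorD_tpowMap d d' g hg, hz0, map_zero]
  · intro z hz hz0
    refine key hz (tensorD_eq_zero d hz.1) (hP.exists_zero _ (hg' hz) ?_)
    rw [mulMap_tpowMap ε η g hg0, hz0, map_zero]

/-- In degree zero all Koszul signs are trivial, and the product in `A` is commutative. -/
lemma mulMap_permAct {z : TPow A E k} (hz : z ∈ degPart A E k 0) (π : Equiv.Perm (Fin k)) :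
    mulMap ε k (permAct A E π z) = mulMap ε k z := by
  revert z
  suffices degPart A E k 0 ≤ LinearMap.ker (mulMap ε k ∘ₗ permAct A E π - mulMap ε k) from
    fun z hz => sub_eq_zero.mp (this hz)
  refine Submodule.span_le.mpr ?_
  rintro _ ⟨a, x, ha, rfl⟩
  rw [SetLike.mem_coe, LinearMap.mem_ker, LinearMap.sub_apply, LinearMap.comp_apply, permAct_homTensor,
    sub_eq_zero]
  have h0 : ∀ j, a j = 0 := fun j => (Finset.sum_eq_zero_iff.mp ha) j (Finset.mem_univ j)
  have h1 : koszulSign π (fun i => (a i : ZMod 2)) = 1 := by simp [koszulSign, h0]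
  rw [h1, Int.cast_one, one_smul, homTensor, homTensor, mulMap, PiTensorProduct.lift.tprod,
      PiTensorProduct.lift.tprod, MultilinearMap.compLinearMap_apply,
      MultilinearMap.compLinearMap_apply, MultilinearMap.mkPiAlgebra_apply,
      MultilinearMap.mkPiAlgebra_apply]
  exact Equiv.prod_comp π.symm (fun i => DirectSum.toModule A ℕ A _ (DirectSum.lof A ℕ E (a i) (x i)))

/-- Every element of `I^k` is the product of an invariant tensor. -/
lemma exists_mulMap_eq [Algebra ℚ A] (ε : E 0 →ₗ[A] A) (k : ℕ) (f : A)
    (hf : f ∈ (show Ideal A from LinearMap.range ε) ^ k) :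
    ∃ z : symPart A E k 0, mulMap ε k z.1 = f := by
  have h1 : (show Ideal A from LinearMap.range ε) ^ k ≤
      ((degPart A E k 0).map (mulMap ε k) : Submodule A A) := by
    have h2 : (show Ideal A from LinearMap.range ε) ^ k =
        (Submodule.span A (Set.range ε) : Submodule A A) ^ k := by
      congr 1
      exact (Submodule.span_eq (LinearMap.range ε)).symm
    rw [h2, Submodule.span_pow, Submodule.span_le]
    intro f hf
    rw [Set.mem_pow] at hf
    obtain ⟨g, rfl⟩ := hf
    choose x hx using fun i => (g i).2
    refine ⟨homTensor A (fun _ => 0) x, Submodule.subset_span ⟨_, _, by simp, rfl⟩, ?_⟩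
    rw [homTensor, mulMap, PiTensorProduct.lift.tprod, MultilinearMap.compLinearMap_apply,
      MultilinearMap.mkPiAlgebra_apply, List.prod_ofFn]
    refine Finset.prod_congr rfl fun i _ => ?_
    rw [DirectSum.toModule_lof]
    exact hx i
  obtain ⟨z, hz, rfl⟩ := h1 hf
  -- Averaging does not change the product, so an arbitrary tensor of degree zero may be replaced by
  -- an invariant one.
  exact ⟨⟨symmetrize A E k z, symmetrize_mem hz⟩, map_symmetrize _ fun π => mulMap_permAct hz π⟩

end
end DerivedSymmetricPower
end

/-! ### Two term complexes and polynomials in their generators -/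

section
open CategoryTheory AlgebraicGeometry TopologicalSpace Limits
namespace DerivedSymmetricPower

/-- The Leibniz rule in the shape of the differential of a tensor power: one factor at a time is
replaced. -/
lemma derivation_prod {R S ι : Type*} [CommRing R] [CommRing S] [Algebra R S] [DecidableEq ι]
    (D : Derivation R S S) (s : Finset ι) (f : ι → S) :
    D (∏ i ∈ s, f i) = ∑ j ∈ s, ∏ i ∈ s, Function.update f j (D (f j)) i := by
  induction s using Finset.induction_on with
  | empty => simp
  | insert a s ha ih =>
    rw [Finset.prod_insert ha, D.leibniz, ih, Finset.sum_insert ha, add_comm, Finset.prod_insert ha,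
      Function.update_self, smul_eq_mul, smul_eq_mul, mul_comm, Finset.mul_sum]
    congr 1
    · congr 1
      refine Finset.prod_congr rfl fun i hi => ?_
      rw [Function.update_of_ne (ne_of_mem_of_not_mem hi ha)]
    · refine Finset.sum_congr rfl fun j hj => ?_
      rw [Finset.prod_insert ha, Function.update_of_ne (ne_of_mem_of_not_mem hj ha).symm]

/-- Equal multiplicities mean that corresponding fibres of `f` and `g` have the same cardinality.
Bijections between the fibres glue to a permutation. -/
lemma exists_perm_of_sum_single_eq {α β : Type*} [Fintype α] {f g : α → β}
    (h : ∑ i, Finsupp.single (f i) 1 = (∑ i, Finsupp.single (g i) 1 : β →₀ ℕ)) :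
    ∃ σ : Equiv.Perm α, ∀ i, g (σ i) = f i := by
  classical
  have hc : ∀ (f : α → β) (b : β), (∑ i, Finsupp.single (f i) 1 : β →₀ ℕ) b =
      Fintype.card {i // f i = b} := by
    intro f b
    rw [Finsupp.finsetSum_apply, Fintype.card_subtype, Finset.card_filter]
    exact Finset.sum_congr rfl fun i _ => Finsupp.single_apply
  have e : ∀ b, Nonempty ({i // f i = b} ≃ {i // g i = b}) := fun b =>
    ⟨Fintype.equivOfCardEq (by rw [← hc, ← hc, h])⟩
  exact ⟨Equiv.ofFiberEquiv fun b => (e b).some, Equiv.ofFiberEquiv_map _⟩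

lemma homogeneousSubmodule_eq_span_prod {R ι : Type*} [CommRing R] (j : ℕ) :
    MvPolynomial.homogeneousSubmodule ι R j =
      Submodule.span R (Set.range fun u : Fin j → ι => ∏ i, MvPolynomial.X (u i)) := by
  rw [← MvPolynomial.homogeneousSubmodule_one_pow, MvPolynomial.homogeneousSubmodule_one_eq_span_X,
    Submodule.span_pow]
  congr 1
  ext p
  rw [Set.mem_pow]
  constructor
  · rintro ⟨f, rfl⟩
    choose u hu using fun i => (f i).2
    exact ⟨u, by simp [List.prod_ofFn, hu]⟩
  · rintro ⟨u, rfl⟩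
    exact ⟨fun i => ⟨MvPolynomial.X (u i), u i, rfl⟩, by simp [List.prod_ofFn]⟩

section
variable {A : Type u} [CommRing A] {ι T : Type}

/-- The degree of a generator. -/
def letterDeg : ι ⊕ T → ℕ := Sum.elim (fun _ => 0) (fun _ => 1)

variable (A ι T) in
/-- The modules of a two term complex with generators `ι` in degree zero and `T` in degree one. -/
abbrev LMod (n : ℕ) : Type u := {b : ι ⊕ T // letterDeg b = n} →₀ A

/-- The generator of `LMod`. -/
def letter (b : ι ⊕ T) : LMod A ι T (letterDeg b) := Finsupp.single ⟨b, rfl⟩ 1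

/-- The differential of the two term complex given by linear forms `κ`. -/
def lD (κ : T → ι →₀ A) (n : ℕ) : LMod A ι T (n + 1) →ₗ[A] LMod A ι T n :=
  Finsupp.linearCombination A fun b => match b with
    | ⟨.inl _, _⟩ => 0
    | ⟨.inr t, h⟩ => (κ t).mapDomain fun i => ⟨.inl i, Nat.succ_injective h⟩

/-- The augmentation of the two term complex. -/
def lEps (x : ι → A) : LMod A ι T 0 →ₗ[A] A :=
  Finsupp.linearCombination A fun b => b.1.elim x 0

/-- The map from the two term complex to the polynomial ring on its generators. -/
def lPoly : Tot (LMod A ι T) →ₗ[A] MvPolynomial (ι ⊕ T) A :=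
  DirectSum.toModule A ℕ _ fun _ => Finsupp.linearCombination A fun b => MvPolynomial.X b.1

/-- The linear form with given coefficients. -/
def linForm : (ι →₀ A) →ₗ[A] MvPolynomial ι A := Finsupp.linearCombination A MvPolynomial.X

lemma rename_linForm {β : Type*} (f : ι → β) (v : ι →₀ A) :
    MvPolynomial.rename f (linForm v) =
      Finsupp.linearCombination A (fun i => (MvPolynomial.X (f i) : MvPolynomial β A)) v := by
  rw [linForm, Finsupp.linearCombination_apply, Finsupp.linearCombination_apply, Finsupp.sum,
    Finsupp.sum, map_sum]
  simp

/-- The Koszul derivation. -/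
def lDer (κ : T → ι →₀ A) : Derivation A (MvPolynomial (ι ⊕ T) A) (MvPolynomial (ι ⊕ T) A) :=
  MvPolynomial.mkDerivation A (Sum.elim 0 fun t => MvPolynomial.rename Sum.inl (linForm (κ t)))

lemma lPoly_lof (n : ℕ) (b : {b : ι ⊕ T // letterDeg b = n}) (a : A) :
    lPoly (DirectSum.lof A ℕ (LMod A ι T) n (Finsupp.single b a)) = a • MvPolynomial.X b.1 := by
  rw [lPoly, DirectSum.toModule_lof, Finsupp.linearCombination_single]

/-- Both sides kill the even generators and send the odd generator `t` to the linear form `κ t`. -/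
lemma lPoly_totD (κ : T → ι →₀ A) (y : Tot (LMod A ι T)) :
    lPoly (totD (lD κ) y) = lDer κ (lPoly y) := by
  suffices lPoly ∘ₗ totD (lD κ) = (lDer κ).toLinearMap ∘ₗ lPoly from LinearMap.congr_fun this y
  refine DirectSum.linearMap_ext A fun n => Finsupp.lhom_ext fun b a => ?_
  change lPoly (totD (lD κ) _) = lDer κ (lPoly _)
  rw [lPoly_lof, Derivation.map_smul, lDer, MvPolynomial.mkDerivation_X]
  obtain ⟨b | t, hb⟩ := b
  · cases n with
    | zero => rw [totD_lof_zero]; simp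
    | succ n => exact absurd hb (by simp [letterDeg])
  · cases n with
    | zero => exact absurd hb (by simp [letterDeg])
    | succ n =>
      rw [totD_lof_succ, lD, Finsupp.linearCombination_single, map_smul, map_smul, lPoly,
        DirectSum.toModule_lof, Finsupp.linearCombination_mapDomain, Sum.elim_inr,
        rename_linForm]
      rfl

lemma aeval_lPoly (x : ι → A) (y : Tot (LMod A ι T)) :
    MvPolynomial.aeval (Sum.elim x 0) (lPoly y) = DirectSum.toModule A ℕ A (fun n => match n with
      | 0 => lEps x
      | _ + 1 => 0) y := by
  suffices (MvPolynomial.aeval (Sum.elim x 0)).toLinearMap ∘ₗ lPoly =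
      DirectSum.toModule A ℕ A (fun n => match n with
      | 0 => (lEps x : LMod A ι T 0 →ₗ[A] A)
      | _ + 1 => 0) from LinearMap.congr_fun this y
  refine DirectSum.linearMap_ext A fun n => Finsupp.lhom_ext fun b a => ?_
  simp only [LinearMap.comp_apply, AlgHom.toLinearMap_apply]
  rw [lPoly_lof, map_smul, MvPolynomial.aeval_X, DirectSum.toModule_lof]
  obtain ⟨b | t, hb⟩ := b
  · obtain rfl : 0 = n := hb
    simp [lEps]
  · obtain rfl : 1 = n := hb
    simp

variable {k : ℕ}

variable (A ι T k) in
/-- The multiplication map from the tensor power of the two term complex to polynomials. -/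
def lMul : TPow A (LMod A ι T) k →ₗ[A] MvPolynomial (ι ⊕ T) A :=
  PiTensorProduct.lift ((MultilinearMap.mkPiAlgebra A (Fin k) (MvPolynomial (ι ⊕ T) A)).compLinearMap
    fun _ => lPoly)

lemma lMul_tprod (y : Fin k → Tot (LMod A ι T)) :
    lMul A ι T k (PiTensorProduct.tprod A y) = ∏ i, lPoly (y i) := by
  simp [lMul]

lemma mulMap_lEps (x : ι → A) (z : TPow A (LMod A ι T) k) :
    mulMap (lEps x) k z = MvPolynomial.aeval (Sum.elim x 0) (lMul A ι T k z) := by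
  induction z using PiTensorProduct.induction_on with
  | smul_tprod r t =>
    rw [map_smul, map_smul, map_smul, lMul_tprod, map_prod, mulMap, PiTensorProduct.lift.tprod,
      MultilinearMap.compLinearMap_apply, MultilinearMap.mkPiAlgebra_apply]
    exact congrArg _ (Finset.prod_congr rfl fun i _ => (aeval_lPoly x (t i)).symm)
  | add x y hx hy => rw [map_add, map_add, map_add, hx, hy]

/-- The tensor product of generators. -/
def word (w : Fin k → ι ⊕ T) : TPow A (LMod A ι T) k :=
  homTensor A (fun i => letterDeg (w i)) fun i => letter (w i)

lemma lMul_word (w : Fin k → ι ⊕ T) :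
    lMul A ι T k (word w) = ∏ i, MvPolynomial.X (w i) := by
  rw [word, homTensor, lMul_tprod]
  refine Finset.prod_congr rfl fun i _ => ?_
  rw [letter, lPoly_lof, one_smul]

/-- Modulo the span of the words, the tensor product of homogeneous elements is a multilinear map
that vanishes on tuples of basis vectors, hence vanishes identically. -/
lemma degPart_eq_span_word (n : ℕ) :
    degPart A (LMod A ι T) k n =
      Submodule.span A {z | ∃ w : Fin k → ι ⊕ T, ∑ i, letterDeg (w i) = n ∧ z = word w} := by
  apply le_antisymm
  · refine Submodule.span_le.mpr ?_
    rintro _ ⟨a, x, ha, rfl⟩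
    set N := Submodule.span A {z : TPow A (LMod A ι T) k |
      ∃ w : Fin k → ι ⊕ T, ∑ i, letterDeg (w i) = n ∧ z = word w}
    let f : MultilinearMap A (fun i => LMod A ι T (a i)) (TPow A (LMod A ι T) k ⧸ N) :=
      N.mkQ.compMultilinearMap ((PiTensorProduct.tprod A).compLinearMap
        fun i => DirectSum.lof A ℕ (LMod A ι T) (a i))
    have hf : f = 0 := by
      refine Module.Basis.ext_multilinear (fun i => Finsupp.basisSingleOne) fun b => ?_
      refine (Submodule.Quotient.mk_eq_zero _).mpr (Submodule.subset_span ⟨fun i => (b i).1, ?_, ?_⟩)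
      · simp only [(b _).2, ha]
      · rw [word, homTensor]
        refine congrArg (PiTensorProduct.tprod A) (funext fun i => ?_)
        have key : ∀ (m : ℕ) (c : {b : ι ⊕ T // letterDeg b = m}),
            DirectSum.lof A ℕ (LMod A ι T) m (Finsupp.single c 1) =
              DirectSum.lof A ℕ (LMod A ι T) (letterDeg c.1) (letter c.1) := by
          rintro _ ⟨c, rfl⟩
          rfl
        simpa using key (a i) (b i)
    exact (Submodule.Quotient.mk_eq_zero _).mp (MultilinearMap.congr_fun hf x)
  · refine Submodule.span_mono ?_
    rintro _ ⟨w, hw, rfl⟩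
    exact ⟨_, _, hw, rfl⟩

lemma permAct_word (π : Equiv.Perm (Fin k)) (w : Fin k → ι ⊕ T) :
    permAct A (LMod A ι T) π (word w) =
      (koszulSign π (fun i => (letterDeg (w i) : ZMod 2)) : A) • word (fun i => w (π.symm i)) :=
  permAct_homTensor _ _ _

lemma letterDeg_le (b : ι ⊕ T) : letterDeg b ≤ 1 := by
  cases b <;> simp [letterDeg]

/-- Only pairs of odd letters contribute signs, and in total degree at most one there is no such
pair. For this reason ordinary commuting variables suffice to describe degrees zero and one. -/
lemma koszulSign_of_sum_le_one (π : Equiv.Perm (Fin k)) (w : Fin k → ι ⊕ T)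
    (hw : ∑ i, letterDeg (w i) ≤ 1) : koszulSign π (fun i => (letterDeg (w i) : ZMod 2)) = 1 := by
  refine Finset.prod_eq_one fun i _ => Finset.prod_eq_one fun j _ => if_neg ?_
  rintro ⟨hij, -, hi, hj⟩
  have h1 : ∀ l, (letterDeg (w l) : ZMod 2) = 1 → 1 ≤ letterDeg (w l) := by
    intro l hl
    by_contra h
    rw [Nat.lt_one_iff.mp (not_le.mp h)] at hl
    simp at hl
  have h2 := Finset.add_le_sum (f := fun i => letterDeg (w i)) (s := Finset.univ) (fun _ _ => Nat.zero_le _)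
    (Finset.mem_univ i) (Finset.mem_univ j) hij.ne
  have := h1 i hi
  have := h1 j hj
  omega

end
end DerivedSymmetricPower
end

/-! ### Invariant tensors: polynomials in low degree, zero in high degree -/

section
open CategoryTheory AlgebraicGeometry TopologicalSpace Limits
namespace DerivedSymmetricPower
section
variable {A : Type u} [CommRing A] {ι T : Type} {k : ℕ}

lemma permAct_word_of_le_one (π : Equiv.Perm (Fin k)) (w : Fin k → ι ⊕ T)
    (hw : ∑ i, letterDeg (w i) ≤ 1) :
    permAct A (LMod A ι T) π (word w) = word (fun i => w (π.symm i)) := by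
  rw [permAct_word, koszulSign_of_sum_le_one π w hw, Int.cast_one, one_smul]

lemma lMul_permAct (π : Equiv.Perm (Fin k)) {n : ℕ} (hn : n ≤ 1) {z : TPow A (LMod A ι T) k}
    (hz : z ∈ degPart A (LMod A ι T) k n) :
    lMul A ι T k (permAct A (LMod A ι T) π z) = lMul A ι T k z := by
  rw [degPart_eq_span_word] at hz
  induction hz using Submodule.span_induction with
  | mem z hz =>
    obtain ⟨w, hw, rfl⟩ := hz
    rw [permAct_word_of_le_one π w (hw.trans_le hn), lMul_word, lMul_word]
    exact Equiv.prod_comp π.symm fun i => MvPolynomial.X (w i)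
  | zero => simp
  | add x y _ _ hx hy => rw [map_add, map_add, map_add, hx, hy]
  | smul a x _ hx => rw [map_smul, map_smul, map_smul, hx]

lemma lMul_word_eq_monomial (w : Fin k → ι ⊕ T) :
    lMul A ι T k (word w) = MvPolynomial.monomial (∑ i, Finsupp.single (w i) 1) 1 := by
  rw [lMul_word, MvPolynomial.monomial_sum_one]
  rfl

/-- Two words with the same monomial differ by a permutation of their places, which carries no sign
in degree at most one and disappears under averaging. -/
lemma symmetrize_word_eq [Algebra ℚ A] {w w' : Fin k → ι ⊕ T} (hw : ∑ i, letterDeg (w i) ≤ 1)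
    (h : ∑ i, Finsupp.single (w i) 1 = (∑ i, Finsupp.single (w' i) 1 : ι ⊕ T →₀ ℕ)) :
    symmetrize A (LMod A ι T) k (word w) = symmetrize A _ k (word w') := by
  obtain ⟨σ, hσ⟩ := exists_perm_of_sum_single_eq h
  rw [← symmetrize_permAct σ, permAct_word_of_le_one σ w hw]
  congr 2
  ext1 i
  rw [← hσ, Equiv.apply_symm_apply]

/-- In characteristic zero, symmetrization is determined by the multiplication map. -/
lemma exists_symmetrize_eq [Algebra ℚ A] :
    ∃ ψ : MvPolynomial (ι ⊕ T) A →ₗ[A] TPow A (LMod A ι T) k, ∀ n ≤ 1,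
      ∀ z ∈ degPart A (LMod A ι T) k n, ψ (lMul A ι T k z) = symmetrize A _ k z := by
  classical
  -- A monomial goes to the average of any word spelling it; `symmetrize_word_eq` makes the choice
  -- harmless. The value zero on the other monomials is never used.
  refine ⟨(MvPolynomial.basisMonomials (ι ⊕ T) A).constr A fun s =>
    if h : ∃ w : Fin k → ι ⊕ T, ∑ i, letterDeg (w i) ≤ 1 ∧ ∑ i, Finsupp.single (w i) 1 = s then
      symmetrize A _ k (word h.choose) else 0, fun n hn z hz => ?_⟩
  rw [degPart_eq_span_word] at hz
  induction hz using Submodule.span_induction with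
  | mem z hz =>
    obtain ⟨w, hw, rfl⟩ := hz
    have h : ∃ w' : Fin k → ι ⊕ T, ∑ i, letterDeg (w' i) ≤ 1 ∧
      ∑ i, Finsupp.single (w' i) 1 = (∑ i, Finsupp.single (w i) 1 : ι ⊕ T →₀ ℕ) :=
      ⟨w, hw.trans_le hn, rfl⟩
    rw [lMul_word_eq_monomial, ← congrFun (MvPolynomial.coe_basisMonomials (ι ⊕ T) A),
      Module.Basis.constr_basis, dif_pos h]
    exact symmetrize_word_eq h.choose_spec.1 h.choose_spec.2
  | zero => simp
  | add x y _ _ hx hy => rw [map_add, map_add, map_add, hx, hy]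
  | smul a x _ hx => rw [map_smul, map_smul, map_smul, hx]

/-- On invariants averaging is the identity, and in degree at most one it factors through `lMul`.
Hence `lMul` is injective there, and identities between invariants may be checked on polynomials. -/
lemma eq_zero_of_lMul_eq_zero [Algebra ℚ A] {n : ℕ} (hn : n ≤ 1) {z : TPow A (LMod A ι T) k}
    (hz : z ∈ symPart A (LMod A ι T) k n) (h : lMul A ι T k z = 0) : z = 0 := by
  obtain ⟨ψ, hψ⟩ := exists_symmetrize_eq (A := A) (ι := ι) (T := T) (k := k)
  rw [← symmetrize_eq_self hz.2, ← hψ n hn z hz.1, h, map_zero]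

/-- Since no odd place lies strictly between `i` and `j`, the pair `(i, j)` itself is the only pair
of odd places whose order the transposition reverses. -/
lemma koszulSign_swap (i j : Fin k) (hij : i < j) (p : Fin k → ZMod 2) (hi : p i = 1) (hj : p j = 1)
    (h : ∀ l, i < l → l < j → p l ≠ 1) : koszulSign (Equiv.swap i j) p = -1 := by
  rw [koszulSign, Finset.prod_eq_single i, Finset.prod_eq_single j]
  · simp [hij, hi, hj]
  · intro b _ hb
    refine if_neg ?_
    rintro ⟨h1, h2, -, h4⟩
    rw [Equiv.swap_apply_left, Equiv.swap_apply_of_ne_of_ne h1.ne' hb] at h2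
    exact h b h1 h2 h4
  · simp
  · intro a _ ha
    refine Finset.prod_eq_one fun b _ => if_neg ?_
    rintro ⟨h1, h2, h3, h4⟩
    by_cases haj : a = j
    · subst haj
      rw [Equiv.swap_apply_right, Equiv.swap_apply_of_ne_of_ne (hij.trans h1).ne' h1.ne'] at h2
      exact (h2.trans (hij.trans h1)).false
    · rw [Equiv.swap_apply_of_ne_of_ne ha haj] at h2
      by_cases hbi : b = i
      · subst hbi
        rw [Equiv.swap_apply_left] at h2
        exact (h2.trans (h1.trans hij)).false
      by_cases hbj : b = j
      · subst hbj
        rw [Equiv.swap_apply_right] at h2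
        exact h a h2 h1 h3
      · rw [Equiv.swap_apply_of_ne_of_ne hbi hbj] at h2
        exact (h1.trans h2).false
  · simp

lemma exists_adjacent (s : Finset (Fin k)) (hs : 2 ≤ s.card) :
    ∃ i ∈ s, ∃ j ∈ s, i < j ∧ ∀ l, i < l → l < j → l ∉ s := by
  obtain ⟨a, ha, b, hb, hab⟩ := Finset.one_lt_card.mp hs
  wlog hlt : a < b generalizing a b
  · exact this b hb a ha hab.symm (lt_of_le_of_ne (not_lt.mp hlt) hab.symm)
  have hne : (s.filter (a < ·)).Nonempty := ⟨b, by simp [hb, hlt]⟩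
  have hm := Finset.min'_mem _ hne
  rw [Finset.mem_filter] at hm
  refine ⟨a, ha, _, hm.1, hm.2, fun l h1 h2 h3 => ?_⟩
  exact absurd (Finset.min'_le _ l (by simp [h1, h3])) (not_le.mpr h2)

/-- A word of degree at least two contains the single odd generator twice. Exchanging two
consecutive occurrences fixes the word but has sign `-1`, so its average is its own negative, and
`2` is invertible. -/
lemma symPart_eq_zero [Algebra ℚ A] [Subsingleton T] {n : ℕ} (hn : 2 ≤ n) {z : TPow A (LMod A ι T) k}
    (hz : z ∈ symPart A (LMod A ι T) k n) : z = 0 := by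
  classical
  suffices ∀ z ∈ degPart A (LMod A ι T) k n, symmetrize A _ k z = 0 by
    rw [← symmetrize_eq_self hz.2, this z hz.1]
  intro z hz
  rw [degPart_eq_span_word] at hz
  induction hz using Submodule.span_induction with
  | mem z hz =>
    obtain ⟨w, hw, rfl⟩ := hz
    let s : Finset (Fin k) := Finset.univ.filter fun i => (w i).isRight
    have hs : ∀ i, letterDeg (w i) = if i ∈ s then 1 else 0 := by
      intro i
      cases h : w i <;> simp [s, h, letterDeg]
    obtain ⟨i, hi, j, hj, hij, hl⟩ := exists_adjacent s (by
      rw [← hw, Finset.sum_congr rfl fun i _ => hs i, Finset.sum_ite_mem] at hn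
      simpa using hn)
    have h1 := koszulSign_swap i j hij (fun i => (letterDeg (w i) : ZMod 2)) (by simp [hs, hi])
      (by simp [hs, hj]) (fun l h h' => by simp [hs, hl l h h'])
    have h2 : (fun l => w ((Equiv.swap i j).symm l)) = w := by
      have hwij : w i = w j := by
        have hi' : (w i).isRight := (Finset.mem_filter.mp hi).2
        have hj' : (w j).isRight := (Finset.mem_filter.mp hj).2
        obtain ⟨a, ha⟩ := Sum.isRight_iff.mp hi'
        obtain ⟨b, hb⟩ := Sum.isRight_iff.mp hj'
        rw [ha, hb, Subsingleton.elim a b]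
      ext1 l
      rw [Equiv.symm_swap]
      by_cases hli : l = i
      · rw [hli, Equiv.swap_apply_left, hwij]
      by_cases hlj : l = j
      · rw [hlj, Equiv.swap_apply_right, hwij]
      · rw [Equiv.swap_apply_of_ne_of_ne hli hlj]
    have h3 := symmetrize_permAct (Equiv.swap i j) (word (A := A) w)
    rw [permAct_word, h1, h2, map_smul, Int.cast_neg, Int.cast_one] at h3
    have h4 : (2 : A) • symmetrize A _ k (word (A := A) w) = 0 := by
      rw [two_smul]
      nth_rw 1 [← h3]
      module
    have h5 : IsUnit (2 : A) := by
      have := (IsUnit.mk0 (2 : ℚ) two_ne_zero).map (algebraMap ℚ A)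
      rwa [map_ofNat] at this
    exact h5.smul_eq_zero.mp h4
  | zero => simp
  | add x y _ _ hx hy => rw [map_add, hx, hy, add_zero]
  | smul a x _ hx => rw [map_smul, hx, smul_zero]

end
end DerivedSymmetricPower
end

/-! ### Symmetric powers of a two term complex with at most one odd generator -/

section
open CategoryTheory AlgebraicGeometry TopologicalSpace Limits
namespace DerivedSymmetricPower
section
variable {A : Type u} [CommRing A] {ι T : Type} {k : ℕ}

/-- The symmetric powers of the two term complex of linear forms `κ` resolve the powers of the
ideal generated by `x`. -/
structure SymKoszul (κ : T → ι →₀ A) (x : ι → A) : Prop where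
  aeval_eq_zero : ∀ t, MvPolynomial.aeval x (linForm (κ t)) = 0
  -- The alternative `p = 0` is for an empty `T`, where evaluation itself must be injective on
  -- homogeneous polynomials of positive degree.
  exists_mul : ∀ j (p : MvPolynomial ι A), p.IsHomogeneous (j + 1) → MvPolynomial.aeval x p = 0 →
    p = 0 ∨ ∃ t, ∃ q : MvPolynomial ι A, q.IsHomogeneous j ∧ p = linForm (κ t) * q
  eq_zero : ∀ t j (q : MvPolynomial ι A), q.IsHomogeneous j → linForm (κ t) * q = 0 → q = 0

/-- In total degree one the factors standing before the odd one are even. No sign survives and the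
differential of the tensor power turns into the Leibniz rule for `lDer`. -/
lemma lMul_tensorD (κ : T → ι →₀ A) {z : TPow A (LMod A ι T) k}
    (hz : z ∈ degPart A (LMod A ι T) k 1) :
    lMul A ι T k (tensorD (lD κ) k z) = lDer κ (lMul A ι T k z) := by
  classical
  revert z
  suffices degPart A (LMod A ι T) k 1 ≤ LinearMap.ker (lMul A ι T k ∘ₗ tensorD (lD κ) k -
      (lDer κ).toLinearMap ∘ₗ lMul A ι T k) from fun z hz => sub_eq_zero.mp (this hz)
  refine Submodule.span_le.mpr ?_
  rintro _ ⟨a, x, ha, rfl⟩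
  rw [SetLike.mem_coe, LinearMap.mem_ker, LinearMap.sub_apply, sub_eq_zero]
  change lMul A ι T k (tensorD (lD κ) k _) = lDer κ (lMul A ι T k _)
  rw [tensorD_homTensor, map_sum, homTensor, lMul_tprod, derivation_prod]
  refine Finset.sum_congr rfl fun j _ => ?_
  have key : ∏ i, lPoly (Function.update (fun i => DirectSum.lof A ℕ (LMod A ι T) (a i) (x i)) j
        (totD (lD κ) (DirectSum.lof A ℕ (LMod A ι T) (a j) (x j))) i) =
      ∏ i, Function.update (fun i => lPoly (DirectSum.lof A ℕ (LMod A ι T) (a i) (x i))) j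
        (lDer κ (lPoly (DirectSum.lof A ℕ (LMod A ι T) (a j) (x j)))) i := by
    refine Finset.prod_congr rfl fun i _ => ?_
    rw [← lPoly_totD]
    exact Function.apply_update (fun _ => lPoly) _ j _ i
  rw [map_smul, lMul_tprod, key]
  -- If the factor at `j` is even then `d` kills it and both terms vanish. Otherwise it carries the
  -- whole degree, and the sign in front of it is `1`.
  by_cases hj : a j = 0
  · have h1 : ∀ (n : ℕ) (y : LMod A ι T n), n = 0 →
        totD (lD κ) (DirectSum.lof A ℕ (LMod A ι T) n y) = 0 := by
      rintro _ y rfl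
      exact totD_lof_zero (lD κ) y
    have h2 := Finset.prod_eq_zero (Finset.mem_univ j) (Function.update_self j
      (0 : MvPolynomial (ι ⊕ T) A) fun i => lPoly (DirectSum.lof A ℕ (LMod A ι T) (a i) (x i)))
    rw [← lPoly_totD, h1 _ _ hj, map_zero, h2, smul_zero]
  · have h1 : ∀ i ≠ j, a i = 0 := by
      intro i hi
      have := Finset.add_le_sum (f := a) (s := Finset.univ) (fun _ _ => Nat.zero_le _)
        (Finset.mem_univ i) (Finset.mem_univ j) hi
      omega
    rw [Finset.prod_eq_one, one_smul]
    intro i _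
    split_ifs with h
    · rw [h1 i h.ne, pow_zero]
    · rfl

lemma map_lMul_degPart_zero : (degPart A (LMod A ι T) k 0).map (lMul A ι T k) =
    (MvPolynomial.homogeneousSubmodule ι A k).map
      (MvPolynomial.rename (R := A) (Sum.inl : ι → ι ⊕ T)).toLinearMap := by
  rw [degPart_eq_span_word, homogeneousSubmodule_eq_span_prod, Submodule.map_span,
    Submodule.map_span]
  congr 1
  ext p
  constructor
  · rintro ⟨_, ⟨w, hw, rfl⟩, rfl⟩
    have h : ∀ i, ∃ u, w i = Sum.inl u := by
      intro i
      have hi := (Finset.sum_eq_zero_iff.mp hw) i (Finset.mem_univ i)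
      cases h : w i with
      | inl u => exact ⟨u, rfl⟩
      | inr t => simp [h, letterDeg] at hi
    choose u hu using h
    refine ⟨_, ⟨u, rfl⟩, ?_⟩
    simp [lMul_word, hu]
  · rintro ⟨_, ⟨u, rfl⟩, rfl⟩
    refine ⟨_, ⟨fun i => Sum.inl (u i), by simp [letterDeg], rfl⟩, ?_⟩
    simp [lMul_word]

/-- A word of degree one has exactly one odd letter, and there is at most one candidate for it. The
first alternative is used when `T` is empty or `k = 0`, where there are no such words. -/
lemma lMul_degPart_one {z : TPow A (LMod A ι T) k} [Subsingleton T]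
    (hz : z ∈ degPart A (LMod A ι T) k 1) :
    lMul A ι T k z = 0 ∨ ∃ j, k = j + 1 ∧ ∃ t, ∃ q : MvPolynomial ι A, q.IsHomogeneous j ∧
      lMul A ι T k z = MvPolynomial.X (Sum.inr t) * MvPolynomial.rename Sum.inl q := by
  rcases isEmpty_or_nonempty T with hT | ⟨⟨t⟩⟩
  · left
    rw [degPart_eq_span_word] at hz
    suffices z ∈ (⊥ : Submodule A (TPow A (LMod A ι T) k)) by
      rw [(Submodule.mem_bot A).mp this, map_zero]
    refine Submodule.span_le.mpr ?_ hz
    rintro _ ⟨w, hw, rfl⟩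
    rw [Finset.sum_eq_zero] at hw
    · simp at hw
    · intro i _
      rcases w i with u | t
      · rfl
      · exact hT.elim t
  obtain - | j := k
  · left
    rw [degPart_eq_span_word] at hz
    suffices z ∈ (⊥ : Submodule A (TPow A (LMod A ι T) 0)) by
      rw [(Submodule.mem_bot A).mp this, map_zero]
    refine Submodule.span_le.mpr ?_ hz
    rintro _ ⟨w, hw, rfl⟩
    simp at hw
  right
  refine ⟨j, rfl, t, ?_⟩
  suffices (degPart A (LMod A ι T) (j + 1) 1).map (lMul A ι T (j + 1)) ≤
      (MvPolynomial.homogeneousSubmodule ι A j).map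
        (LinearMap.mulLeft A (MvPolynomial.X (Sum.inr t)) ∘ₗ
        (MvPolynomial.rename (R := A) (Sum.inl : ι → ι ⊕ T)).toLinearMap) by
    obtain ⟨q, hq, h⟩ := this (Submodule.mem_map_of_mem hz)
    exact ⟨q, hq, h.symm⟩
  rw [degPart_eq_span_word, homogeneousSubmodule_eq_span_prod, Submodule.map_span,
    Submodule.map_span]
  refine Submodule.span_mono ?_
  rintro _ ⟨_, ⟨w, hw, rfl⟩, rfl⟩
  obtain ⟨i, hi⟩ : ∃ i, letterDeg (w i) ≠ 0 := by
    by_contra! h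
    simp [h] at hw
  have hit : w i = Sum.inr t := by
    cases h : w i with
    | inl u => simp [h, letterDeg] at hi
    | inr s => rw [Subsingleton.elim s t]
  rw [Fin.sum_univ_succAbove _ i, hit] at hw
  have h : ∀ l, ∃ u, w (i.succAbove l) = Sum.inl u := by
    intro l
    have hl := (Finset.sum_eq_zero_iff.mp (by simpa [letterDeg] using hw :
      ∑ l, letterDeg (w (i.succAbove l)) = 0)) l (Finset.mem_univ l)
    cases h : w (i.succAbove l) with
    | inl u => exact ⟨u, rfl⟩
    | inr t => simp [h, letterDeg] at hl
  choose u hu using h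
  refine ⟨_, ⟨u, rfl⟩, ?_⟩
  rw [lMul_word, Fin.prod_univ_succAbove _ i, hit]
  simp [hu]

lemma exists_lMul_eq {j : ℕ} (t : T) (q : MvPolynomial ι A) (hq : q.IsHomogeneous j) :
    ∃ z ∈ degPart A (LMod A ι T) (j + 1) 1,
      lMul A ι T (j + 1) z = MvPolynomial.X (Sum.inr t) * MvPolynomial.rename Sum.inl q := by
  suffices (MvPolynomial.homogeneousSubmodule ι A j).map
        (LinearMap.mulLeft A (MvPolynomial.X (Sum.inr t)) ∘ₗ
        (MvPolynomial.rename (R := A) (Sum.inl : ι → ι ⊕ T)).toLinearMap) ≤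
      (degPart A (LMod A ι T) (j + 1) 1).map (lMul A ι T (j + 1)) by
    exact this (Submodule.mem_map_of_mem hq)
  rw [degPart_eq_span_word, homogeneousSubmodule_eq_span_prod, Submodule.map_span,
    Submodule.map_span]
  refine Submodule.span_mono ?_
  rintro _ ⟨_, ⟨u, rfl⟩, rfl⟩
  refine ⟨_, ⟨Fin.cons (Sum.inr t) fun i => Sum.inl (u i), ?_, rfl⟩, ?_⟩
  · simp [Fin.sum_univ_succ, letterDeg]
  · simp [lMul_word, Fin.prod_univ_succ]

lemma lDer_rename (κ : T → ι →₀ A) (p : MvPolynomial ι A) :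
    lDer κ (MvPolynomial.rename Sum.inl p) = 0 := by
  induction p using MvPolynomial.induction_on with
  | C a => simp [lDer]
  | add p q hp hq => rw [map_add, map_add, hp, hq, add_zero]
  | mul_X p i hp => rw [map_mul, Derivation.leibniz, hp, MvPolynomial.rename_X, lDer,
      MvPolynomial.mkDerivation_X]; simp

/-- In polynomial terms the differential from degree one to degree zero is multiplication by the
linear form of `t`. -/
lemma lDer_X_mul (κ : T → ι →₀ A) (t : T) (q : MvPolynomial ι A) :
    lDer κ (MvPolynomial.X (Sum.inr t) * MvPolynomial.rename Sum.inl q) =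
      MvPolynomial.rename Sum.inl (linForm (κ t) * q) := by
  rw [Derivation.leibniz, lDer_rename, lDer, MvPolynomial.mkDerivation_X, map_mul]
  simp [mul_comm]

variable {κ : T → ι →₀ A} {x : ι → A}

lemma aeval_rename_inl (p : MvPolynomial ι A) :
    MvPolynomial.aeval (Sum.elim x (0 : T → A)) (MvPolynomial.rename Sum.inl p) =
      MvPolynomial.aeval x p := by
  rw [MvPolynomial.aeval_rename, Sum.elim_comp_inl]

/-- Through `lMul`, degree zero becomes the homogeneous polynomials of degree `k`, degree one those
of degree `k - 1` times the odd variable, and the augmentation becomes evaluation at `x`. The fields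
of `SymKoszul` then state exactness in degrees zero and one; in degree two and above the invariants
vanish. -/
theorem SymKoszul.symExact [Algebra ℚ A] [Subsingleton T] (h : SymKoszul κ x) (k : ℕ) :
    SymExact (lD κ) (lEps x) k where
  exists_succ n z hz hz0 := by
    refine ⟨0, zero_mem _, ?_⟩
    rw [map_zero, eq_comm]
    obtain - | n := n
    · refine eq_zero_of_lMul_eq_zero le_rfl hz ?_
      obtain h0 | ⟨j, rfl, t, q, hq, h0⟩ := lMul_degPart_one hz.1
      · exact h0
      · have h1 := lMul_tensorD κ hz.1
        rw [hz0, map_zero, h0, lDer_X_mul, eq_comm, map_eq_zero_iff _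
          (MvPolynomial.rename_injective _ Sum.inl_injective)] at h1
        rw [h0, h.eq_zero t j q hq h1, map_zero, mul_zero]
    · exact symPart_eq_zero (by omega) hz
  exists_zero z hz hz0 := by
    obtain ⟨p, hp, hpz⟩ : lMul A ι T k z ∈ _ :=
      map_lMul_degPart_zero.le (Submodule.mem_map_of_mem hz.1)
    change MvPolynomial.rename Sum.inl p = _ at hpz
    rw [mulMap_lEps, ← hpz, aeval_rename_inl] at hz0
    have h0 : p = 0 → ∃ w ∈ symPart A (LMod A ι T) k 1, tensorD (lD κ) k w = z := by
      rintro rfl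
      refine ⟨0, zero_mem _, ?_⟩
      rw [map_zero, eq_comm]
      exact eq_zero_of_lMul_eq_zero zero_le_one hz (by rw [← hpz, map_zero])
    -- For `k = 0` the polynomial is a constant and equals its own value, which is zero.
    obtain - | j := k
    · rw [SetLike.mem_coe, MvPolynomial.mem_homogeneousSubmodule,
        ← MvPolynomial.totalDegree_zero_iff_isHomogeneous,
        MvPolynomial.totalDegree_eq_zero_iff_eq_C] at hp
      refine h0 ?_
      rw [hp, MvPolynomial.aeval_C] at hz0
      rw [hp, show MvPolynomial.coeff 0 p = 0 from hz0, MvPolynomial.C_0]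
    obtain h1 | ⟨t, q, hq, rfl⟩ := h.exists_mul j p hp hz0
    · exact h0 h1
    obtain ⟨w, hw, hwq⟩ := exists_lMul_eq t q hq
    have hw' := symmetrize_mem hw
    refine ⟨_, hw', sub_eq_zero.mp ?_⟩
    -- The primitive is the average of a tensor representing `q`. Both sides are invariant of degree
    -- zero, so comparing the associated polynomials is enough.
    refine eq_zero_of_lMul_eq_zero zero_le_one (sub_mem ?_ hz) ?_
    · rw [tensorD_symmetrize]
      exact symmetrize_mem (tensorD_mem_degPart _ hw)
    · rw [map_sub, lMul_tensorD κ hw'.1, map_symmetrize _ fun π => lMul_permAct π le_rfl hw, hwq,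
        lDer_X_mul, hpz, sub_self]

lemma lPoly_lof_injective (n : ℕ) :
    Function.Injective (lPoly ∘ₗ DirectSum.lof A ℕ (LMod A ι T) n) := by
  have h : (lPoly ∘ₗ DirectSum.lof A ℕ (LMod A ι T) n) = Finsupp.linearCombination A
      ((MvPolynomial.X : ι ⊕ T → MvPolynomial (ι ⊕ T) A) ∘ Subtype.val) :=
    Finsupp.lhom_ext fun b a => by
      rw [LinearMap.comp_apply, lPoly_lof, Finsupp.linearCombination_single]; rfl
  rw [h]
  exact (MvPolynomial.linearIndependent_X (R := A) (σ := ι ⊕ T)).comp _ Subtype.val_injective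

instance (n : ℕ) : IsEmpty {b : ι ⊕ T // letterDeg b = n + 2} :=
  ⟨fun b => by have := letterDeg_le b.1; omega⟩

lemma lPoly_lof_one [Subsingleton T] (v : LMod A ι T 1) (t : T) :
    ∃ c : A, lPoly (DirectSum.lof A ℕ (LMod A ι T) 1 v) =
      MvPolynomial.X (Sum.inr t) * MvPolynomial.rename Sum.inl (MvPolynomial.C c) := by
  refine ⟨v ⟨.inr t, rfl⟩, ?_⟩
  have : v = Finsupp.single ⟨.inr t, rfl⟩ (v ⟨.inr t, rfl⟩) := by
    ext ⟨b | s, hb⟩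
    · simp [letterDeg] at hb
    · obtain rfl := Subsingleton.elim s t
      simp
  conv_lhs => rw [this]
  rw [lPoly_lof, MvPolynomial.rename_C, mul_comm, MvPolynomial.smul_eq_C_mul]

lemma exists_lPoly_lof_zero (v : LMod A ι T 0) :
    ∃ p : MvPolynomial ι A, p.IsHomogeneous 1 ∧ MvPolynomial.aeval x p = lEps x v ∧
      lPoly (DirectSum.lof A ℕ (LMod A ι T) 0 v) = MvPolynomial.rename Sum.inl p := by
  induction v using Finsupp.induction_linear with
  | zero => exact ⟨0, MvPolynomial.isHomogeneous_zero _ _ _, by simp, by simp⟩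
  | add v w hv hw =>
    obtain ⟨p, h1, h2, h3⟩ := hv
    obtain ⟨q, h1', h2', h3'⟩ := hw
    exact ⟨p + q, h1.add h1', by rw [map_add, map_add, h2, h2'], by simp only [map_add, h3, h3']⟩
  | single b a =>
    obtain ⟨b | t, hb⟩ := b
    · refine ⟨MvPolynomial.C a * MvPolynomial.X b, MvPolynomial.isHomogeneous_C_mul_X a b, ?_, ?_⟩
      · simp [lEps]
      · rw [lPoly_lof]; simp [MvPolynomial.smul_eq_C_mul]
    · simp [letterDeg] at hb

/-- The two term complex is its own first symmetric power: its exactness, here and in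
`SymKoszul.exact_lEps`, is the case `j = 0` of the hypotheses on polynomials. -/
lemma SymKoszul.exact_lD [Subsingleton T] (h : SymKoszul κ x) (n : ℕ) :
    Function.Exact (lD κ (n + 1)) (lD κ n) := by
  refine fun v => ⟨fun hv => ⟨0, ?_⟩, ?_⟩
  · rw [map_zero]
    obtain - | n := n
    · rcases isEmpty_or_nonempty T with hT | ⟨⟨t⟩⟩
      · ext ⟨b | t, hb⟩
        · simp [letterDeg] at hb
        · exact hT.elim t
      obtain ⟨c, hc⟩ := lPoly_lof_one v t
      have h1 := lPoly_totD κ (DirectSum.lof A ℕ (LMod A ι T) 1 v)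
      rw [totD_lof_succ, hv, map_zero, map_zero, hc, lDer_X_mul, eq_comm, map_eq_zero_iff _
          (MvPolynomial.rename_injective _ Sum.inl_injective)] at h1
      have h2 := h.eq_zero t 0 _ (MvPolynomial.isHomogeneous_C _ c) h1
      refine lPoly_lof_injective 1 ?_
      rw [map_zero, LinearMap.comp_apply, hc, h2, map_zero, mul_zero]
    · exact Subsingleton.elim _ _
  · rintro ⟨w, rfl⟩
    rw [Subsingleton.elim w 0, map_zero, map_zero]

lemma SymKoszul.exact_lEps [Subsingleton T] (h : SymKoszul κ x) :
    Function.Exact (lD κ 0) (lEps x) := by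
  refine fun v => ⟨fun hv => ?_, ?_⟩
  · obtain ⟨p, hp, hpx, hpv⟩ := exists_lPoly_lof_zero (x := x) v
    obtain rfl | ⟨t, q, hq, rfl⟩ := h.exists_mul 0 p hp (hpx.trans hv)
    · refine ⟨0, lPoly_lof_injective 0 ?_⟩
      rw [LinearMap.comp_apply, LinearMap.comp_apply, hpv]
      simp
    · rw [← MvPolynomial.totalDegree_zero_iff_isHomogeneous,
        MvPolynomial.totalDegree_eq_zero_iff_eq_C] at hq
      refine ⟨Finsupp.single ⟨.inr t, rfl⟩ (q.coeff 0), lPoly_lof_injective 0 ?_⟩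
      rw [LinearMap.comp_apply, LinearMap.comp_apply, hpv, ← lDer_X_mul, ← totD_lof_succ (lD κ),
        lPoly_totD, lPoly_lof]
      conv_rhs => rw [hq]
      rw [MvPolynomial.rename_C, mul_comm, MvPolynomial.smul_eq_C_mul]
  · rintro ⟨w, rfl⟩
    induction w using Finsupp.induction_linear with
    | zero => simp
    | add v w hv hw => rw [map_add, map_add, hv, hw, add_zero]
    | single b a =>
      obtain ⟨b | t, hb⟩ := b
      · simp [letterDeg] at hb
      · have h1 := h.aeval_eq_zero t
        rw [linForm, Finsupp.linearCombination_apply, Finsupp.sum, map_sum] at h1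
        rw [lD, Finsupp.linearCombination_single, map_smul, lEps, Finsupp.linearCombination_mapDomain,
          Finsupp.linearCombination_apply, Finsupp.sum]
        simp only [map_smul, MvPolynomial.aeval_X] at h1
        exact (congrArg (a • ·) h1).trans (smul_zero a)

lemma range_lEps (x : ι → A) :
    LinearMap.range (lEps x : LMod A ι T 0 →ₗ[A] A) = Ideal.span (Set.range x) := by
  rw [lEps, Finsupp.range_linearCombination]
  congr 1
  ext a
  constructor
  · rintro ⟨⟨b | t, hb⟩, rfl⟩
    · exact ⟨b, rfl⟩
    · simp [letterDeg] at hb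
  · rintro ⟨b, rfl⟩
    exact ⟨⟨.inl b, rfl⟩, rfl⟩

end
end DerivedSymmetricPower
end

/-! ### Homogeneous polynomials vanishing on a regular pair -/

section
open CategoryTheory AlgebraicGeometry TopologicalSpace Limits
namespace DerivedSymmetricPower
section
variable {A : Type u} [CommRing A]

/-- The only monomial of this degree not divisible by `X 0` is a power of `X 1`. This splitting
drives both inductions on the degree below. -/
lemma exists_eq_X_zero_mul_add {n : ℕ} {p : MvPolynomial (Fin 2) A} (hp : p.IsHomogeneous (n + 1)) :
    ∃ p' : MvPolynomial (Fin 2) A, p'.IsHomogeneous n ∧ ∃ c : A,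
      p = MvPolynomial.X 0 * p' + MvPolynomial.C c * MvPolynomial.X 1 ^ (n + 1) := by
  have hp' : p ∈ MvPolynomial.homogeneousSubmodule (Fin 2) A (n + 1) := hp
  rw [homogeneousSubmodule_eq_span_prod] at hp'
  clear hp
  induction hp' using Submodule.span_induction with
  | mem p hp =>
    obtain ⟨u, rfl⟩ := hp
    by_cases h : ∃ i, u i = 0
    · obtain ⟨i, hi⟩ := h
      refine ⟨∏ l, MvPolynomial.X (u (i.succAbove l)), ?_, 0, ?_⟩
      · have : (∏ l : Fin n, MvPolynomial.X (u (i.succAbove l)) : MvPolynomial (Fin 2) A) ∈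
            MvPolynomial.homogeneousSubmodule (Fin 2) A n := by
          rw [homogeneousSubmodule_eq_span_prod]
          exact Submodule.subset_span ⟨_, rfl⟩
        exact this
      · simp only []
        rw [Fin.prod_univ_succAbove _ i, hi]
        simp
    · push Not at h
      refine ⟨0, MvPolynomial.isHomogeneous_zero _ _ _, 1, ?_⟩
      have h1 : ∀ i, u i = 1 := fun i => by have := h i; omega
      simp [h1]
  | zero => exact ⟨0, MvPolynomial.isHomogeneous_zero _ _ _, 0, by simp⟩
  | add p q _ _ hp hq =>
    obtain ⟨p', h1, c, rfl⟩ := hp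
    obtain ⟨q', h2, d, rfl⟩ := hq
    exact ⟨p' + q', h1.add h2, c + d, by rw [map_add]; ring⟩
  | smul a p _ hp =>
    obtain ⟨p', h1, c, rfl⟩ := hp
    refine ⟨MvPolynomial.C a * p', ?_, a * c, ?_⟩
    · simpa using (MvPolynomial.isHomogeneous_C _ a).mul h1
    · rw [map_mul, MvPolynomial.smul_eq_C_mul]; ring

/-- The Koszul form `x₁ X₀ - x₀ X₁`. -/
def koszulForm (x : Fin 2 → A) : MvPolynomial (Fin 2) A :=
  MvPolynomial.C (x 1) * MvPolynomial.X 0 - MvPolynomial.C (x 0) * MvPolynomial.X 1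

lemma eq_C_of_isHomogeneous_zero {σ : Type*} {p : MvPolynomial σ A} (hp : p.IsHomogeneous 0) :
    p = MvPolynomial.C (p.coeff 0) := by
  rwa [← MvPolynomial.totalDegree_zero_iff_isHomogeneous,
    MvPolynomial.totalDegree_eq_zero_iff_eq_C] at hp

/-- Write `q = X₀ q' + c X₁^n`. The coefficient of `X₁^(n+1)` in the product is `-x₀ c`, so `c = 0`.
Then the factor `X₀` cancels and `q'` has smaller degree. -/
lemma eq_zero_of_koszulForm_mul {x : Fin 2 → A} (h0 : ∀ a, x 0 * a = 0 → a = 0) {n : ℕ}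
    {q : MvPolynomial (Fin 2) A} (hq : q.IsHomogeneous n) (h : koszulForm x * q = 0) : q = 0 := by
  have key : ∀ (m : ℕ) (c : A) (r : MvPolynomial (Fin 2) A),
      MvPolynomial.X 0 * r - MvPolynomial.C (x 0 * c) * MvPolynomial.X 1 ^ m = 0 → c = 0 := by
    intro m c r hr
    refine h0 c ?_
    -- Setting `X₀ = 0` isolates the pure power of `X₁`.
    have := congrArg (MvPolynomial.aeval ![(0 : Polynomial A), Polynomial.X]) hr
    rw [map_sub, map_mul, map_mul, map_pow, MvPolynomial.aeval_X, MvPolynomial.aeval_X,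
      MvPolynomial.aeval_C] at this
    have := congrArg (fun f => Polynomial.coeff f m) this
    simpa [← map_mul, Polynomial.algebraMap_eq] using this
  induction n generalizing q with
  | zero =>
    rw [eq_C_of_isHomogeneous_zero hq] at h ⊢
    rw [key 1 (q.coeff 0) (MvPolynomial.C (x 1) * MvPolynomial.C (q.coeff 0)), map_zero]
    rw [← h, koszulForm, map_mul]
    ring
  | succ n ih =>
    obtain ⟨q', hq', c, rfl⟩ := exists_eq_X_zero_mul_add hq
    obtain rfl : c = 0 := by
      refine key (n + 2) c (koszulForm x * q' + MvPolynomial.C (x 1 * c) *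
        MvPolynomial.X 1 ^ (n + 1)) ?_
      rw [← h, koszulForm, map_mul, map_mul]
      ring
    rw [map_zero, zero_mul, add_zero, mul_left_comm] at h
    rw [ih hq' ((MvPolynomial.isRegular_X (n := (0 : Fin 2))).left.mul_left_eq_zero_iff.mp h)]
    simp

/-- Write `p = X₀ p' + c X₁^(n+1)`. Evaluation at `x` shows that `x₀` divides `x₁^(n+1) c`, so `c =
x₀ e` by regularity. Then `p = X₀ (p' + x₁ e X₁^n) - e X₁^n (x₁ X₀ - x₀ X₁)`. The polynomial in the
first bracket vanishes at `x` after cancelling `x₀`, and it has smaller degree. -/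
lemma exists_eq_koszulForm_mul {x : Fin 2 → A} (h0 : ∀ a, x 0 * a = 0 → a = 0)
    (h1 : ∀ a, x 0 ∣ x 1 * a → x 0 ∣ a) (j : ℕ) (p : MvPolynomial (Fin 2) A)
    (hp : p.IsHomogeneous (j + 1)) (h : MvPolynomial.aeval x p = 0) :
    ∃ q : MvPolynomial (Fin 2) A, q.IsHomogeneous j ∧ p = koszulForm x * q := by
  have h1' : ∀ m a, x 0 ∣ x 1 ^ m * a → x 0 ∣ a := by
    intro m
    induction m with
    | zero => simp
    | succ m ih => exact fun a ha => ih a (h1 _ (by rwa [pow_succ', mul_assoc] at ha))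
  induction j generalizing p with
  | zero =>
    obtain ⟨p', hp', c, rfl⟩ := exists_eq_X_zero_mul_add hp
    rw [eq_C_of_isHomogeneous_zero hp'] at h ⊢
    set b := p'.coeff 0
    have h2 : x 0 * b + c * x 1 = 0 := by simpa using h
    obtain ⟨e, rfl⟩ := h1 c ⟨-b, by linear_combination h2⟩
    have h3 : b = - (x 1 * e) := by
      have := h0 (b + x 1 * e) (by linear_combination h2)
      linear_combination this
    refine ⟨MvPolynomial.C (-e), MvPolynomial.isHomogeneous_C _ _, ?_⟩
    rw [h3, koszulForm]
    simp only [map_neg, map_mul]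
    ring
  | succ j ih =>
    obtain ⟨p', hp', c, rfl⟩ := exists_eq_X_zero_mul_add hp
    have h2 : x 0 * MvPolynomial.aeval x p' + c * x 1 ^ (j + 1 + 1) = 0 := by simpa using h
    obtain ⟨e, rfl⟩ := h1' (j + 1 + 1) c ⟨-MvPolynomial.aeval x p', by linear_combination h2⟩
    have hX : ∀ a : A, (MvPolynomial.C a * MvPolynomial.X (1 : Fin 2) ^ (j + 1)).IsHomogeneous (j + 1) :=
      fun a => MvPolynomial.isHomogeneous_C_mul_X_pow a 1 (j + 1)
    obtain ⟨q, hq, hq'⟩ := ih (p' + MvPolynomial.C (x 1 * e) * MvPolynomial.X 1 ^ (j + 1))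
      (hp'.add (hX _)) (h0 _ (by
        rw [map_add, map_mul, map_pow, MvPolynomial.aeval_C, MvPolynomial.aeval_X]
        change x 0 * (_ + x 1 * e * _) = 0
        linear_combination h2))
    refine ⟨MvPolynomial.X 0 * q - MvPolynomial.C e * MvPolynomial.X 1 ^ (j + 1), ?_, ?_⟩
    · refine MvPolynomial.IsHomogeneous.sub ?_ (hX _)
      rw [add_comm]
      exact (MvPolynomial.isHomogeneous_X A 0).mul hq
    · rw [mul_sub, mul_left_comm, ← hq', koszulForm]
      simp only [map_mul]
      ring

open scoped Pointwise in
lemma regular_pair {a b : A} (h : RingTheory.Sequence.IsWeaklyRegular A [a, b]) :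
    (∀ c, a * c = 0 → c = 0) ∧ ∀ c, a ∣ b * c → a ∣ c := by
  rw [RingTheory.Sequence.isWeaklyRegular_cons_iff, RingTheory.Sequence.isWeaklyRegular_cons_iff] at h
  refine ⟨fun c hc => h.1.right_eq_zero_of_smul hc, fun c hc => ?_⟩
  have h1 := h.2.1
  rw [isSMulRegular_quotient_iff_mem_of_smul_mem] at h1
  have hm : ∀ c : A, c ∈ a • (⊤ : Submodule A A) ↔ a ∣ c := by
    intro c
    rw [Submodule.mem_smul_pointwise_iff_exists]
    exact ⟨fun ⟨e, _, he⟩ => ⟨e, he.symm⟩, fun ⟨e, he⟩ => ⟨e, trivial, he.symm⟩⟩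
  exact (hm c).mp (h1 c ((hm _).mpr hc))

lemma linForm_eq_koszulForm (x : Fin 2 → A) :
    linForm (Finsupp.single 0 (x 1) - Finsupp.single 1 (x 0)) = koszulForm x := by
  simp [linForm, koszulForm, MvPolynomial.smul_eq_C_mul]

lemma symKoszul_pair {x : Fin 2 → A} (h : RingTheory.Sequence.IsWeaklyRegular A [x 0, x 1]) :
    SymKoszul (fun _ : Unit => Finsupp.single 0 (x 1) - Finsupp.single 1 (x 0)) x where
  aeval_eq_zero _ := by rw [linForm_eq_koszulForm, koszulForm]; simp [mul_comm]
  exists_mul j p hp h0 := by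
    obtain ⟨q, hq, rfl⟩ := exists_eq_koszulForm_mul (regular_pair h).1 (regular_pair h).2 j p hp h0
    exact Or.inr ⟨(), q, hq, by rw [linForm_eq_koszulForm]⟩
  eq_zero _ j q hq h0 := by
    rw [linForm_eq_koszulForm] at h0
    exact eq_zero_of_koszulForm_mul (regular_pair h).1 hq h0

/-- No odd generator is needed: a homogeneous polynomial in one variable is `c X^(j+1)`, and its
value determines `c`. This case includes the unit ideal, generated by `1`. -/
lemma symKoszul_single {x : Fin 1 → A} (h : IsSMulRegular A (x 0)) :
    SymKoszul (fun t : Empty => t.elim) x where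
  aeval_eq_zero t := t.elim
  exists_mul j p hp h0 := by
    left
    have hp' : p ∈ MvPolynomial.homogeneousSubmodule (Fin 1) A (j + 1) := hp
    rw [homogeneousSubmodule_eq_span_prod, Set.range_unique, Submodule.mem_span_singleton] at hp'
    obtain ⟨c, rfl⟩ := hp'
    have h1 : c * x 0 ^ (j + 1) = 0 := by
      simpa [MvPolynomial.smul_eq_C_mul, Subsingleton.elim _ (0 : Fin 1)] using h0
    have h2 := (h.pow (j + 1)).right_eq_zero_of_smul (x := c) (by rw [smul_eq_mul, mul_comm, h1])
    rw [h2, zero_smul]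
  eq_zero t := t.elim

/-- The zero ideal: without variables there are no nonzero homogeneous polynomials of positive
degree. -/
lemma symKoszul_empty (x : Fin 0 → A) : SymKoszul (fun t : Empty => t.elim) x where
  aeval_eq_zero t := t.elim
  exists_mul j p hp h0 := by
    left
    have hp' : p ∈ MvPolynomial.homogeneousSubmodule (Fin 0) A (j + 1) := hp
    rwa [homogeneousSubmodule_eq_span_prod, Set.range_eq_empty, Submodule.span_empty,
      Submodule.mem_bot] at hp'
  eq_zero t := t.elim

variable {E : ℕ → Type u} [∀ n, AddCommGroup (E n)] [∀ n, Module A (E n)]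

/-- For an ideal generated by a regular sequence of length at most two, the symmetric powers of a
projective resolution are exact. -/
theorem symExact_of_isWeaklyRegular [Algebra ℚ A] [∀ n, Module.Projective A (E n)]
    {d : ∀ n, E (n + 1) →ₗ[A] E n} {ε : E 0 →ₗ[A] A} {rs : List A}
    (hrs : RingTheory.Sequence.IsWeaklyRegular A rs) (hl : rs.length ≤ 2)
    (hd : ∀ n, Function.Exact (d (n + 1)) (d n)) (hε : Function.Exact (d 0) ε)
    (hr : LinearMap.range ε = Ideal.ofList rs) (k : ℕ) : SymExact d ε k := by
  have main : ∀ {ι T : Type} [Subsingleton T] (κ : T → ι →₀ A) (x : ι → A), SymKoszul κ x →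
      Ideal.span (Set.range x) = Ideal.ofList rs → SymExact d ε k := fun κ x h hx =>
    SymExact.of_resolution hd hε h.exact_lD h.exact_lEps (by rw [hr, range_lEps, hx]) (h.symExact k)
  match rs, hl with
  | [], _ => exact main _ _ (symKoszul_empty ![]) (by simp)
  | [a], _ =>
    rw [RingTheory.Sequence.isWeaklyRegular_cons_iff] at hrs
    exact main _ _ (symKoszul_single (x := ![a]) hrs.1) (by simp [Ideal.ofList])
  | [a, b], _ =>
    refine main _ _ (symKoszul_pair (x := ![a, b]) hrs) ?_
    rw [Ideal.ofList]
    congr 1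
    ext c
    simp [eq_comm, or_comm]

end

/-! ### The explicit local form -/

section
variable {R : Type v} [CommRing R]

/-- The exterior square of a free module of rank two is generated by the wedge of the two basis
vectors, so the tensor product reduces to a single copy of `M`. -/
lemma exists_eq_wedge_tmul {M : Type*} [AddCommGroup M] [Module R M]
    (z : (⋀[R]^2 (Fin 2 → R)) ⊗[R] M) :
    ∃ m : M, z = exteriorPower.ιMulti R 2 (Pi.basisFun R (Fin 2)) ⊗ₜ m := by
  have h : ∀ w : ⋀[R]^2 (Fin 2 → R), w ∈ Submodule.span R
      {exteriorPower.ιMulti R 2 (Pi.basisFun R (Fin 2))} := by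
    intro w
    set N := Submodule.span R {exteriorPower.ιMulti R 2 (Pi.basisFun R (Fin 2))}
    have h0 : N.mkQ.compAlternatingMap (exteriorPower.ιMulti R 2) = 0 := by
      refine Module.Basis.ext_alternating (Pi.basisFun R (Fin 2)) fun v hv => ?_
      let σ : Equiv.Perm (Fin 2) := Equiv.ofBijective v (Finite.injective_iff_bijective.mp hv)
      -- An injective pair of indices in `Fin 2` is a permutation, which changes the wedge only by a
      -- sign.
      refine (AlternatingMap.map_perm _ (Pi.basisFun R (Fin 2)) σ).trans ?_
      rw [LinearMap.compAlternatingMap_apply, show N.mkQ _ = 0 from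
        (Submodule.Quotient.mk_eq_zero _).mpr (Submodule.mem_span_singleton_self _), smul_zero]
      rfl
    have h1 : N = ⊤ := by
      rw [eq_top_iff, ← exteriorPower.ιMulti_span, Submodule.span_le]
      rintro _ ⟨v, rfl⟩
      exact (Submodule.Quotient.mk_eq_zero _).mp (congrFun (congrArg DFunLike.coe h0) v)
    rw [h1]
    trivial
  induction z using TensorProduct.induction_on with
  | zero => exact ⟨0, by simp⟩
  | tmul w m =>
    obtain ⟨r, rfl⟩ := Submodule.mem_span_singleton.mp (h w)
    exact ⟨r • m, TensorProduct.smul_tmul _ _ _⟩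
  | add y z hy hz =>
    obtain ⟨m, rfl⟩ := hy
    obtain ⟨n, rfl⟩ := hz
    exact ⟨m + n, (TensorProduct.tmul_add _ _ _).symm⟩

/-- After removing the factor of rank one the differential is multiplication by the Koszul form, so
the two polynomial lemmas apply directly. -/
lemma koszulSymD_wedge (x : Fin 2 → R) (k : ℕ)
    (q : MvPolynomial.homogeneousSubmodule (Fin 2) R k) :
    (koszulSymD x k (exteriorPower.ιMulti R 2 (Pi.basisFun R (Fin 2)) ⊗ₜ q)).1 =
      koszulForm x * q.1 := by
  rw [koszulSymD, TensorProduct.lift.tmul,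
    exteriorPower.alternatingMapLinearEquiv_apply_ιMulti]
  simp [koszulAlternating, koszulFunctional, symMul, koszulForm, Fintype.linearCombination_apply,
    MvPolynomial.smul_eq_C_mul, sub_mul, mul_assoc]

/-- The local form of the symmetric powers of the Koszul complex of a regular sequence of length
two. -/
theorem koszulSymD_exact {x : Fin 2 → R} (h : RingTheory.Sequence.IsWeaklyRegular R [x 0, x 1])
    (k : ℕ) : Function.Injective (koszulSymD x k) ∧
      Function.Exact (koszulSymD x k) (symEval x (k + 1)) ∧
      LinearMap.range (symEval x (k + 1)) = (Ideal.span {x 0, x 1}) ^ (k + 1) := by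
  obtain ⟨h0, h1⟩ := regular_pair h
  refine ⟨(injective_iff_map_eq_zero _).mpr fun z hz => ?_, fun p => ⟨fun hp => ?_, ?_⟩, ?_⟩
  · obtain ⟨q, rfl⟩ := exists_eq_wedge_tmul z
    have := koszulSymD_wedge x k q
    rw [hz] at this
    rw [show q = 0 from Subtype.ext (eq_zero_of_koszulForm_mul h0 q.2 this.symm),
      TensorProduct.tmul_zero]
  · obtain ⟨q, hq, hp'⟩ := exists_eq_koszulForm_mul h0 h1 k p.1 p.2 hp
    exact ⟨_ ⊗ₜ ⟨q, hq⟩, Subtype.ext ((koszulSymD_wedge x k ⟨q, hq⟩).trans hp'.symm)⟩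
  · rintro ⟨z, rfl⟩
    obtain ⟨q, rfl⟩ := exists_eq_wedge_tmul z
    change MvPolynomial.aeval x (koszulSymD x k _).1 = 0
    rw [koszulSymD_wedge, map_mul, koszulForm]
    simp [mul_comm]
  · rw [symEval, LinearMap.range_comp, Submodule.range_subtype, homogeneousSubmodule_eq_span_prod,
      Submodule.map_span, show ({x 0, x 1} : Set R) = Set.range x by ext; simp [eq_comm],
      Ideal.span, Submodule.span_pow]
    congr 1
    ext a
    rw [Set.mem_pow]
    constructor
    · rintro ⟨_, ⟨u, rfl⟩, rfl⟩
      exact ⟨fun i => ⟨x (u i), u i, rfl⟩, by simp [List.prod_ofFn, Fin.prod_univ_succ]⟩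
    · rintro ⟨f, rfl⟩
      choose u hu using fun i => (f i).2
      exact ⟨_, ⟨u, rfl⟩, by simp [List.prod_ofFn, Fin.prod_univ_succ, hu]⟩

end
end DerivedSymmetricPower
end

/-! ### Regular sequences from smoothness -/

section
open CategoryTheory AlgebraicGeometry TopologicalSpace Limits
namespace DerivedSymmetricPower

/-- Membership in an ideal generated by variables is tested on monomials, and multiplication by `X
i` does not change the exponent of `X j` for `j < i`. -/
lemma isWeaklyRegular_ofFn_X (K : Type*) [CommRing K] (r : ℕ) :
    RingTheory.Sequence.IsWeaklyRegular (MvPolynomial (Fin r) K)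
      (List.ofFn fun i : Fin r => (MvPolynomial.X i : MvPolynomial (Fin r) K)) := by
  classical
  rw [RingTheory.Sequence.isWeaklyRegular_iff]
  intro i hi
  have hi' : i < r := by simpa using hi
  have h1 : Ideal.ofList (List.take i (List.ofFn fun i : Fin r => (MvPolynomial.X i : MvPolynomial (Fin r) K)))
      = Ideal.span (MvPolynomial.X '' {j : Fin r | j.1 < i}) := by
    rw [Ideal.ofList]
    congr 1
    ext p
    simp only [Set.mem_ofPred_eq, List.mem_take_iff_getElem, List.length_ofFn, List.getElem_ofFn,
      Set.mem_image]
    constructor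
    · rintro ⟨j, hj, rfl⟩
      exact ⟨⟨j, by omega⟩, by simp; omega, rfl⟩
    · rintro ⟨j, hj, rfl⟩
      exact ⟨j, by have := j.2; simp; omega, rfl⟩
  rw [isSMulRegular_quotient_iff_mem_of_smul_mem, h1, List.getElem_ofFn]
  intro p hp
  simp only [smul_eq_mul, Ideal.mul_top] at hp ⊢
  rw [MvPolynomial.mem_ideal_span_X_image] at hp ⊢
  intro m hm
  obtain ⟨j, hj, hj'⟩ := hp (m + Finsupp.single ⟨i, hi'⟩ 1) (by
    rw [MvPolynomial.mem_support_iff, add_comm, MvPolynomial.coeff_X_mul]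
    exact MvPolynomial.mem_support_iff.mp hm)
  refine ⟨j, hj, fun h => hj' ?_⟩
  have hne : (⟨i, hi'⟩ : Fin r) ≠ j := by
    rintro rfl
    exact lt_irrefl i hj
  rw [Finsupp.add_apply, h, Finsupp.single_eq_of_ne hne.symm, add_zero]

section
variable {A : Type u} [CommRing A] [IsLocalRing A]

/-- The matrix reduces to the identity over the residue field, so its determinant is a unit. -/
lemma bijective_of_residue_eq {r : ℕ} (Φ : (Fin r → A) →ₗ[A] (Fin r → A))
    (h : ∀ i j, IsLocalRing.residue A (Φ (Pi.single j 1) i) = if i = j then 1 else 0) :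
    Function.Bijective Φ := by
  rw [← Module.End.isUnit_iff, LinearMap.isUnit_iff_isUnit_det, ← LinearMap.det_toMatrix']
  refine isUnit_of_map_unit (IsLocalRing.residue A) _ ?_
  rw [RingHom.map_det]
  have : (IsLocalRing.residue A).mapMatrix (LinearMap.toMatrix' Φ) = 1 := by
    ext i j
    rw [RingHom.mapMatrix_apply, Matrix.map_apply, LinearMap.toMatrix'_apply, Matrix.one_apply, h]
  rw [this, Matrix.det_one]
  exact isUnit_one

variable {K : Type u} [Field K] [IsNoetherianRing A] [Algebra K A] [Algebra.FormallySmooth K A]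

/-- A local formally smooth algebra is flat over the polynomial ring on elements whose differentials
are part of a basis. -/
lemma flat_of_retraction {r : ℕ} [Algebra (MvPolynomial (Fin r) K) A]
    [IsScalarTower K (MvPolynomial (Fin r) K) A]
    (ρ : Ω[A⁄K] →ₗ[A] (Fin r → A))
    (h : ∀ i j, IsLocalRing.residue A (ρ (KaehlerDifferential.D K A
      (algebraMap (MvPolynomial (Fin r) K) A (MvPolynomial.X j))) i) = if i = j then 1 else 0) :
    Module.Flat (MvPolynomial (Fin r) K) A := by
  set P := MvPolynomial (Fin r) K
  let b : Module.Basis (Fin r) A (A ⊗[P] Ω[P⁄K]) :=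
    (KaehlerDifferential.mvPolynomialBasis K (Fin r)).baseChange A
  let c := KaehlerDifferential.mapBaseChange K P A
  -- In coordinates `ρ ∘ c` is the identity modulo the maximal ideal, hence invertible. Its inverse
  -- corrects `ρ` to a retraction `s` of `c`.
  let Φ : (Fin r → A) →ₗ[A] (Fin r → A) := ρ ∘ₗ c ∘ₗ b.equivFun.symm.toLinearMap
  have hΦ : Function.Bijective Φ := by
    refine bijective_of_residue_eq Φ fun i j => ?_
    rw [← h]
    refine congrArg (fun y => IsLocalRing.residue A (ρ y i)) ?_
    change c (b.equivFun.symm _) = _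
    rw [Module.Basis.equivFun_symm_apply, Finset.sum_eq_single j]
    · rw [Pi.single_eq_same, one_smul, Module.Basis.baseChange_apply,
        KaehlerDifferential.mvPolynomialBasis_apply]
      exact (KaehlerDifferential.mapBaseChange_tmul K P A _ _).trans
        ((one_smul _ _).trans (KaehlerDifferential.map_D K K P A _))
    · intro l _ hl
      rw [Pi.single_eq_of_ne hl, zero_smul]
    · simp
  let Φ' := LinearEquiv.ofBijective Φ hΦ
  let s : Ω[A⁄K] →ₗ[A] A ⊗[P] Ω[P⁄K] := b.equivFun.symm.toLinearMap ∘ₗ Φ'.symm.toLinearMap ∘ₗ ρ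
  have hs : s ∘ₗ c = LinearMap.id := by
    refine b.ext fun j => ?_
    change b.equivFun.symm (Φ'.symm (ρ (c (b j)))) = b j
    rw [LinearEquiv.symm_apply_eq, LinearEquiv.symm_apply_eq]
    change _ = ρ (c (b.equivFun.symm _))
    rw [LinearEquiv.symm_apply_apply]
  have hc : Function.Injective c := fun x y hxy => by
    rw [← LinearMap.id_apply (R := A) x, ← hs, LinearMap.comp_apply, hxy, ← LinearMap.comp_apply, hs,
      LinearMap.id_apply]
  -- The Jacobi–Zariski sequence: the connecting map is injective because `H1Cotangent K A`
  -- vanishes, and its image lies in the kernel of the injective map `c`.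
  have h1 : Subsingleton (Algebra.H1Cotangent P A) := by
    have e1 : Function.Injective (Algebra.H1Cotangent.δ K P A) := by
      rw [injective_iff_map_eq_zero]
      intro x hx
      obtain ⟨y, rfl⟩ := (Algebra.H1Cotangent.exact_map_δ K P A x).mp hx
      rw [Subsingleton.elim y 0, map_zero]
    refine ⟨fun x y => e1 (hc ?_)⟩
    have e2 := (Algebra.H1Cotangent.exact_δ_mapBaseChange K P A)
    change c _ = c _
    rw [e2.apply_apply_eq_zero, e2.apply_apply_eq_zero]
  -- The split injection `c` makes the relative differentials a direct summand of the projective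
  -- module `Ω[A⁄K]`.
  have h2 : Module.Projective A Ω[A⁄P] := by
    have h0 : ∃ l : Ω[A⁄K] →ₗ[A] A ⊗[P] Ω[P⁄K], l ∘ₗ c = LinearMap.id := ⟨s, hs⟩
    obtain ⟨l, hl⟩ := ((Function.Exact.split_tfae (KaehlerDifferential.exact_mapBaseChange_map K P A)
      hc (KaehlerDifferential.map_surjective K P A)).out 0 1).mpr h0
    exact Module.Projective.of_split l _ hl
  have h3 : Algebra.FormallySmooth P A := ⟨h2, h1⟩
  have h4 : IsNoetherianRing (P ⊗[K] A) := by
    have : Algebra.FiniteType A (A ⊗[K] P) := inferInstance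
    have h5 := Algebra.FiniteType.isNoetherianRing A (A ⊗[K] P)
    exact isNoetherianRing_of_ringEquiv _ (Algebra.TensorProduct.comm K A P).toRingEquiv
  -- Formal smoothness yields flatness because `A` is a quotient of the Noetherian `P`-algebra `P
  -- ⊗[K] A`, a polynomial ring over `A`.
  exact Algebra.FormallySmooth.flat_of_algHom_of_isNoetherianRing (S := P ⊗[K] A)
    (Algebra.TensorProduct.lift (Algebra.ofId P A) (AlgHom.id K A) fun _ _ => Commute.all _ _)
    fun a => ⟨1 ⊗ₜ a, by simp⟩

/-- The kernel of a surjection of smooth local algebras is generated by a regular sequence. -/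
theorem exists_isWeaklyRegular_ker (K A B : Type u) [Field K] [CommRing A] [IsLocalRing A]
    [IsNoetherianRing A] [Algebra K A] [Algebra.FormallySmooth K A] [CommRing B] [Nontrivial B]
    [Algebra K B] [Algebra A B] [IsScalarTower K A B] [Algebra.FormallySmooth K B] (hs : Function.Surjective (algebraMap A B)) :
    ∃ rs : List A, RingTheory.Sequence.IsWeaklyRegular A rs ∧
      Ideal.ofList rs = RingHom.ker (algebraMap A B) := by
  set J := RingHom.ker (algebraMap A B)
  have hJ : J ≤ IsLocalRing.maximalIdeal A := IsLocalRing.le_maximalIdeal (RingHom.ker_ne_top _)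
  let k := IsLocalRing.ResidueField A
  -- A basis of the fibre of `J` at the closed point lifts to generators `f` of `J`, by Nakayama.
  let b₀ := Module.finBasis k (k ⊗[A] J)
  set r := Module.finrank k (k ⊗[A] J)
  have hsurj : Function.Surjective (TensorProduct.mk A k J 1) :=
    TensorProduct.mk_surjective A J k IsLocalRing.residue_surjective
  choose f hf using fun i => hsurj (b₀ i)
  have hspan := IsLocalRing.span_eq_top_of_tmul_eq_basis f b₀ hf
  -- Smoothness of `B` splits the conormal map from `J / J²` to the differentials of `A` restricted
  -- to `B`.
  obtain ⟨l, hl⟩ := (Algebra.FormallySmooth.iff_split_injection (R := K) hs).mp inferInstance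
  let θ : J.Cotangent →ₗ[A] k ⊗[A] J := Submodule.liftQ _ (TensorProduct.mk A k J 1) (by
    rw [Submodule.smul_le]
    intro a ha x _
    rw [LinearMap.mem_ker, map_smul, TensorProduct.mk_apply, TensorProduct.smul_tmul',
      Algebra.smul_def, IsLocalRing.ResidueField.algebraMap_eq,
      (IsLocalRing.residue_eq_zero_iff a).mpr (hJ ha), zero_mul, TensorProduct.zero_tmul])
  -- Through the splitting, the differentials of the `f j` become the standard basis over the
  -- residue field. Projectivity of `Ω[A⁄K]` then lifts `σ` to the map `ρ` with values in `A^r`.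
  let σ : Ω[A⁄K] →ₗ[A] (Fin r → k) := (b₀.equivFun.toLinearMap.restrictScalars A) ∘ₗ θ ∘ₗ l ∘ₗ
    TensorProduct.mk A B Ω[A⁄K] 1
  have hσ : ∀ j, σ (KaehlerDifferential.D K A (f j)) = Pi.single j 1 := by
    intro j
    have h1 : l (1 ⊗ₜ KaehlerDifferential.D K A (f j)) = J.toCotangent (f j) :=
      LinearMap.congr_fun hl (J.toCotangent (f j))
    change b₀.equivFun (θ (l (1 ⊗ₜ _))) = _
    rw [h1]
    change b₀.equivFun (TensorProduct.mk A k J 1 (f j)) = _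
    rw [hf]
    ext i
    rw [Module.Basis.equivFun_self, Pi.single_apply]
    exact if_congr eq_comm rfl rfl
  let π : (Fin r → A) →ₗ[A] (Fin r → k) := LinearMap.compLeft (Algebra.linearMap A k) _
  obtain ⟨ρ, hρ⟩ := Module.projective_lifting_property π σ
    (Function.Surjective.comp_left IsLocalRing.residue_surjective)
  let φ : MvPolynomial (Fin r) K →ₐ[K] A := MvPolynomial.aeval fun i => (f i : A)
  let := φ.toRingHom.toAlgebra
  have : IsScalarTower K (MvPolynomial (Fin r) K) A :=
    IsScalarTower.of_algebraMap_eq' φ.comp_algebraMap.symm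
  have hφ : ∀ i, algebraMap (MvPolynomial (Fin r) K) A (MvPolynomial.X i) = f i :=
    fun i => MvPolynomial.aeval_X _ i
  have hflat : Module.Flat (MvPolynomial (Fin r) K) A := by
    refine flat_of_retraction ρ fun i j => ?_
    rw [hφ]
    have := congrFun ((LinearMap.congr_fun hρ (KaehlerDifferential.D K A (f j))).trans (hσ j)) i
    rw [Pi.single_apply] at this
    exact this
  -- Flat base change carries the regular sequence of variables to the generators `f`.
  refine ⟨_, (isWeaklyRegular_ofFn_X K r).of_flat (S := A), ?_⟩
  have h2 := congrArg (Submodule.map J.subtype) hspan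
  rw [Submodule.map_span, Submodule.map_top, Submodule.range_subtype] at h2
  rw [← h2, Ideal.ofList]
  congr 1
  ext a
  simp [hφ, List.mem_ofFn]

end
end DerivedSymmetricPower
end

/-! ### Bounding the length by the codimension -/

section
open CategoryTheory AlgebraicGeometry TopologicalSpace Limits
namespace DerivedSymmetricPower

/-- Inside the maximal ideal a weakly regular sequence is regular, and each of its elements lowers
the dimension by one. -/
lemma length_le_of_isWeaklyRegular {A : Type*} [CommRing A] [IsLocalRing A] [IsNoetherianRing A]
    {rs : List A} (h : RingTheory.Sequence.IsWeaklyRegular A rs)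
    (hm : Ideal.ofList rs ≤ IsLocalRing.maximalIdeal A) {d : ℕ} (hd : ringKrullDim A ≤ d) :
    rs.length ≤ d := by
  have hne : Ideal.ofList rs ≠ ⊤ :=
    ne_top_of_le_ne_top (Ideal.IsPrime.ne_top inferInstance) hm
  have h1 := ringKrullDim_add_length_eq_ringKrullDim_of_isRegular rs ⟨h, by
    rw [smul_eq_mul, Ideal.mul_top]; exact hne.symm⟩
  have := Ideal.Quotient.nontrivial_iff.mpr hne
  have h2 : (rs.length : WithBot ℕ∞) ≤ d := by
    refine le_trans ?_ hd
    rw [← h1]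
    exact le_add_of_nonneg_left ringKrullDim_nonneg_of_nontrivial
  exact_mod_cast h2

/-- The sequence is found at `P`, but the dimension there may be large. After localizing further at
`P'` it stays weakly regular by flatness and still generates a proper ideal, because `P'` contains
the kernel. The dimension of `A'` therefore bounds its length. -/
theorem exists_isWeaklyRegular_localization (K S Q A A' : Type u) [Field K] [CommRing S]
    [Algebra K S] [Algebra.FormallySmooth K S] [IsNoetherianRing S] [CommRing Q] [Algebra K Q]
    [Algebra.FormallySmooth K Q] [Algebra S Q] [IsScalarTower K S Q]
    (hs : Function.Surjective (algebraMap S Q)) (P P' : Ideal S) [P.IsPrime] [P'.IsPrime]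
    (hQP' : RingHom.ker (algebraMap S Q) ≤ P') (hPP' : P' ≤ P) [CommRing A] [Algebra S A]
    [IsLocalization.AtPrime A P] [CommRing A'] [Algebra S A'] [IsLocalization.AtPrime A' P'] {d : ℕ}
    (hd : ringKrullDim A' ≤ d) :
    ∃ rs : List A, rs.length ≤ d ∧ RingTheory.Sequence.IsWeaklyRegular A rs ∧
      Ideal.ofList rs = (RingHom.ker (algebraMap S Q)).map (algebraMap S A) := by
  have := IsLocalization.AtPrime.isLocalRing A P
  have := IsLocalization.AtPrime.isLocalRing A' P'
  have : IsNoetherianRing A := IsLocalization.isNoetherianRing P.primeCompl A inferInstance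
  have : IsNoetherianRing A' := IsLocalization.isNoetherianRing P'.primeCompl A' inferInstance
  let := ((algebraMap S A).comp (algebraMap K S)).toAlgebra
  have : IsScalarTower K S A := IsScalarTower.of_algebraMap_eq' rfl
  have : Algebra.FormallySmooth S A := .of_isLocalization P.primeCompl
  have : Algebra.FormallySmooth K A := .comp K S A
  let N : Submonoid Q := P.primeCompl.map (algebraMap S Q)
  let B := Localization N
  have : Algebra.FormallySmooth Q B := .of_isLocalization N
  have : Algebra.FormallySmooth K B := .comp K Q B
  let g : A →+* B := IsLocalization.map B (algebraMap S Q) P.primeCompl.le_comap_map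
  let := g.toAlgebra
  have : IsScalarTower K A B := IsScalarTower.of_algebraMap_eq fun c => by
    change _ = g (algebraMap S A (algebraMap K S c))
    rw [IsLocalization.map_eq, ← IsScalarTower.algebraMap_apply K S Q,
      ← IsScalarTower.algebraMap_apply K Q B]
  have hker : RingHom.ker (algebraMap A B) = (RingHom.ker (algebraMap S Q)).map (algebraMap S A) :=
    IsLocalization.ker_map (M := P.primeCompl) B (g := algebraMap S Q) rfl
  have hlt : (RingHom.ker (algebraMap S Q)).map (algebraMap S A) ≤ IsLocalRing.maximalIdeal A := by
    rw [Ideal.map_le_iff_le_comap]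
    exact (hQP'.trans hPP').trans (IsLocalization.AtPrime.under_maximalIdeal A P).ge
  -- The kernel lies in `P`, so it generates a proper ideal of `A` and the localized quotient is not
  -- zero.
  have : Nontrivial B := by
    by_contra hB
    rw [not_nontrivial_iff_subsingleton] at hB
    have h1 : (1 : A) ∈ RingHom.ker (algebraMap A B) := Subsingleton.elim _ _
    rw [hker] at h1
    exact (Ideal.ne_top_iff_one _).mp (Ideal.IsPrime.ne_top inferInstance) (hlt h1)
  obtain ⟨rs, hrs, hrs'⟩ := exists_isWeaklyRegular_ker K A B
    (IsLocalization.map_surjective_of_surjective P.primeCompl A B hs)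
  rw [hker] at hrs'
  refine ⟨rs, ?_, hrs, hrs'⟩
  have hle : P.primeCompl ≤ P'.primeCompl := fun s hs h => hs (hPP' h)
  let := IsLocalization.localizationAlgebraOfSubmonoidLe A A' P.primeCompl P'.primeCompl hle
  have := IsLocalization.localization_isScalarTower_of_submonoid_le A A' P.primeCompl P'.primeCompl hle
  have := IsLocalization.isLocalization_of_submonoid_le A A' P.primeCompl P'.primeCompl hle
  have : Module.Flat A A' := IsLocalization.flat A' (P'.primeCompl.map (algebraMap S A))
  rw [← List.length_map (f := algebraMap A A')]
  refine length_le_of_isWeaklyRegular hrs.of_flat ?_ hd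
  rw [← Ideal.map_ofList, hrs', Ideal.map_map, ← IsScalarTower.algebraMap_eq,
    Ideal.map_le_iff_le_comap]
  exact hQP'.trans (IsLocalization.AtPrime.under_maximalIdeal A' P').ge

end DerivedSymmetricPower
end

/-! ### The ideal of a smooth closed subscheme at a point -/

section
open CategoryTheory AlgebraicGeometry TopologicalSpace Limits
namespace DerivedSymmetricPower

lemma mem_primeIdealOf_iff {X : Scheme.{u}} {U : X.Opens} (hU : IsAffineOpen U) (x : U)
    (f : Γ(X, U)) : f ∈ (hU.primeIdealOf x).asIdeal ↔ x.1 ∉ X.basicOpen f := by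
  have := hU.isLocalization_stalk x
  rw [X.mem_basicOpen f x.1 x.2, ← IsLocalization.AtPrime.to_map_mem_maximal_iff
    (X.presheaf.stalk x.1) (hU.primeIdealOf x).asIdeal, IsLocalRing.mem_maximalIdeal, mem_nonunits_iff]
  rfl

/-- The ideal of a smooth closed subscheme of a smooth scheme is locally generated by a regular
sequence, whose length is bounded by the codimension. -/
theorem exists_isWeaklyRegular_stalk {K : Type u} [Field K] {M Z : Scheme.{u}}
    (p : M ⟶ Spec (CommRingCat.of K)) [Smooth p] (i : Z ⟶ M) [IsClosedImmersion i]
    [Smooth (i ≫ p)] {d : ℕ} (hd : ∀ z : Z, closure {z} ∈ irreducibleComponents Z →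
    ringKrullDim (M.presheaf.stalk (i z)) ≤ d) (x : M) :
    ∃ rs : List (M.presheaf.stalk x), rs.length ≤ max d 1 ∧
      RingTheory.Sequence.IsWeaklyRegular (M.presheaf.stalk x) rs ∧
      Ideal.ofList rs = LinearMap.range (stkIdealInclusion i.ker x) := by
  obtain ⟨_, ⟨V, hV', rfl⟩, hx, -⟩ := M.isBasis_affineOpens.exists_subset_of_mem_open
      (show x ∈ ((⊤ : M.Opens) : Set M) from trivial) (⊤ : M.Opens).isOpen
  have hV : IsAffineOpen V := hV'
  rw [range_stkIdealInclusion ⟨V, hV⟩ hx]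
  by_cases hxi : x ∈ Set.range i
  · obtain ⟨z, rfl⟩ := hxi
    -- The generic point `η` of a component of `Z` through the given point; the codimension
    -- hypothesis applies only to such points.
    have hirr := isIrreducible_irreducibleComponent (x := z)
    let η := hirr.genericPoint
    have hη : closure {η} = irreducibleComponent z :=
      hirr.isGenericPoint_genericPoint isClosed_irreducibleComponent
    have hηz : i η ⤳ i z := by
      refine Specializes.map ?_ i.continuous
      rw [specializes_iff_mem_closure, hη]
      exact mem_irreducibleComponent
    have hηV : i η ∈ V := hηz.mem_open V.isOpen hx
    have hdη := hd η (hη ▸ irreducibleComponent_mem_irreducibleComponents z)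
    let S := Γ(M, V)
    let Q := Γ(Z, i ⁻¹ᵁ V)
    let φ : K →+* S := (p.appLE ⊤ V le_top).hom.comp
      (Scheme.ΓSpecIso (CommRingCat.of K)).inv.hom
    have hφ : φ.Smooth := (RingHom.Smooth.of_bijective
      (ConcreteCategory.bijective_of_isIso (Scheme.ΓSpecIso (CommRingCat.of K)).inv)).comp
      (p.smooth_appLE (isAffineOpen_top _) hV le_top)
    have hψ : ((i.app V).hom.comp φ).Smooth := by
      have h1 := (RingHom.Smooth.of_bijective
        (ConcreteCategory.bijective_of_isIso (Scheme.ΓSpecIso (CommRingCat.of K)).inv)).comp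
        ((i ≫ p).smooth_appLE (isAffineOpen_top _) (hV.preimage i) le_top)
      have h2 := Scheme.Hom.appLE_comp_appLE i p ⊤ V (i ⁻¹ᵁ V) le_top le_rfl
      rw [← h2, Scheme.Hom.appLE_eq_app] at h1
      exact h1
    let := φ.toAlgebra
    let := (i.app V).hom.toAlgebra
    let := ((i.app V).hom.comp φ).toAlgebra
    have : IsScalarTower K S Q := IsScalarTower.of_algebraMap_eq' rfl
    have : Algebra.FormallySmooth K S := hφ.formallySmooth
    have : Algebra.FormallySmooth K Q := hψ.formallySmooth
    have : Algebra.FinitePresentation K S := hφ.finitePresentation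
    have : Algebra.FiniteType K S := inferInstance
    have : IsNoetherianRing S := Algebra.FiniteType.isNoetherianRing K S
    let : Algebra S (M.presheaf.stalk (i z)) := M.presheaf.algebra_section_stalk ⟨_, hx⟩
    let : Algebra S (M.presheaf.stalk (i η)) := M.presheaf.algebra_section_stalk ⟨_, hηV⟩
    have := hV.isLocalization_stalk ⟨_, hx⟩
    have := hV.isLocalization_stalk ⟨_, hηV⟩
    have hker : RingHom.ker (algebraMap S Q) = i.ker.ideal ⟨V, hV⟩ := (i.ker_apply ⟨V, hV⟩).symm
    -- A function that restricts to zero on `Z` has empty nonvanishing locus there, so it vanishes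
    -- at the image of `η`.
    have hle1 : RingHom.ker (algebraMap S Q) ≤ (hV.primeIdealOf ⟨_, hηV⟩).asIdeal := by
      refine fun f hf => (mem_primeIdealOf_iff hV _ f).mpr fun hfη => ?_
      change η ∈ i ⁻¹ᵁ M.basicOpen f at hfη
      rw [Scheme.preimage_basicOpen, show i.app V f = 0 from hf, Scheme.basicOpen_zero] at hfη
      exact hfη
    have hle2 : (hV.primeIdealOf ⟨_, hηV⟩).asIdeal ≤ (hV.primeIdealOf ⟨_, hx⟩).asIdeal := by
      refine fun f hf => (mem_primeIdealOf_iff hV _ f).mpr fun h => ?_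
      exact (mem_primeIdealOf_iff hV _ f).mp hf (hηz.mem_open (M.basicOpen f).isOpen h)
    obtain ⟨rs, h1, h2, h3⟩ := exists_isWeaklyRegular_localization K S Q
      (M.presheaf.stalk (i z)) (M.presheaf.stalk (i η)) (i.app_surjective V hV) _ _ hle1 hle2 hdη
    exact ⟨rs, h1.trans (le_max_left _ _), h2, by rw [h3, hker]; rfl⟩
  -- Off `Z` the stalk of the ideal is the unit ideal, generated by the sequence `[1]`; this
  -- accounts for the `1` in `max d 1`.
  · refine ⟨[1], le_max_right _ _, ?_, ?_⟩
    · rw [RingTheory.Sequence.isWeaklyRegular_cons_iff]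
      exact ⟨IsSMulRegular.one _, RingTheory.Sequence.IsWeaklyRegular.nil _ _⟩
    · have h1 : x ∉ i.ker.support := by
        have := i.support_ker
        rw [i.isClosedEmbedding.isClosed_range.closure_eq] at this
        rwa [← SetLike.mem_coe, this]
      rw [Scheme.IdealSheafData.mem_support_iff_of_mem (U := ⟨V, hV⟩) hx, Scheme.mem_zeroLocus_iff] at h1
      push Not at h1
      obtain ⟨f, hf, hxf⟩ := h1
      rw [M.mem_basicOpen f x hx] at hxf
      rw [Ideal.ofList_singleton, Ideal.span_singleton_one, eq_comm]
      exact Ideal.eq_top_of_isUnit_mem _ (Ideal.mem_map_of_mem _ hf) hxf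

end DerivedSymmetricPower
end

/-! ### The global theorem -/

section
open CategoryTheory AlgebraicGeometry TopologicalSpace Limits
namespace DerivedSymmetricPower

/-- The multiplication map on derived symmetric powers of the ideal of a smooth closed subscheme of
codimension at most two is a quasi-isomorphism. -/
theorem quasiIso_symPowerMul_of_smooth {K : Type u} [Field K] [CharZero K] {M Z : Scheme.{u}}
    (p : M ⟶ Spec (CommRingCat.of K)) [Smooth p] (i : Z ⟶ M) [IsClosedImmersion i]
    [Smooth (i ≫ p)] (hd : ∀ z : Z, closure {z} ∈ irreducibleComponents Z →
      ringKrullDim (M.presheaf.stalk (i z)) ≤ 2) (k : ℕ) {E : ChainComplex M.Modules ℕ}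
    (ε : E ⟶ (ChainComplex.single₀ M.Modules).obj (idealModule i.ker))
    (hE : ∀ n, (E.X n).IsLocallyFree) (hε : QuasiIso ε) : QuasiIso (symPowerMul ε k) := by
  refine quasiIso_symPowerMul_of_stk ε k (fun x => ?_) (range_stkEps hε)
  obtain ⟨rs, h1, h2, h3⟩ := exists_isWeaklyRegular_stalk p i (d := 2) hd x
  let A := M.presheaf.stalk x
  let φ : K →+* A := (M.presheaf.germ ⊤ x trivial).hom.comp
    (((p.appLE ⊤ ⊤ le_top).hom).comp (Scheme.ΓSpecIso (CommRingCat.of K)).inv.hom)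
  -- Characteristic zero enters here: the local ring is a `K`-algebra, hence a `ℚ`-algebra, and
  -- averaging is available.
  let : Algebra ℚ A := (φ.comp (algebraMap ℚ K)).toAlgebra
  have : ∀ n, Module.Projective A (Stk (E.X n) x) := fun n => by
    have := hE n
    have := free_stk (E.X n) x
    infer_instance
  have key : SymExact (A := A) (E := fun m => Stk (E.X m) x) (stkD E x) (stkEps (augZero ε) x) k :=
    symExact_of_isWeaklyRegular h2 h1 (stkD_exact hε x) (stkEps_exact hε x)
      ((range_stkEps hε x).trans h3.symm) k
  refine ⟨fun n z => ⟨fun hz => ?_, ?_⟩, fun z hz => ?_,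
    exists_mulMap_eq (A := A) (E := fun m => Stk (E.X m) x) (stkEps (augZero ε) x) k⟩
  · obtain ⟨w, hw, hwz⟩ := key.exists_succ n z.1 z.2 (congrArg Subtype.val hz)
    exact ⟨⟨w, hw⟩, Subtype.ext hwz⟩
  · rintro ⟨w, rfl⟩
    have hdd : ∀ n, (stkD E x n).comp (stkD E x (n + 1)) = 0 := fun n =>
      (stkD_exact hε x n).linearMap_comp_eq_zero
    exact Subtype.ext (tensorD_tensorD (E := fun m => Stk (E.X m) x) _ hdd k w.1)
  · obtain ⟨w, hw, hwz⟩ := key.exists_zero z.1 z.2 hz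
    exact ⟨⟨w, hw⟩, Subtype.ext hwz⟩

end DerivedSymmetricPower
end

end

/-- The codimension of a component is measured by the dimension of the local ring of `M` at its
generic point. In the local form the exponent is written `k + 1`, which encodes that it is at least
one. -/
theorem mainTheorem2 :
    (∀ (K : Type u) [Field K] [CharZero K] (M Z : AlgebraicGeometry.Scheme.{u})
      (p : M ⟶ AlgebraicGeometry.Spec (CommRingCat.of K))
      [AlgebraicGeometry.Smooth p] [AlgebraicGeometry.IsSeparated p]
      [AlgebraicGeometry.QuasiCompact p]
      (i : Z ⟶ M) [AlgebraicGeometry.IsClosedImmersion i] [AlgebraicGeometry.Smooth (i ≫ p)],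
      (∀ z : Z, closure {z} ∈ irreducibleComponents Z →
        ringKrullDim (M.presheaf.stalk (i z)) ≤ 2) →
      ∀ (k : ℕ) (E : ChainComplex M.Modules ℕ)
        (ε : E ⟶ (ChainComplex.single₀ M.Modules).obj (DerivedSymmetricPower.idealModule i.ker)),
        (∀ n, (E.X n).IsLocallyFree) → QuasiIso ε →
          QuasiIso (DerivedSymmetricPower.symPowerMul ε k)) ∧
    (∀ (R : Type v) [CommRing R] (x : Fin 2 → R),
      RingTheory.Sequence.IsRegular R [x 0, x 1] → ∀ k : ℕ,
        Function.Injective (DerivedSymmetricPower.koszulSymD x k) ∧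
        Function.Exact (DerivedSymmetricPower.koszulSymD x k)
          (DerivedSymmetricPower.symEval x (k + 1)) ∧
        LinearMap.range (DerivedSymmetricPower.symEval x (k + 1)) =
          Ideal.span {x 0, x 1} ^ (k + 1)) :=
  ⟨fun _ _ _ _ _ p _ _ _ i _ _ hd k _ ε hE hε =>
    DerivedSymmetricPower.quasiIso_symPowerMul_of_smooth p i hd k ε hE hε,
  fun _ _ _ h k => DerivedSymmetricPower.koszulSymD_exact h.toIsWeaklyRegular k⟩
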